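/- **Theorem (near-additive pairwise spanners).** Let $G=(V,E)$ be an unweighted undirected graph with $n$ nodes, let $\mathcal P\subseteq V\times V$ and let $\varepsilon>0$. There is a polynomial time algorithm that computes a subgraph $H\subseteq G$ such that $$\delta_H(s,t)\le(1+\varepsilon)\,\delta_G(s,t)+4\qquad\text{for every }(s,t)\in\mathcal P,$$ where $\delta$ denotes the distance (number of edges of a shortest path, $\infty$ if there is no path). The number of edges of $H$ is $$O\!\left(n+n\,|\mathcal P|^{1/4}\sqrt{\frac{\log n}{\varepsilon}}\right),$$ and, if $\varepsilon\le 1$, it is $$O\!\left(n\,|\mathcal P|^{1/4}\sqrt{\frac{\log n}{\varepsilon}}\right).$$ The constants hidden in the $O$ are absolute. A single algorithm serves all $G$, $\mathcal P$ and $\varepsilon$: its input consists of $G$, $\mathcal P$ and two positive integers $a,b$ with $a/b\le\varepsilon\le 2a/b$ (for rational $\varepsilon$ one may take $a/b=\varepsilon$), and its running time is polynomial in the size of this input. -/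

import Mathlib

/-! ### A random access machine with a step count

Programs are structured (assignments, stores, sequencing, branching, loops).  They act on a bank of
registers and on a memory whose cells are addressed by natural numbers, so that a load or a store
can use a computed address.  Addition, truncated subtraction, constants, register accesses, memory
accesses and tests cost one step each.  A product costs one step plus the numbers of bits of its
factors; hence a run of `T` steps only produces numbers whose bit length exceeds the bit lengths in
the input and in the program by `O(T)`, and polynomial time on this machine is polynomial time on
a Turing machine. -/

namespace RAM

/-- The contents of the registers and of the memory. -/
structure Store where
  reg : ℕ → ℕ
  mem : ℕ → ℕ

/-- Arithmetic expressions. -/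
inductive Expr where
  | lit (k : ℕ)
  | reg (i : ℕ)
  | load (addr : Expr)
  | add (e₁ e₂ : Expr)
  | sub (e₁ e₂ : Expr)
  | mul (e₁ e₂ : Expr)

namespace Expr

/-- The value of an expression. -/
def eval (s : Store) : Expr → ℕ
  | lit k => k
  | reg i => s.reg i
  | load e => s.mem (e.eval s)
  | add e₁ e₂ => e₁.eval s + e₂.eval s
  | sub e₁ e₂ => e₁.eval s - e₂.eval s
  | mul e₁ e₂ => e₁.eval s * e₂.eval s

/-- The number of steps that the evaluation of an expression takes. -/
def cost (s : Store) : Expr → ℕ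
  | lit _ => 1
  | reg _ => 1
  | load e => e.cost s + 1
  | add e₁ e₂ => e₁.cost s + e₂.cost s + 1
  | sub e₁ e₂ => e₁.cost s + e₂.cost s + 1
  | mul e₁ e₂ =>
      e₁.cost s + e₂.cost s + 1 + Nat.size (e₁.eval s) + Nat.size (e₂.eval s)

end Expr

/-- Programs.  A test `e` of a branching or of a loop succeeds if the value of `e` is not zero. -/
inductive Prog where
  | skip
  | assign (i : ℕ) (e : Expr)
  | store (addr e : Expr)
  | seq (A B : Prog)
  | ite (e : Expr) (A B : Prog)
  | loop (e : Expr) (A : Prog)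

/-- `Exec A s t s'`: started on the store `s`, the program `A` halts after exactly `t` steps, and
leaves the store `s'`. -/
inductive Exec : Prog → Store → ℕ → Store → Prop where
  | skip (s : Store) : Exec .skip s 1 s
  | assign (s : Store) (i : ℕ) (e : Expr) :
      Exec (.assign i e) s (e.cost s + 1) ⟨Function.update s.reg i (e.eval s), s.mem⟩
  | store (s : Store) (addr e : Expr) :
      Exec (.store addr e) s (addr.cost s + e.cost s + 1)
        ⟨s.reg, Function.update s.mem (addr.eval s) (e.eval s)⟩
  | seq {A B : Prog} {s s' s'' : Store} {t t' : ℕ} (hA : Exec A s t s') (hB : Exec B s' t' s'') :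
      Exec (.seq A B) s (t + t') s''
  | ite_true {e : Expr} {A B : Prog} {s s' : Store} {t : ℕ} (he : e.eval s ≠ 0)
      (hA : Exec A s t s') : Exec (.ite e A B) s (e.cost s + 1 + t) s'
  | ite_false {e : Expr} {A B : Prog} {s s' : Store} {t : ℕ} (he : e.eval s = 0)
      (hB : Exec B s t s') : Exec (.ite e A B) s (e.cost s + 1 + t) s'
  | loop_true {e : Expr} {A : Prog} {s s' s'' : Store} {t t' : ℕ} (he : e.eval s ≠ 0)
      (hA : Exec A s t s') (hL : Exec (.loop e A) s' t' s'') :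
      Exec (.loop e A) s (e.cost s + 1 + t + t') s''
  | loop_false {e : Expr} {A : Prog} {s : Store} (he : e.eval s = 0) :
      Exec (.loop e A) s (e.cost s + 1) s

/-- The initial store on the input `xs`: register `0` holds the length of `xs`, the first cells of
the memory hold its entries, and everything else is zero. -/
def initStore (xs : List ℕ) : Store where
  reg i := if i = 0 then xs.length else 0
  mem i := xs.getD i 0

/-- A store presents the output `ys` if register `0` holds the length of `ys` and the first cells
of the memory hold its entries. -/
def Store.Presents (s : Store) (ys : List ℕ) : Prop :=
  s.reg 0 = ys.length ∧ ∀ i < ys.length, s.mem i = ys.getD i 0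

/-- On the input `xs`, the program `A` halts with the output `ys` after at most `T` steps. -/
def Prog.OutputsWithin (A : Prog) (xs ys : List ℕ) (T : ℕ) : Prop :=
  ∃ t ≤ T, ∃ s : Store, Exec A (initStore xs) t s ∧ s.Presents ys

/-- The size of an input: the total bit length, with one separator for every entry. -/
def inputSize (xs : List ℕ) : ℕ :=
  (xs.map fun x => Nat.size x + 1).sum

end RAM

/-! ### Pairwise spanners and their encoding -/

/-- `H` is a pairwise spanner of `G` on the pairs `P` with stretch function `f`: a subgraph of `G`
with `δ_H(s,t) ≤ f (δ_G(s,t))` for every `(s,t) ∈ P`.  Distances between vertices in different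
components are infinite, so nothing is demanded if `t` cannot be reached from `s` in `G`, and
otherwise `t` must be reachable from `s` in `H`. -/
def IsPairwiseSpanner {V : Type*} (G H : SimpleGraph V) (P : Finset (V × V)) (f : ℕ → ℝ) : Prop :=
  H ≤ G ∧ ∀ s t : V, (s, t) ∈ P → G.Reachable s t →
    H.Reachable s t ∧ (H.dist s t : ℝ) ≤ f (G.dist s t)

open Classical in
/-- The `n × n` matrix of zeros and ones of a binary relation, row by row: the entry with index
`u * n + v` is one if and only if `r u v`. -/
noncomputable def encodeRel {n : ℕ} (r : Fin n → Fin n → Prop) : List ℕ :=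
  List.ofFn fun k : Fin (n * n) => if r k.divNat k.modNat then 1 else 0

/-- A graph on `n` vertices is written down as its adjacency matrix. -/
noncomputable def encodeGraph {n : ℕ} (G : SimpleGraph (Fin n)) : List ℕ :=
  encodeRel G.Adj

/-- The input: the number of vertices, the numerator and the denominator of the rational number
`a / b`, the adjacency matrix of the graph, and the matrix of the set of pairs. -/
noncomputable def encodeInput {n : ℕ} (G : SimpleGraph (Fin n)) (P : Finset (Fin n × Fin n))
    (a b : ℕ) : List ℕ :=
  [n, a, b] ++ encodeGraph G ++ encodeRel fun u v => (u, v) ∈ P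

/-- The bound `n |P|^{1/4} √(log n / ε)`. -/
noncomputable def spannerBound (n N : ℕ) (ε : ℝ) : ℝ :=
  (n : ℝ) * (N : ℝ) ^ (1 / 4 : ℝ) * √(Real.log n / ε)

/-! # Near-additive pairwise spanners

The algorithm computes many candidates, one for each choice of a few parameters below `n`.  It
discards those that do not have the required stretch, and outputs a smallest one of the others, so
that only the existence of one good candidate matters for the number of edges.  There are two kinds.

*Greedy spanners.*  If `ε ≥ log n` or `log |P| ≥ 16 log n / ε`, the greedy spanner with
multiplicative stretch `1 + a / b` is good: its girth is at least about `ε / 2`, so it has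
`O(n ^ (1 + 4 / ε))` edges (`NoShortCycle.ecard_le`, `exists_greedy_le`), and this is `O(n)` or
`O(n |P|^{1/4})`.

*Clusterings.*  Disjoint stars with at least `h` leaves are chosen such that every vertex has at
most `h` neighbours that are no leaves.  There are at most `n / h` centers, and the graph `H₀` of
the stars and of the edges with an endpoint that is no leaf has at most `n + n h` edges
(`IsClustering`).  Among the shortest walks of `G`, those with few edges outside of `H₀` are used.
Such a walk meets at least a third as many stars as it has edges outside of `H₀`, since a star
meets a shortest walk in at most three vertices.  Let `s`, `t` be a pair.

* If the walk has at most `2 τ` edges outside of `H₀`, it is bought entirely.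
* Otherwise, there are small sets `S₁`, `S₂` of centers such that the walk has at most `τ` edges
  outside of `H₀` before it meets the star of some element of `S₁`, and at most `τ` such edges after
  it meets the star of some element of `S₂` (`greedy_hitting`).  These two outer parts are bought,
  and centers in `S₁ ∪ S₂` are joined by walks that are at most by `2` too long.  This yields an
  additive error of `6`, which is allowed if `ε d ≥ 2`, where `d` is the distance of `s` and `t`.
* If `ε d < 2`, all centers within distance `κ ≈ 2 / ε` are joined by shortest walks; then the
  additive error is `4`.

The walks between centers are paid for by a potential, which counts pairs of centers with a
small additive error (`potential_short`, `IsClustering.potential_far`).  The total is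
`n + n h + κ N² + 9 |S₁ ∪ S₂| N + 2 τ |P|` with `N ≤ n / h`, and the choice
`h ≈ |P|^{1/4} √(log n / ε)`, `τ ≈ n h / |P|` gives the bound (`CandidateBound.le`).

*The machine.*  The algorithm is written in a small language of statements on `n × n` matrices
whose entries are defined by terms with sums and minima over the vertices.  There is no product
of numbers in this language, and no loop that depends on data, so a statement takes a number of
steps which is bounded by a polynomial in `n` on the random access machine
(`Stmt.program_outputs`). -/

/-! ### Straight-line reasoning about the machine -/

namespace RAM

/-- Started on `s`, the program `A` halts within `T` steps in a store that satisfies `Q`. -/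
def Runs (A : Prog) (T : ℕ) (s : Store) (Q : Store → Prop) : Prop :=
  ∃ t ≤ T, ∃ s', Exec A s t s' ∧ Q s'

theorem Runs.mono {A : Prog} {T T' : ℕ} {s : Store} {Q Q' : Store → Prop}
    (h : Runs A T s Q) (hT : T ≤ T') (hQ : ∀ s', Q s' → Q' s') : Runs A T' s Q' := by
  obtain ⟨t, ht, s', he, hq⟩ := h
  exact ⟨t, ht.trans hT, s', he, hQ _ hq⟩

theorem Runs.skip {s : Store} {Q : Store → Prop} (h : Q s) : Runs .skip 1 s Q :=
  ⟨1, le_rfl, s, .skip s, h⟩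

theorem Runs.assign {i : ℕ} {e : Expr} {s : Store} {T : ℕ} {Q : Store → Prop}
    (hT : e.cost s + 1 ≤ T) (h : Q ⟨Function.update s.reg i (e.eval s), s.mem⟩) :
    Runs (.assign i e) T s Q :=
  ⟨_, hT, _, .assign s i e, h⟩

theorem Runs.store {a e : Expr} {s : Store} {T : ℕ} {Q : Store → Prop}
    (hT : a.cost s + e.cost s + 1 ≤ T)
    (h : Q ⟨s.reg, Function.update s.mem (a.eval s) (e.eval s)⟩) :
    Runs (.store a e) T s Q :=
  ⟨_, hT, _, .store s a e, h⟩

theorem Runs.seq {A B : Prog} {T T' : ℕ} {s : Store} {Q R : Store → Prop}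
    (hA : Runs A T s R) (hB : ∀ s', R s' → Runs B T' s' Q) : Runs (.seq A B) (T + T') s Q := by
  obtain ⟨t, ht, s', he, hr⟩ := hA
  obtain ⟨t', ht', s'', he', hq⟩ := hB s' hr
  exact ⟨t + t', by omega, s'', .seq he he', hq⟩

theorem Runs.ite {e : Expr} {A B : Prog} {T : ℕ} {s : Store} {Q : Store → Prop}
    (hA : e.eval s ≠ 0 → Runs A T s Q) (hB : e.eval s = 0 → Runs B T s Q) :
    Runs (.ite e A B) (e.cost s + 1 + T) s Q := by
  by_cases h : e.eval s = 0
  · obtain ⟨t, ht, s', he, hq⟩ := hB h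
    exact ⟨_, by omega, s', .ite_false h he, hq⟩
  · obtain ⟨t, ht, s', he, hq⟩ := hA h
    exact ⟨_, by omega, s', .ite_true h he, hq⟩

/-- The program that runs `A` with register `x` counting from `0` up to, and excluding, the content
of register `1`. -/
def Prog.count (x : ℕ) (A : Prog) : Prog :=
  .seq (.assign x (.lit 0))
    (.loop (.sub (.reg 1) (.reg x)) (.seq A (.assign x (.add (.reg x) (.lit 1)))))

theorem Runs.count {x : ℕ} {A : Prog} {n T : ℕ} {s : Store} (Inv : ℕ → Store → Prop)
    (hx : x ≠ 1) (hn : s.reg 1 = n)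
    (h0 : Inv 0 ⟨Function.update s.reg x 0, s.mem⟩)
    (hstep : ∀ i < n, ∀ s, s.reg x = i → s.reg 1 = n → Inv i s →
      Runs A T s fun s' => s'.reg x = i ∧ s'.reg 1 = n ∧
        Inv (i + 1) ⟨Function.update s'.reg x (i + 1), s'.mem⟩) :
    Runs (.count x A) (n * (T + 8) + 6) s
      fun s' => s'.reg x = n ∧ s'.reg 1 = n ∧ Inv n s' := by
  have key : ∀ d i, i + d = n → ∀ s, s.reg x = i → s.reg 1 = n → Inv i s →
      Runs (.loop (.sub (.reg 1) (.reg x)) (.seq A (.assign x (.add (.reg x) (.lit 1)))))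
        (d * (T + 8) + 4) s fun s' => s'.reg x = n ∧ s'.reg 1 = n ∧ Inv n s' := by
    intro d
    induction d with
    | zero =>
      intro i hi s hsx hs1 hI
      have hin : i = n := by omega
      subst hin
      exact ⟨_, by simp [Expr.cost], s, .loop_false (by simp [Expr.eval, hsx, hs1]), hsx, hs1, hI⟩
    | succ d ih =>
      intro i hi s hsx hs1 hI
      obtain ⟨t, ht, s1, he1, hs1x, hs11, hI1⟩ := hstep i (by omega) s hsx hs1 hI
      obtain ⟨t', ht', s2, he2, hq⟩ := ih (i + 1) (by omega)
        ⟨Function.update s1.reg x (i + 1), s1.mem⟩ (by simp)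
        (by simp [Ne.symm hx, hs11]) hI1
      have he3 := Exec.assign s1 x (.add (.reg x) (.lit 1))
      simp only [Expr.eval, hs1x, Expr.cost] at he3
      refine ⟨_, ?_, s2, .loop_true ?_ (.seq he1 he3) he2, hq⟩
      · simp only [Expr.cost]
        have : (d + 1) * (T + 8) = d * (T + 8) + T + 8 := by ring
        omega
      · simp only [Expr.eval, hsx, hs1]; omega
  refine (Runs.seq (T := 2) (T' := n * (T + 8) + 4)
    (R := fun s' => s' = ⟨Function.update s.reg x 0, s.mem⟩)
    (Runs.assign (by simp [Expr.cost]) (by simp [Expr.eval]))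
    (fun s' hs' => ?_)).mono (le_of_eq (by ring)) (fun _ h => h)
  · subst hs'
    exact key n 0 (by simp) _ (by simp) (by simp [Ne.symm hx, hn]) h0

end RAM

/-! ### Matrix programs -/

namespace MatProg

/-- The read-only data of a matrix program on `n` vertices: two matrices and two numbers. -/
structure Inst (n : ℕ) where
  graph : Fin n → Fin n → ℕ
  pairs : Fin n → Fin n → ℕ
  numer : ℕ
  denom : ℕ

/-- Numerical terms.  Variables `x`, `y` range over the `n` vertices; `entry k x y` is an entry of
the `k`-th working matrix; `sum` and `inf` bind a variable.  There is no product, so that the time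
which the evaluation takes depends on `n` only, and not on the values. -/
inductive Term where
  | lit (c : ℕ)
  | size
  | numer
  | denom
  | graph (x y : ℕ)
  | pairs (x y : ℕ)
  | entry (k x y : ℕ)
  | idx (x : ℕ)
  | add (t u : Term)
  | sub (t u : Term)
  | ite (c t u : Term)
  | sum (x : ℕ) (t : Term)
  | inf (x : ℕ) (t : Term)

/-- The working matrices. -/
abbrev Mats (n : ℕ) := ℕ → Fin n → Fin n → ℕ

/-- The values of the variables. -/
abbrev Env (n : ℕ) := ℕ → Fin n

/-- The value of a term. -/
noncomputable def Term.eval {n : ℕ} (I : Inst n) (σ : Mats n) : Term → Env n → ℕ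
  | lit c, _ => c
  | size, _ => n
  | numer, _ => I.numer
  | denom, _ => I.denom
  | graph x y, e => I.graph (e x) (e y)
  | pairs x y, e => I.pairs (e x) (e y)
  | entry k x y, e => σ k (e x) (e y)
  | idx x, e => e x
  | add t u, e => t.eval I σ e + u.eval I σ e
  | sub t u, e => t.eval I σ e - u.eval I σ e
  | ite c t u, e => if c.eval I σ e ≠ 0 then t.eval I σ e else u.eval I σ e
  | sum x t, e => ∑ i : Fin n, t.eval I σ (Function.update e x i)
  | inf x t, e => ⨅ i : Fin n, t.eval I σ (Function.update e x i)

/-- Statements.  `fill k t` replaces all entries of the `k`-th working matrix at once by the values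
of `t`, with the variables `0` and `1` bound to the row and the column; `loop x S` runs `S` with `x`
bound to each vertex in turn. -/
inductive Stmt where
  | fill (k : ℕ) (t : Term)
  | seq (S S' : Stmt)
  | loop (x : ℕ) (S : Stmt)

/-- `f` applied for the first `i` indices in turn. -/
def foldUpTo {n : ℕ} {α : Type*} (f : Fin n → α → α) (a : α) : ℕ → α
  | 0 => a
  | i + 1 => if h : i < n then f ⟨i, h⟩ (foldUpTo f a i) else foldUpTo f a i

/-- The working matrices after a statement. -/
noncomputable def Stmt.run {n : ℕ} (I : Inst n) : Stmt → Env n → Mats n → Mats n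
  | fill k t, e, σ => Function.update σ k fun i j =>
      t.eval I σ (Function.update (Function.update e 0 i) 1 j)
  | seq S S', e, σ => S'.run I e (S.run I e σ)
  | loop x S, e, σ => foldUpTo (fun i σ => S.run I (Function.update e x i) σ) σ n

/-! ### Compilation of matrix programs

Register `0` holds the address of the first free cell, register `1` the number of vertices.
The other even registers hold the variables, the other odd registers are a stack of temporaries. -/

open RAM

/-- The register of the variable `x`. -/
def vreg (x : ℕ) : ℕ := 2 * x + 2

/-- The register of the `k`-th temporary. -/
def treg (k : ℕ) : ℕ := 2 * k + 3

@[simp] theorem vreg_inj {x y : ℕ} : vreg x = vreg y ↔ x = y := by unfold vreg; omega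
@[simp] theorem treg_inj {x y : ℕ} : treg x = treg y ↔ x = y := by unfold treg; omega
@[simp] theorem vreg_ne_treg {x k : ℕ} : vreg x ≠ treg k := by unfold vreg treg; omega
@[simp] theorem treg_ne_vreg {x k : ℕ} : treg k ≠ vreg x := by unfold vreg treg; omega
@[simp] theorem vreg_ne_zero {x : ℕ} : vreg x ≠ 0 := by unfold vreg; omega
@[simp] theorem vreg_ne_one {x : ℕ} : vreg x ≠ 1 := by unfold vreg; omega
@[simp] theorem zero_ne_vreg {x : ℕ} : 0 ≠ vreg x := by unfold vreg; omega
@[simp] theorem zero_ne_treg {x : ℕ} : 0 ≠ treg x := by unfold treg; omega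
@[simp] theorem one_ne_vreg {x : ℕ} : 1 ≠ vreg x := by unfold vreg; omega
@[simp] theorem one_ne_treg {x : ℕ} : 1 ≠ treg x := by unfold treg; omega

/-- The offset `x * n + y` of a matrix entry. -/
def offExpr (x y : ℕ) : Expr := .add (.mul (.reg (vreg x)) (.reg 1)) (.reg (vreg y))

/-- The address of an entry of the working matrix in slot `k`. -/
def addrExpr (k x y : ℕ) : Expr :=
  .add (.reg 0) (.add (.mul (.add (.mul (.lit k) (.reg 1)) (.reg (vreg x))) (.reg 1))
    (.reg (vreg y)))

/-- The program that puts the value of a term into temporary `k`, without touching the temporaries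
below `k`. -/
def Term.compile : Term → ℕ → Prog
  | lit c, k => .assign (treg k) (.lit c)
  | size, k => .assign (treg k) (.reg 1)
  | numer, k => .assign (treg k) (.load (.lit 1))
  | denom, k => .assign (treg k) (.load (.lit 2))
  | graph x y, k => .assign (treg k) (.load (.add (.lit 3) (offExpr x y)))
  | pairs x y, k => .assign (treg k)
      (.load (.add (.add (.lit 3) (.mul (.reg 1) (.reg 1))) (offExpr x y)))
  -- slot `0` is kept free for the two-phase execution of `fill`
  | entry m x y, k => .assign (treg k) (.load (addrExpr (m + 1) x y))
  | idx x, k => .assign (treg k) (.reg (vreg x))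
  | add t u, k => .seq (.seq (t.compile k) (u.compile (k + 1)))
      (.assign (treg k) (.add (.reg (treg k)) (.reg (treg (k + 1)))))
  | sub t u, k => .seq (.seq (t.compile k) (u.compile (k + 1)))
      (.assign (treg k) (.sub (.reg (treg k)) (.reg (treg (k + 1)))))
  | ite c t u, k => .seq (c.compile k) (.ite (.reg (treg k)) (t.compile k) (u.compile k))
  | sum x t, k =>
      .seq (.seq (.seq (.assign (treg k) (.reg (vreg x))) (.assign (treg (k + 1)) (.lit 0)))
        (.count (vreg x) (.seq (t.compile (k + 2))
          (.assign (treg (k + 1)) (.add (.reg (treg (k + 1))) (.reg (treg (k + 2))))))))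
        (.seq (.assign (vreg x) (.reg (treg k))) (.assign (treg k) (.reg (treg (k + 1)))))
  | inf x t, k =>
      .seq (.seq (.seq (.assign (treg k) (.reg (vreg x))) (.assign (treg (k + 1)) (.lit 0)))
        (.count (vreg x) (.seq (t.compile (k + 2))
          -- the accumulator is replaced in the first round and whenever it is too large
          (.ite (.add (.sub (.lit 1) (.reg (vreg x)))
              (.sub (.reg (treg (k + 1))) (.reg (treg (k + 2)))))
            (.assign (treg (k + 1)) (.reg (treg (k + 2)))) .skip))))
        (.seq (.assign (vreg x) (.reg (treg k))) (.assign (treg k) (.reg (treg (k + 1)))))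

open Polynomial in
/-- A bound, in terms of the number of vertices, for the time that a term takes. -/
noncomputable def Term.time : Term → ℕ[X]
  | lit _ => C 2
  | size => C 2
  | numer => C 3
  | denom => C 3
  | graph _ _ => C 20 + C 4 * X
  | pairs _ _ => C 20 + C 10 * X
  | entry m _ _ => C (20 + m) + C (20 + m) * X
  | idx _ => C 2
  | add t u => t.time + u.time + C 4
  | sub t u => t.time + u.time + C 4
  | ite c t u => c.time + t.time + u.time + C 2
  | sum _ t => X * (t.time + C 12) + C 20
  | inf _ t => X * (t.time + C 20) + C 20

/-- The registers below the temporaries are as they should be. -/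
structure RegsOK {n : ℕ} (e : Env n) (r : ℕ → ℕ) : Prop where
  base : r 0 = 3 + 2 * (n * n)
  size : r 1 = n
  vars : ∀ x, r (vreg x) = e x

/-- The memory holds the input and the working matrices. -/
structure MemOK {n : ℕ} (I : Inst n) (σ : Mats n) (m : ℕ → ℕ) : Prop where
  numer : m 1 = I.numer
  denom : m 2 = I.denom
  graph : ∀ i j : Fin n, m (3 + (i * n + j)) = I.graph i j
  pairs : ∀ i j : Fin n, m (3 + n * n + (i * n + j)) = I.pairs i j
  entry : ∀ (k : ℕ) (i j : Fin n),
    m (3 + 2 * (n * n) + (((k + 1) * n + i) * n + j)) = σ k i j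

theorem RegsOK.update_treg {n : ℕ} {e : Env n} {r : ℕ → ℕ} (h : RegsOK e r) (k v : ℕ) :
    RegsOK e (Function.update r (treg k) v) :=
  ⟨by simp [h.base], by simp [h.size],
    fun x => by simp [h.vars]⟩

theorem size_le_self (m : ℕ) : Nat.size m ≤ m := Nat.size_le.2 Nat.lt_two_pow_self

theorem iInf_fin_eq {n : ℕ} {f : Fin n → ℕ} {a : ℕ} (h1 : ∀ i, a ≤ f i) (h2 : ∃ i, f i = a) :
    ⨅ i, f i = a := by
  obtain ⟨i, hi⟩ := h2
  have : Nonempty (Fin n) := ⟨i⟩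
  exact le_antisymm (hi ▸ ciInf_le (OrderBot.bddBelow _) i) (le_ciInf h1)

/-- What the compiled term achieves. -/
def TermPost {n : ℕ} (v : ℕ) (e : Env n) (k : ℕ) (s s' : Store) : Prop :=
  s'.mem = s.mem ∧ s'.reg (treg k) = v ∧ RegsOK e s'.reg ∧ ∀ j < k, s'.reg (treg j) = s.reg (treg j)

theorem TermPost.assign {n : ℕ} {e : Env n} {k : ℕ} {s : Store} {E : Expr} {v T : ℕ}
    (hr : RegsOK e s.reg) (hT : E.cost s + 1 ≤ T) (hv : E.eval s = v) :
    Runs (.assign (treg k) E) T s (TermPost v e k s) := by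
  refine Runs.assign hT ⟨rfl, by simp [hv], hr.update_treg _ _, fun j hj => ?_⟩
  simp [hj.ne]

theorem offExpr_eval {n : ℕ} {e : Env n} {s : Store} (hr : RegsOK e s.reg) (x y : ℕ) :
    (offExpr x y).eval s = (e x : ℕ) * n + e y := by
  simp [offExpr, Expr.eval, hr.vars, hr.size]

theorem offExpr_cost {n : ℕ} {e : Env n} {s : Store} (hr : RegsOK e s.reg) (x y : ℕ) :
    (offExpr x y).cost s ≤ 5 + 2 * n := by
  simp only [offExpr, Expr.cost, Expr.eval, hr.vars, hr.size]
  have := size_le_self n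
  have := size_le_self (e x : ℕ)
  have := (e x).2
  omega

theorem addrExpr_eval {n : ℕ} {e : Env n} {s : Store} (hr : RegsOK e s.reg) (k x y : ℕ) :
    (addrExpr k x y).eval s = 3 + 2 * (n * n) + ((k * n + e x) * n + e y) := by
  simp [addrExpr, Expr.eval, hr.vars, hr.size, hr.base]

theorem addrExpr_cost {n : ℕ} {e : Env n} {s : Store} (hr : RegsOK e s.reg) (k x y : ℕ) :
    (addrExpr k x y).cost s ≤ 11 + k + (3 + k) * n := by
  simp only [addrExpr, Expr.cost, Expr.eval, hr.vars, hr.size]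
  have := size_le_self n
  have := size_le_self k
  have := size_le_self (k * n + (e x : ℕ))
  have := (e x).2
  have : (3 + k) * n = 3 * n + k * n := by ring
  omega

theorem Term.compile_runs {n : ℕ} {I : Inst n} {σ : Mats n} : ∀ (t : Term) (k : ℕ) (e : Env n)
    (s : Store), RegsOK e s.reg → MemOK I σ s.mem →
    Runs (t.compile k) (t.time.eval n) s (TermPost (t.eval I σ e) e k s) := by
  intro t
  induction t with
  | lit c => intro k e s hr hm; exact TermPost.assign hr (by simp [Expr.cost, time]) rfl
  | size => intro k e s hr hm; exact TermPost.assign hr (by simp [Expr.cost, time]) hr.size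
  | numer =>
    intro k e s hr hm
    exact TermPost.assign hr (by simp [Expr.cost, time]) (by simp [Expr.eval, hm.numer, Term.eval])
  | denom =>
    intro k e s hr hm
    exact TermPost.assign hr (by simp [Expr.cost, time]) (by simp [Expr.eval, hm.denom, Term.eval])
  | graph x y =>
    intro k e s hr hm
    refine TermPost.assign hr ?_ ?_
    · have := offExpr_cost hr x y
      simp only [Expr.cost, time]; simp; omega
    · simp only [Expr.eval, offExpr_eval hr, hm.graph, Term.eval]
  | pairs x y =>
    intro k e s hr hm
    refine TermPost.assign hr ?_ ?_
    · have := offExpr_cost hr x y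
      have := size_le_self n
      simp only [Expr.cost, time, Expr.eval, hr.size]; simp; omega
    · simp only [Expr.eval, offExpr_eval hr, hr.size, hm.pairs, Term.eval]
  | entry m x y =>
    intro k e s hr hm
    refine TermPost.assign hr ?_ ?_
    · have := addrExpr_cost hr (m + 1) x y
      simp only [Expr.cost, time]; simp; nlinarith
    · simp only [Expr.eval, addrExpr_eval hr, hm.entry, Term.eval]
  | idx x =>
    intro k e s hr hm
    exact TermPost.assign hr (by simp [Expr.cost, time]) (by simp [Expr.eval, hr.vars, Term.eval])
  | add t u iht ihu =>
    intro k e s hr hm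
    refine ((((iht k e s hr hm).seq (R := fun s' => TermPost (t.eval I σ e) e k s s') ?_).seq
      (Q := TermPost ((t.add u).eval I σ e) e k s) (T' := 4)
      (R := fun s' => TermPost (t.eval I σ e) e k s s' ∧ s'.reg (treg (k + 1)) = u.eval I σ e)
      ?_)).mono (T := t.time.eval n + u.time.eval n + 4) (by simp [time]) (fun _ h => h)
    · rintro s' ⟨h1, h2, h3, h4⟩
      refine (ihu (k + 1) e s' h3 (h1 ▸ hm)).mono le_rfl ?_
      rintro s'' ⟨g1, g2, g3, g4⟩
      exact ⟨⟨g1.trans h1, (g4 k (by omega)).trans h2, g3,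
        fun j hj => (g4 j (by omega)).trans (h4 j hj)⟩, g2⟩
    · rintro s' ⟨⟨h1, h2, h3, h4⟩, h5⟩
      refine (TermPost.assign (k := k) h3 (by simp [Expr.cost])
        (by simp only [Expr.eval, h2, h5]; rfl)).mono le_rfl ?_
      rintro s'' ⟨g1, g2, g3, g4⟩
      exact ⟨g1.trans h1, g2, g3, fun j hj => (g4 j hj).trans (h4 j hj)⟩
  | sub t u iht ihu =>
    intro k e s hr hm
    refine ((((iht k e s hr hm).seq (R := fun s' => TermPost (t.eval I σ e) e k s s') ?_).seq
      (Q := TermPost ((t.sub u).eval I σ e) e k s) (T' := 4)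
      (R := fun s' => TermPost (t.eval I σ e) e k s s' ∧ s'.reg (treg (k + 1)) = u.eval I σ e)
      ?_)).mono (T := t.time.eval n + u.time.eval n + 4) (by simp [time]) (fun _ h => h)
    · rintro s' ⟨h1, h2, h3, h4⟩
      refine (ihu (k + 1) e s' h3 (h1 ▸ hm)).mono le_rfl ?_
      rintro s'' ⟨g1, g2, g3, g4⟩
      exact ⟨⟨g1.trans h1, (g4 k (by omega)).trans h2, g3,
        fun j hj => (g4 j (by omega)).trans (h4 j hj)⟩, g2⟩
    · rintro s' ⟨⟨h1, h2, h3, h4⟩, h5⟩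
      refine (TermPost.assign (k := k) h3 (by simp [Expr.cost])
        (by simp only [Expr.eval, h2, h5]; rfl)).mono le_rfl ?_
      rintro s'' ⟨g1, g2, g3, g4⟩
      exact ⟨g1.trans h1, g2, g3, fun j hj => (g4 j hj).trans (h4 j hj)⟩
  | ite c t u ihc iht ihu =>
    intro k e s hr hm
    refine ((ihc k e s hr hm).seq (R := fun s' => TermPost (c.eval I σ e) e k s s')
      (Q := TermPost ((Term.ite c t u).eval I σ e) e k s)
      (T' := 2 + (t.time.eval n + u.time.eval n)) ?_).mono (by simp [time]; omega) (fun _ h => h)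
    rintro s' ⟨h1, h2, h3, h4⟩
    have key : ∀ s'' v, TermPost v e k s' s'' → TermPost v e k s s'' := by
      rintro s'' v ⟨g1, g2, g3, g4⟩
      exact ⟨g1.trans h1, g2, g3, fun j hj => (g4 j hj).trans (h4 j hj)⟩
    refine (Runs.ite (T := t.time.eval n + u.time.eval n) ?_ ?_).mono (by simp [Expr.cost])
      (fun _ h => h)
    · intro h
      simp only [Expr.eval, h2] at h
      refine (iht k e s' h3 (h1 ▸ hm)).mono (by omega) ?_
      intro s'' g
      simp only [Term.eval, ne_eq, h, not_false_iff, if_true]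
      exact key _ _ g
    · intro h
      simp only [Expr.eval, h2] at h
      refine (ihu k e s' h3 (h1 ▸ hm)).mono (by omega) ?_
      intro s'' g
      simp only [Term.eval, ne_eq, h, not_true, if_false]
      exact key _ _ g
  | sum x t ih =>
    intro k e s hr hm
    let Inv : ℕ → Store → Prop := fun i s' => s'.mem = s.mem ∧
      s'.reg (treg k) = e x ∧ s'.reg 0 = 3 + 2 * (n * n) ∧ (∀ y ≠ x, s'.reg (vreg y) = e y) ∧
      (∀ j < k, s'.reg (treg j) = s.reg (treg j)) ∧
      s'.reg (treg (k + 1)) =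
        ∑ j : Fin n, if (j : ℕ) < i then t.eval I σ (Function.update e x j) else 0
    refine (((((Runs.assign (T := 2) (by simp [Expr.cost]) ?_).seq
      (R := fun s' => s' = ⟨Function.update s.reg (treg k) (e x), s.mem⟩) (T' := 2)
      (Q := fun s' => s'.reg 1 = n ∧ Inv 0 ⟨Function.update s'.reg (vreg x) 0, s'.mem⟩) ?_).seq
      (T' := n * (t.time.eval n + 4 + 8) + 6)
      (Q := fun s' => s'.reg (vreg x) = n ∧ s'.reg 1 = n ∧ Inv n s') ?_).seq
      (Q := TermPost ((Term.sum x t).eval I σ e) e k s) (T' := 4) ?_)).mono ?_ (fun _ h => h)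
    · simp [Expr.eval, hr.vars]
    · rintro s' rfl
      refine Runs.assign (by simp [Expr.cost]) ⟨?_, rfl, ?_, ?_, ?_, ?_, ?_⟩
      · simp [hr.size]
      · simp
      · simp [hr.base]
      · intro y hy; simp [hr.vars, hy]
      · intro j hj
        simp [hj.ne, (show j ≠ k + 1 by omega)]
      · simp [Expr.eval]
    · rintro s' ⟨h1, h2⟩
      refine Runs.count Inv (by simp) h1 h2 ?_
      rintro i hi s1 hx h1 ⟨i1, i2, i3, i4, i5, i6⟩
      have hr1 : RegsOK (Function.update e x ⟨i, hi⟩) s1.reg := by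
        refine ⟨i3, h1, fun y => ?_⟩
        by_cases hy : y = x
        · subst hy; simp [hx]
        · simp [hy, i4 y hy]
      refine (ih (k + 2) _ s1 hr1 (i1 ▸ hm)).seq (T' := 4) ?_
      rintro s2 ⟨g1, g2, g3, g4⟩
      refine Runs.assign (by simp [Expr.cost]) ⟨?_, ?_, ?_, ?_, ?_, ?_, ?_, ?_⟩
      · simp [g3.vars]
      · simp [g3.size]
      · exact g1.trans i1
      · simp [g4 k (by omega), i2]
      · simp [g3.base]
      · intro y hy; simp [g3.vars, hy]
      · intro j hj
        simp [(show j ≠ k + 1 by omega), g4 j (by omega), i5 j hj]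
      · simp only [Function.update_apply, Expr.eval, g2, g4 (k + 1) (by omega), i6]
        simp only [treg_ne_vreg, if_false, if_true]
        have : ∀ j : Fin n, (if (j : ℕ) < i + 1 then t.eval I σ (Function.update e x j) else 0) =
            (if (j : ℕ) < i then t.eval I σ (Function.update e x j) else 0) +
            (if j = ⟨i, hi⟩ then t.eval I σ (Function.update e x j) else 0) := by
          intro j
          rcases lt_trichotomy (j : ℕ) i with h | h | h
          · simp [h, (show (j : ℕ) < i + 1 by omega), Fin.ext_iff, h.ne]
          · simp [h, Fin.ext_iff]
          · simp [Fin.ext_iff, h.ne', h.not_gt, (show ¬ (j : ℕ) < i + 1 by omega)]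
        rw [Finset.sum_congr rfl fun j _ => this j, Finset.sum_add_distrib]
        simp
    · rintro s' ⟨hx, h1, i1, i2, i3, i4, i5, i6⟩
      refine (Runs.assign (T := 2) (by simp [Expr.cost]) ?_).seq (T' := 2)
        (R := fun s'' => s'' = ⟨Function.update s'.reg (vreg x) (e x), s'.mem⟩) ?_
      · simp [Expr.eval, i2]
      · rintro s'' rfl
        refine Runs.assign (by simp [Expr.cost]) ⟨i1, ?_, ?_, ?_⟩
        · simp [Expr.eval, i6, Term.eval]
        · refine RegsOK.update_treg ⟨?_, ?_, fun y => ?_⟩ _ _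
          · simp [i3]
          · simp [h1]
          · by_cases hy : y = x
            · subst hy; simp
            · simp [hy, i4 y hy]
        · intro j hj
          simp [hj.ne, i5 j hj]
    · simp [time]; ring_nf; omega
  | inf x t ih =>
    intro k e s hr hm
    let f : Fin n → ℕ := fun j => t.eval I σ (Function.update e x j)
    let Inv : ℕ → Store → Prop := fun i s' => s'.mem = s.mem ∧
      s'.reg (treg k) = e x ∧ s'.reg 0 = 3 + 2 * (n * n) ∧ (∀ y ≠ x, s'.reg (vreg y) = e y) ∧
      (∀ j < k, s'.reg (treg j) = s.reg (treg j)) ∧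
      (∀ j : Fin n, (j : ℕ) < i → s'.reg (treg (k + 1)) ≤ f j) ∧
      (0 < i → ∃ j : Fin n, f j = s'.reg (treg (k + 1)))
    refine (((((Runs.assign (T := 2) (by simp [Expr.cost]) ?_).seq
      (R := fun s' => s' = ⟨Function.update s.reg (treg k) (e x), s.mem⟩) (T' := 2)
      (Q := fun s' => s'.reg 1 = n ∧ Inv 0 ⟨Function.update s'.reg (vreg x) 0, s'.mem⟩) ?_).seq
      (T' := n * (t.time.eval n + 10 + 8) + 6)
      (Q := fun s' => s'.reg (vreg x) = n ∧ s'.reg 1 = n ∧ Inv n s') ?_).seq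
      (Q := TermPost ((Term.inf x t).eval I σ e) e k s) (T' := 4) ?_)).mono ?_ (fun _ h => h)
    · simp [Expr.eval, hr.vars]
    · rintro s' rfl
      refine Runs.assign (by simp [Expr.cost]) ⟨?_, rfl, ?_, ?_, ?_, ?_, ?_, ?_⟩
      · simp [hr.size]
      · simp
      · simp [hr.base]
      · intro y hy; simp [hr.vars, hy]
      · intro j hj
        simp [hj.ne, (show j ≠ k + 1 by omega)]
      · simp
      · simp
    · rintro s' ⟨h1, h2⟩
      refine Runs.count Inv (by simp) h1 h2 ?_
      rintro i hi s1 hx h1 ⟨i1, i2, i3, i4, i5, i6, i7⟩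
      have hr1 : RegsOK (Function.update e x ⟨i, hi⟩) s1.reg := by
        refine ⟨i3, h1, fun y => ?_⟩
        by_cases hy : y = x
        · subst hy; simp [hx]
        · simp [hy, i4 y hy]
      refine (ih (k + 2) _ s1 hr1 (i1 ▸ hm)).seq (T' := 10) ?_
      rintro s2 ⟨g1, g2, g3, g4⟩
      have hv : s2.reg (vreg x) = i := by simp [g3.vars]
      have g5 := g4 (k + 1) (by omega)
      refine (Runs.ite (T := 2) ?_ ?_).mono (by simp [Expr.cost]) (fun _ h => h)
      · intro _
        rename_i hc
        simp only [Expr.eval, g2, hv, g5] at hc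
        refine Runs.assign (by simp [Expr.cost]) ⟨?_, ?_, ?_, ?_, ?_, ?_, ?_, ?_, ?_⟩
        · simp [g3.vars]
        · simp [g3.size]
        · exact g1.trans i1
        · simp [g4 k (by omega), i2]
        · simp [g3.base]
        · intro y hy; simp [g3.vars, hy]
        · intro j hj
          simp [(show j ≠ k + 1 by omega), g4 j (by omega), i5 j hj]
        · intro j hj
          simp only [Function.update_apply, Expr.eval, g2, treg_ne_vreg, if_false, if_true]
          rcases Nat.lt_succ_iff_lt_or_eq.1 hj with h | h
          · have := i6 j h
            change f ⟨i, hi⟩ ≤ f j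
            change (1 - i) + (_ - f ⟨i, hi⟩) ≠ 0 at hc
            omega
          · have : j = ⟨i, hi⟩ := Fin.ext h
            subst this; exact le_rfl
        · intro _
          simp only [Function.update_apply, Expr.eval, g2, treg_ne_vreg, if_false, if_true]
          exact ⟨⟨i, hi⟩, rfl⟩
      · intro hc
        simp only [Expr.eval, g2, hv, g5] at hc
        refine (Runs.skip (s := s2) ⟨?_, ?_, ?_, ?_, ?_, ?_, ?_, ?_, ?_⟩).mono (by omega)
          (fun _ h => h)
        · simp [g3.vars]
        · simp [g3.size]
        · exact g1.trans i1
        · simp [g4 k (by omega), i2]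
        · simp [g3.base]
        · intro y hy; simp [g3.vars, hy]
        · intro j hj
          simp [g4 j (by omega), i5 j hj]
        · intro j hj
          simp only [Function.update_apply, treg_ne_vreg, if_false]
          rw [g5]
          rcases Nat.lt_succ_iff_lt_or_eq.1 hj with h | h
          · exact i6 j h
          · have : j = ⟨i, hi⟩ := Fin.ext h
            subst this
            change (1 - i) + (_ - f ⟨i, hi⟩) = 0 at hc
            omega
        · intro _
          simp only [Function.update_apply, treg_ne_vreg, if_false]
          rw [g5]
          exact i7 (by omega)
    · rintro s' ⟨hx, h1, i1, i2, i3, i4, i5, i6, i7⟩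
      refine (Runs.assign (T := 2) (by simp [Expr.cost]) ?_).seq (T' := 2)
        (R := fun s'' => s'' = ⟨Function.update s'.reg (vreg x) (e x), s'.mem⟩) ?_
      · simp [Expr.eval, i2]
      · rintro s'' rfl
        refine Runs.assign (by simp [Expr.cost]) ⟨i1, ?_, ?_, ?_⟩
        · simp only [Function.update_apply, Expr.eval, Term.eval]
          simp only [treg_ne_vreg, if_false, if_true]
          exact (iInf_fin_eq (fun i => i6 i i.2) (i7 (Fin.pos (e x)))).symm
        · refine RegsOK.update_treg ⟨?_, ?_, fun y => ?_⟩ _ _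
          · simp [i3]
          · simp [h1]
          · by_cases hy : y = x
            · subst hy; simp
            · simp [hy, i4 y hy]
        · intro j hj
          simp [hj.ne, i5 j hj]
    · simp [time]; ring_nf; omega

end MatProg

namespace MatProg
open RAM

/-- The address of an entry of the matrix in slot `k`. -/
def addr (n k i j : ℕ) : ℕ := 3 + 2 * (n * n) + ((k * n + i) * n + j)

theorem addr_inj {n k k' : ℕ} {i j i' j' : Fin n} :
    addr n k i j = addr n k' i' j' ↔ k = k' ∧ i = i' ∧ j = j' := by
  constructor
  · intro h
    have hn : 0 < n := i.pos
    have h1 : (k * n + i) * n + j = (k' * n + i') * n + j' := by unfold addr at h; omega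
    have hj : (j : ℕ) = j' := by
      have := congrArg (· % n) h1
      simpa [Nat.mul_add_mod_of_lt, Nat.mod_eq_of_lt] using this
    have h2 : k * n + i = k' * n + i' := by
      rw [hj] at h1
      exact Nat.eq_of_mul_eq_mul_right hn (by omega)
    have hi : (i : ℕ) = i' := by
      have := congrArg (· % n) h2
      simpa [Nat.mul_add_mod_of_lt, Nat.mod_eq_of_lt] using this
    refine ⟨Nat.eq_of_mul_eq_mul_right hn (by omega), Fin.ext hi, Fin.ext hj⟩
  · rintro ⟨rfl, rfl, rfl⟩; rfl

theorem offset_lt {n : ℕ} (i j : Fin n) : (i : ℕ) * n + j < n * n := by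
  have := i.2
  have := j.2
  calc (i : ℕ) * n + j < i * n + n := by omega
    _ = (i + 1) * n := by ring
    _ ≤ n * n := Nat.mul_le_mul_right _ (by omega)

theorem MemOK.congr {n : ℕ} {I : Inst n} {σ : Mats n} {m m' : ℕ → ℕ} (h : MemOK I σ m)
    (hm : ∀ a, (∀ i j : Fin n, a ≠ addr n 0 i j) → m' a = m a) : MemOK I σ m' := by
  have low : ∀ a < 3 + 2 * (n * n), m' a = m a := by
    intro a ha
    refine hm a fun i j => ?_
    unfold addr; omega
  refine ⟨(low 1 (by omega)).trans h.numer, (low 2 (by omega)).trans h.denom, fun i j => ?_,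
    fun i j => ?_, fun k i j => ?_⟩
  · have := offset_lt i j
    exact (low _ (by omega)).trans (h.graph i j)
  · have := offset_lt i j
    exact (low _ (by omega)).trans (h.pairs i j)
  · refine (hm _ fun i' j' hh => ?_).trans (h.entry k i j)
    have := (addr_inj (k := k + 1) (k' := 0)).1 hh
    omega

theorem MemOK.congr_fill {n : ℕ} {I : Inst n} {σ : Mats n} {m m' : ℕ → ℕ} {k : ℕ}
    {f : Fin n → Fin n → ℕ} (h : MemOK I σ m)
    (hm : ∀ a, (∀ i j : Fin n, a ≠ addr n (k + 1) i j) → m' a = m a)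
    (hf : ∀ i j : Fin n, m' (addr n (k + 1) i j) = f i j) :
    MemOK I (Function.update σ k f) m' := by
  have low : ∀ a < 3 + 2 * (n * n), m' a = m a := by
    intro a ha
    refine hm a fun i j => ?_
    unfold addr; omega
  refine ⟨(low 1 (by omega)).trans h.numer, (low 2 (by omega)).trans h.denom, fun i j => ?_,
    fun i j => ?_, fun l i j => ?_⟩
  · have := offset_lt i j
    exact (low _ (by omega)).trans (h.graph i j)
  · have := offset_lt i j
    exact (low _ (by omega)).trans (h.pairs i j)
  · by_cases hl : l = k
    · subst hl; simpa [addr] using hf i j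
    · rw [Function.update_of_ne hl]
      refine (hm _ fun i' j' hh => ?_).trans (h.entry l i j)
      have := (addr_inj (k := l + 1) (k' := k + 1)).1 hh
      omega

/-- Two nested loops, over the variables `0` and `1`, that fill the cells `A i j`. -/
theorem runs_fillLoop {n : ℕ} {B : Prog} {T K : ℕ} {A : Fin n → Fin n → ℕ} {e : Env n} {s : Store}
    {f : Fin n → Fin n → ℕ} (hA : ∀ i j i' j', A i j = A i' j' → i = i' ∧ j = j')
    (hr0 : s.reg 0 = 3 + 2 * (n * n)) (hr1 : s.reg 1 = n)
    (hrv : ∀ y, y ≠ 0 → y ≠ 1 → s.reg (vreg y) = e y)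
    (hB : ∀ (i j : Fin n) (s' : Store),
      RegsOK (Function.update (Function.update e 0 i) 1 j) s'.reg →
      (∀ a, (∀ i j : Fin n, a ≠ A i j) → s'.mem a = s.mem a) →
      Runs B T s' fun s'' =>
        RegsOK (Function.update (Function.update e 0 i) 1 j) s''.reg ∧
        (∀ l < K, s''.reg (treg l) = s'.reg (treg l)) ∧ s''.mem (A i j) = f i j ∧
        ∀ a, a ≠ A i j → s''.mem a = s'.mem a) :
    Runs (.count (vreg 0) (.count (vreg 1) B)) (n * (n * (T + 8) + 6 + 8) + 6) s fun s' =>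
      s'.reg 0 = 3 + 2 * (n * n) ∧ s'.reg 1 = n ∧
      (∀ y, y ≠ 0 → y ≠ 1 → s'.reg (vreg y) = e y) ∧
      (∀ l < K, s'.reg (treg l) = s.reg (treg l)) ∧
      (∀ i j : Fin n, s'.mem (A i j) = f i j) ∧
      ∀ a, (∀ i j : Fin n, a ≠ A i j) → s'.mem a = s.mem a := by
  let P : ℕ → ℕ → Store → Prop := fun i j s' =>
    s'.reg 0 = 3 + 2 * (n * n) ∧ (∀ y, y ≠ 0 → y ≠ 1 → s'.reg (vreg y) = e y) ∧
    (∀ l < K, s'.reg (treg l) = s.reg (treg l)) ∧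
    (∀ i' j' : Fin n, (i' : ℕ) < i ∨ (i' : ℕ) = i ∧ (j' : ℕ) < j →
      s'.mem (A i' j') = f i' j') ∧
    ∀ a, (∀ i j : Fin n, a ≠ A i j) → s'.mem a = s.mem a
  have hPreg : ∀ i j s' x v, (x = 0 ∨ x = 1) → P i j s' →
      P i j ⟨Function.update s'.reg (vreg x) v, s'.mem⟩ := by
    rintro i j s' x v hx ⟨p1, p2, p3, p4, p5⟩
    refine ⟨by simp [p1], fun y h0 h1 => ?_, fun l hl => by simp [p3 l hl], p4, p5⟩
    rcases hx with rfl | rfl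
    · simp [h0, p2 y h0 h1]
    · simp [h1, p2 y h0 h1]
  refine (Runs.count (n := n) (T := n * (T + 8) + 6) (fun i => P i 0) (by simp) hr1 ?_ ?_).mono
    le_rfl ?_
  · refine hPreg _ _ _ _ _ (by simp) ⟨hr0, hrv, fun _ _ => rfl, ?_,
      fun _ _ => rfl⟩
    rintro i' j' (h | ⟨-, h⟩) <;> omega
  · intro i hi s1 hx h1 hP
    refine (Runs.count (n := n) (T := T) (fun j s' => s'.reg (vreg 0) = i ∧ P i j s') (by simp) h1
      ⟨by simp [hx], hPreg _ _ _ _ _ (by simp) hP⟩ ?_).mono le_rfl ?_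
    · rintro j hj s2 hy h2 ⟨hx2, p1, p2, p3, p4, p5⟩
      have hr2 : RegsOK (Function.update (Function.update e 0 ⟨i, hi⟩) 1 ⟨j, hj⟩) s2.reg := by
        refine ⟨p1, h2, fun y => ?_⟩
        by_cases hy1 : y = 1
        · subst hy1; simp [hy]
        · by_cases hy0 : y = 0
          · subst hy0; simp [hx2]
          · simp [hy1, hy0, p2 y hy0 hy1]
      refine (hB ⟨i, hi⟩ ⟨j, hj⟩ s2 hr2 p5).mono le_rfl ?_
      rintro s3 ⟨g1, g2, g3, g4⟩
      refine ⟨by simp [g1.vars], g1.size, by simp [g1.vars], ?_⟩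
      refine hPreg _ _ _ _ _ (by simp) ⟨g1.base, fun y h0 h1 => by simp [g1.vars, h0, h1],
        fun l hl => (g2 l hl).trans (p3 l hl), ?_, ?_⟩
      · intro i' j' h
        by_cases he : A i' j' = A ⟨i, hi⟩ ⟨j, hj⟩
        · obtain ⟨rfl, rfl⟩ := hA _ _ _ _ he
          exact g3
        · rw [g4 _ he]
          refine p4 i' j' ?_
          rcases h with h | ⟨h, h'⟩
          · exact Or.inl h
          · rcases Nat.lt_succ_iff_lt_or_eq.1 h' with h'' | h''
            · exact Or.inr ⟨h, h''⟩
            · exact absurd (congrArg₂ A (Fin.ext h) (Fin.ext h'')) he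
      · intro a ha
        rw [g4 a (ha ⟨i, hi⟩ ⟨j, hj⟩), p5 a ha]
    · rintro s2 ⟨q1, q2, q3, p1, p2, p3, p4, p5⟩
      refine ⟨q3, q2, hPreg _ _ _ _ _ (by simp) ⟨p1, p2, p3, ?_, p5⟩⟩
      rintro i' j' (h | ⟨-, h⟩)
      · refine p4 i' j' ?_
        have := j'.2
        omega
      · omega
  · rintro s' ⟨q1, q2, p1, p2, p3, p4, p5⟩
    exact ⟨p1, q2, p2, p3, fun i j => p4 i j (Or.inl i.2), p5⟩

/-- The program for a statement; it leaves the temporaries below `k` alone. -/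
def Stmt.compile : Stmt → ℕ → Prog
  | fill m t, k =>
      -- the new values are collected in slot `0`, since `t` may read the old matrix
      .seq (.seq (.seq (.seq
        (.assign (treg k) (.reg (vreg 0))) (.assign (treg (k + 1)) (.reg (vreg 1))))
        (.count (vreg 0) (.count (vreg 1)
          (.seq (t.compile (k + 2)) (.store (addrExpr 0 0 1) (.reg (treg (k + 2))))))))
        (.count (vreg 0) (.count (vreg 1)
          (.store (addrExpr (m + 1) 0 1) (.load (addrExpr 0 0 1))))))
        (.seq (.assign (vreg 0) (.reg (treg k))) (.assign (vreg 1) (.reg (treg (k + 1)))))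
  | seq S S', k => .seq (S.compile k) (S'.compile k)
  | loop x S, k =>
      .seq (.seq (.assign (treg k) (.reg (vreg x))) (.count (vreg x) (S.compile (k + 1))))
        (.assign (vreg x) (.reg (treg k)))

open Polynomial in
/-- A bound, in terms of the number of vertices, for the time that a statement takes. -/
noncomputable def Stmt.time : Stmt → ℕ[X]
  | fill m t => (X * (X * (t.time + C 40 + C 6 * X) + C 20) + C 10) +
      (X * (X * (C (100 + m) + C (10 + m) * X) + C 20) + C 10) + C 10
  | seq S S' => S.time + S'.time
  | loop _ S => X * (S.time + C 8) + C 20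

theorem Stmt.compile_runs {n : ℕ} {I : Inst n} : ∀ (S : Stmt) (k : ℕ) (e : Env n) (σ : Mats n)
    (s : Store), RegsOK e s.reg → MemOK I σ s.mem →
    Runs (S.compile k) (S.time.eval n) s fun s' =>
      RegsOK e s'.reg ∧ MemOK I (S.run I e σ) s'.mem ∧
        ∀ j < k, s'.reg (treg j) = s.reg (treg j) := by
  intro S
  induction S with
  | fill m t =>
    intro k e σ s hr hm
    let f : Fin n → Fin n → ℕ := fun i j =>
      t.eval I σ (Function.update (Function.update e 0 i) 1 j)
    let R1 : Store → Prop := fun s' => RegsOK e s'.reg ∧ s'.mem = s.mem ∧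
      s'.reg (treg k) = e 0 ∧ s'.reg (treg (k + 1)) = e 1 ∧
      ∀ j < k, s'.reg (treg j) = s.reg (treg j)
    let R2 : Store → Prop := fun s' => s'.reg 0 = 3 + 2 * (n * n) ∧ s'.reg 1 = n ∧
      (∀ y, y ≠ 0 → y ≠ 1 → s'.reg (vreg y) = e y) ∧
      s'.reg (treg k) = e 0 ∧ s'.reg (treg (k + 1)) = e 1 ∧
      (∀ j < k, s'.reg (treg j) = s.reg (treg j))
    refine ((((((Runs.assign (T := 2) (by simp [Expr.cost]) ?_).seq
      (R := fun s' => s' = ⟨Function.update s.reg (treg k) (e 0), s.mem⟩) (T' := 2)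
      (Q := R1) ?_).seq
      (T' := n * (n * ((t.time.eval n + (2 * n + 2 * n + 30)) + 8) + 6 + 8) + 6)
      (Q := fun s' => R2 s' ∧ MemOK I σ s'.mem ∧ ∀ i j : Fin n, s'.mem (addr n 0 i j) = f i j)
      ?_).seq
      (T' := n * (n * ((40 + m + (10 + m) * n) + 8) + 6 + 8) + 6)
      (Q := fun s' => R2 s' ∧ MemOK I (Function.update σ m f) s'.mem) ?_).seq
      (T' := 4) ?_)).mono (Q := fun s' => RegsOK e s'.reg ∧
        MemOK I ((Stmt.fill m t).run I e σ) s'.mem ∧ ∀ j < k, s'.reg (treg j) = s.reg (treg j))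
      ?_ (fun _ h => h)
    · simp [Expr.eval, hr.vars]
    · rintro s' rfl
      refine Runs.assign (by simp [Expr.cost]) ⟨?_, rfl, ?_, ?_, ?_⟩
      · exact (hr.update_treg _ _).update_treg _ _
      · simp
      · simp [Expr.eval, hr.vars]
      · intro j hj
        simp [hj.ne, (show j ≠ k + 1 by omega)]
    · rintro s1 ⟨hr1, hm1, hk, hk1, hj1⟩
      refine (runs_fillLoop (e := e) (A := fun i j => addr n 0 i j) (f := f) (K := k + 2)
        (fun _ _ _ _ h => (addr_inj.1 h).2) hr1.base hr1.size (fun y _ _ => hr1.vars y)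
        ?_).mono le_rfl ?_
      · intro i j s2 hr2 hm2
        rw [hm1] at hm2
        refine (t.compile_runs (k + 2) _ s2 hr2 (hm.congr hm2)).seq ?_
        rintro s3 ⟨g1, g2, g3, g4⟩
        have ha : (addrExpr 0 0 1).eval s3 = addr n 0 i j := by
          rw [addrExpr_eval g3]; simp [addr]
        refine Runs.store ?_ ⟨g3, g4, ?_, ?_⟩
        · have := addrExpr_cost g3 0 0 1
          simp only [Expr.cost]; omega
        · simp [ha, Expr.eval, g2, f]
        · intro a ha'
          simp only [ha, g1]
          exact Function.update_of_ne ha' _ _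
      · rintro s2 ⟨g1, g2, g3, g4, g5, g6⟩
        rw [hm1] at g6
        exact ⟨⟨g1, g2, g3, (g4 k (by omega)).trans hk, (g4 (k + 1) (by omega)).trans hk1,
          fun j hj => (g4 j (by omega)).trans (hj1 j hj)⟩, hm.congr g6, g5⟩
    · rintro s1 ⟨⟨p1, p2, p3, p4, p5, p6⟩, hm1, hf1⟩
      refine (runs_fillLoop (e := e) (A := fun i j => addr n (m + 1) i j) (f := f) (K := k + 2)
        (fun _ _ _ _ h => (addr_inj.1 h).2) p1 p2 p3 ?_).mono le_rfl ?_
      · intro i j s2 hr2 hm2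
        have ha : ∀ q, (addrExpr q 0 1).eval s2 = addr n q i j := by
          intro q; rw [addrExpr_eval hr2]; simp [addr]
        refine Runs.store ?_ ⟨hr2, fun _ _ => rfl, ?_, ?_⟩
        · have := addrExpr_cost hr2 0 0 1
          have := addrExpr_cost hr2 (m + 1) 0 1
          simp only [Expr.cost]
          nlinarith
        · simp only [ha, Expr.eval, Function.update_self]
          rw [hm2 _ fun i' j' hh => by have := (addr_inj (k := 0)).1 hh; omega, hf1]
        · intro a ha'
          simp only [ha]
          exact Function.update_of_ne ha' _ _
      · rintro s2 ⟨g1, g2, g3, g4, g5, g6⟩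
        refine ⟨⟨g1, g2, g3, ?_, ?_, fun j hj => ?_⟩, hm1.congr_fill g6 g5⟩
        · rw [g4 k (by omega), p4]
        · rw [g4 (k + 1) (by omega), p5]
        · rw [g4 j (by omega), p6 j hj]
    · rintro s1 ⟨⟨p1, p2, p3, p4, p5, p6⟩, hm1⟩
      refine (Runs.assign (T := 2) (by simp [Expr.cost]) ?_).seq (T' := 2)
        (R := fun s' => s' = ⟨Function.update s1.reg (vreg 0) (e 0), s1.mem⟩) ?_
      · simp [Expr.eval, p4]
      · rintro s' rfl
        refine Runs.assign (by simp [Expr.cost]) ⟨⟨?_, ?_, ?_⟩, hm1, ?_⟩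
        · simp [p1]
        · simp [p2]
        · intro y
          by_cases hy1 : y = 1
          · subst hy1; simp [Expr.eval, p5]
          · by_cases hy0 : y = 0
            · subst hy0; simp
            · simp [hy1, hy0, p3 y hy0 hy1]
        · intro j hj; simp [p6 j hj]
    · simp [time]; ring_nf; omega
  | seq S S' ih ih' =>
    intro k e σ s hr hm
    refine ((ih k e σ s hr hm).seq (T' := S'.time.eval n) ?_).mono (by simp [time]) (fun _ h => h)
    rintro s1 ⟨g1, g2, g3⟩
    refine (ih' k e _ s1 g1 g2).mono le_rfl ?_
    rintro s2 ⟨h1, h2, h3⟩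
    exact ⟨h1, h2, fun j hj => (h3 j hj).trans (g3 j hj)⟩
  | loop x S ih =>
    intro k e σ s hr hm
    let F : Fin n → Mats n → Mats n := fun i σ => S.run I (Function.update e x i) σ
    let Inv : ℕ → Store → Prop := fun i s' => s'.reg 0 = 3 + 2 * (n * n) ∧
      (∀ y ≠ x, s'.reg (vreg y) = e y) ∧ s'.reg (treg k) = e x ∧
      (∀ j < k, s'.reg (treg j) = s.reg (treg j)) ∧ MemOK I (foldUpTo F σ i) s'.mem
    refine (((Runs.assign (T := 2) (by simp [Expr.cost]) ?_).seq
      (R := fun s' => s' = ⟨Function.update s.reg (treg k) (e x), s.mem⟩)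
      (T' := n * (S.time.eval n + 8) + 6)
      (Q := fun s' => s'.reg (vreg x) = n ∧ s'.reg 1 = n ∧ Inv n s') ?_).seq (T' := 2) ?_).mono
      (by simp [time]; omega) (fun _ h => h)
    · simp [Expr.eval, hr.vars]
    · rintro s' rfl
      refine Runs.count Inv (by simp) (by simp [hr.size]) ?_ ?_
      · refine ⟨by simp [hr.base], fun y hy => by simp [hy, hr.vars], by simp, fun j hj => ?_, hm⟩
        simp [hj.ne]
      · rintro i hi s1 hx h1 ⟨i1, i2, i3, i4, i5⟩
        have hr1 : RegsOK (Function.update e x ⟨i, hi⟩) s1.reg := by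
          refine ⟨i1, h1, fun y => ?_⟩
          by_cases hy : y = x
          · subst hy; simp [hx]
          · simp [hy, i2 y hy]
        refine (ih (k + 1) _ _ s1 hr1 i5).mono le_rfl ?_
        rintro s2 ⟨g1, g2, g3⟩
        refine ⟨by simp [g1.vars], g1.size, by simp [g1.base], fun y hy => by simp [hy, g1.vars],
          ?_, ?_, ?_⟩
        · simp [g3 k (by omega), i3]
        · intro j hj; simp [g3 j (by omega), i4 j hj]
        · simpa [foldUpTo, hi] using g2
    · rintro s' ⟨hx, h1, i1, i2, i3, i4, i5⟩
      refine Runs.assign (by simp [Expr.cost]) ⟨⟨by simp [i1], by simp [h1], fun y => ?_⟩, i5, ?_⟩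
      · by_cases hy : y = x
        · subst hy; simp [Expr.eval, i3]
        · simp [hy, i2 y hy]
      · intro j hj; simp [i4 j hj]

/-- The machine program that runs a matrix program and presents the working matrix `out`. -/
def Stmt.program (S : Stmt) (out : ℕ) : Prog :=
  .seq (.seq (.assign 1 (.load (.lit 0)))
    (.ite (.reg 1)
      (.seq (S.compile 0) (.count (vreg 0) (.count (vreg 1)
        (.store (offExpr 0 1) (.load (addrExpr (out + 1) 0 1))))))
      .skip))
    (.assign 0 (.mul (.reg 1) (.reg 1)))

/-- The memory contents that describe an instance. -/
def Inst.encode {n : ℕ} (I : Inst n) : List ℕ :=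
  [n, I.numer, I.denom] ++ (List.ofFn fun k : Fin (n * n) => I.graph k.divNat k.modNat) ++
    List.ofFn fun k : Fin (n * n) => I.pairs k.divNat k.modNat

theorem Inst.length_encode {n : ℕ} (I : Inst n) : I.encode.length = 3 + 2 * (n * n) := by
  simp [encode]; omega

theorem divNat_modNat_offset {n : ℕ} (i j : Fin n) :
    (⟨i * n + j, offset_lt i j⟩ : Fin (n * n)).divNat = i ∧
      (⟨i * n + j, offset_lt i j⟩ : Fin (n * n)).modNat = j := by
  have hn := i.pos
  constructor <;> apply Fin.ext
  · simp only [Fin.divNat]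
    rw [mul_comm, Nat.mul_add_div hn, Nat.div_eq_of_lt j.2, add_zero]
  · simp only [Fin.modNat]
    simp [Nat.mod_eq_of_lt]

theorem Inst.memOK {n : ℕ} (I : Inst n) :
    MemOK I (fun _ _ _ => 0) (initStore I.encode).mem := by
  refine ⟨by simp [initStore, encode], by simp [initStore, encode], fun i j => ?_, fun i j => ?_,
    fun k i j => ?_⟩
  · have h := offset_lt i j
    obtain ⟨h1, h2⟩ := divNat_modNat_offset i j
    simp only [initStore, encode, List.cons_append, List.nil_append]
    rw [show 3 + ((i : ℕ) * n + j) = (i * n + j) + 1 + 1 + 1 by omega]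
    simp only [List.getD_cons_succ]
    rw [List.getD_append _ _ _ _ (by simpa using h), List.getD_eq_getElem _ _ (by simpa using h)]
    simp [h1, h2]
  · have h := offset_lt i j
    obtain ⟨h1, h2⟩ := divNat_modNat_offset i j
    simp only [initStore, encode, List.cons_append, List.nil_append]
    rw [show 3 + n * n + ((i : ℕ) * n + j) = (n * n + (i * n + j)) + 1 + 1 + 1 by omega]
    simp only [List.getD_cons_succ]
    rw [List.getD_append_right _ _ _ _ (by simp), List.getD_eq_getElem _ _ (by simpa using h)]
    simp [h1, h2]
  · simp only [initStore]
    refine List.getD_eq_default _ _ ?_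
    rw [length_encode]; omega

open Polynomial in
/-- A bound for the time that the machine program of a statement takes on `n` vertices. -/
noncomputable def Stmt.programTime (S : Stmt) (out : ℕ) : ℕ[X] :=
  S.time + (X * (X * (C (100 + out) + C (20 + out) * X) + C 20) + C 20) + C 10 + C 2 * X

theorem Stmt.program_outputs {n : ℕ} (I : Inst n) (S : Stmt) (out : ℕ) (ys : List ℕ)
    (hlen : ys.length = n * n)
    (hys : ∀ (hn : 0 < n) (i j : Fin n), S.run I (fun _ => ⟨0, hn⟩) (fun _ _ _ => 0) out i j =
      ys.getD (i * n + j) 0) :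
    (S.program out).OutputsWithin I.encode ys ((S.programTime out).eval n) := by
  have hinit : (initStore I.encode).mem 0 = n := by simp [initStore, Inst.encode]
  let s1 : Store := ⟨Function.update (initStore I.encode).reg 1 n, (initStore I.encode).mem⟩
  have hr0 : s1.reg 0 = 3 + 2 * (n * n) := by
    simp [s1, initStore, I.length_encode]
  change Runs _ _ _ _
  let R : Store → Prop := fun s => s.reg 1 = n ∧ ∀ i j : Fin n, s.mem (i * n + j) =
    ys.getD (i * n + j) 0
  refine (((Runs.assign (T := 3) (by simp [Expr.cost]) ?_).seq (R := fun s => s = s1)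
    (T' := 2 + (S.time.eval n +
      (n * (n * ((40 + out + (10 + out) * n) + 8) + 6 + 8) + 6) + 1)) (Q := R) ?_).seq
    (T' := 4 + 2 * n) ?_).mono ?_ (fun _ h => h)
  · simp [Expr.eval, hinit, s1]
  · rintro s rfl
    refine (Runs.ite (T := S.time.eval n +
      (n * (n * ((40 + out + (10 + out) * n) + 8) + 6 + 8) + 6) + 1) ?_ ?_).mono
      (by simp [Expr.cost]) (fun _ h => h)
    · intro hn
      have hn : 0 < n := Nat.pos_of_ne_zero (by simpa [Expr.eval, s1] using hn)
      let e : Env n := fun _ => ⟨0, hn⟩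
      have hr : RegsOK e s1.reg := by
        refine ⟨hr0, by simp [s1], fun x => ?_⟩
        simp [s1, e, initStore]
      refine ((S.compile_runs 0 e _ s1 hr I.memOK).seq ?_).mono (Nat.le_add_right _ _)
        (fun _ h => h)
      rintro s2 ⟨g1, g2, -⟩
      refine (runs_fillLoop (e := e) (A := fun i j => (i : ℕ) * n + j) (K := 0)
        (f := fun i j => ys.getD (i * n + j) 0) ?_ g1.base g1.size (fun y _ _ => g1.vars y)
        ?_).mono le_rfl ?_
      · intro i j i' j' h
        have := (addr_inj (k := 0) (k' := 0) (i := i) (i' := i') (j := j) (j' := j')).1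
          (by unfold addr; simpa using h)
        exact this.2
      · intro i j s3 hr3 hm3
        refine Runs.store ?_ ⟨hr3, fun _ _ => rfl, ?_, ?_⟩
        · have := offExpr_cost hr3 0 1
          have := addrExpr_cost hr3 (out + 1) 0 1
          simp only [Expr.cost]
          nlinarith
        · have : s3.mem (addr n (out + 1) i j) = ys.getD (i * n + j) 0 := by
            rw [hm3 _ fun i' j' => ?_, ← hys hn i j, ← g2.entry out i j]; rfl
            have := offset_lt i' j'
            unfold addr; omega
          simp only [offExpr_eval hr3, Expr.eval, addrExpr_eval hr3]
          simpa [addr] using this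
        · intro a ha
          simp only [offExpr_eval hr3]
          exact Function.update_of_ne (by simpa using ha) _ _
      · rintro s3 ⟨-, h1, -, -, h5, -⟩
        exact ⟨h1, h5⟩
    · intro hn
      have hn : n = 0 := by simpa [Expr.eval, s1] using hn
      refine (Runs.skip ⟨by simp [s1], fun i => ?_⟩).mono (Nat.le_add_left _ _) (fun _ h => h)
      subst hn; exact i.elim0
  · rintro s ⟨h1, h2⟩
    refine Runs.assign ?_ ⟨?_, ?_⟩
    · have := size_le_self n
      simp only [Expr.cost, Expr.eval, h1]; omega
    · simp [Expr.eval, h1, hlen]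
    · intro a ha
      rw [hlen] at ha
      have hn : 0 < n := Nat.pos_of_ne_zero (by rintro rfl; simp at ha)
      have := h2 ⟨a / n, Nat.div_lt_of_lt_mul ha⟩ ⟨a % n, Nat.mod_lt _ hn⟩
      simpa [Nat.div_add_mod'] using this
  · simp [programTime]; ring_nf; omega

end MatProg

/-! ### Weighted distances -/

namespace PairSpanner

open SimpleGraph

variable {V : Type*} {G H : SimpleGraph V}

/-- The weight of a walk: the sum of the weights of its steps. -/
def wt (w : V → V → ℕ) : ∀ {u v : V}, G.Walk u v → ℕ
  | _, _, .nil => 0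
  | u, _, .cons (v := v) _ p => w u v + wt w p

@[simp] theorem wt_nil (w : V → V → ℕ) (u : V) : wt w (Walk.nil : G.Walk u u) = 0 := rfl

@[simp] theorem wt_cons (w : V → V → ℕ) {u v x : V} (h : G.Adj u v) (p : G.Walk v x) :
    wt w (Walk.cons h p) = w u v + wt w p := rfl

@[simp] theorem wt_append (w : V → V → ℕ) {u v x : V} (p : G.Walk u v) (q : G.Walk v x) :
    wt w (p.append q) = wt w p + wt w q := by
  induction p with
  | nil => simp
  | cons h p ih => simp [ih, add_assoc]

theorem wt_reverse {w : V → V → ℕ} (hw : ∀ x y, w x y = w y x) {u v : V} (p : G.Walk u v) :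
    wt w p.reverse = wt w p := by
  induction p with
  | nil => rfl
  | cons h p ih => simp [ih, hw, add_comm]

theorem wt_one {u v : V} (p : G.Walk u v) : wt (fun _ _ => 1) p = p.length := by
  induction p with
  | nil => rfl
  | cons h p ih => simp [ih, add_comm]

theorem wt_le_length {w : V → V → ℕ} (hw : ∀ x y, w x y ≤ 1) {u v : V} (p : G.Walk u v) :
    wt w p ≤ p.length := by
  induction p with
  | nil => simp
  | cons h p ih =>
    have := hw
    rw [wt_cons, Walk.length_cons, add_comm]
    exact Nat.add_le_add ih (hw _ _)

theorem wt_const_add (m : ℕ) (w : V → V → ℕ) {u v : V} (p : G.Walk u v) :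
    wt (fun x y => m + w x y) p = m * p.length + wt w p := by
  induction p with
  | nil => simp
  | cons h p ih => simp [ih]; ring

theorem wt_bypass_le [DecidableEq V] (w : V → V → ℕ) {u v : V} (p : G.Walk u v) :
    wt w p.bypass ≤ wt w p := by
  induction p with
  | nil => simp [Walk.bypass]
  | @cons u v x h p ih =>
    simp only [Walk.bypass]
    split_ifs with hs
    · have := congrArg (wt w) (p.bypass.take_spec hs)
      rw [wt_append] at this
      rw [wt_cons]
      omega
    · simpa using ih

theorem exists_short_walk [Fintype V] (w : V → V → ℕ) {u v : V} (p : G.Walk u v) :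
    ∃ q : G.Walk u v, q.length < Fintype.card V ∧ wt w q ≤ wt w p := by
  classical
  exact ⟨p.bypass, p.bypass_isPath.length_lt, wt_bypass_le w p⟩

/-- The least weight of a walk from `x` to `y`, but at most `B`, which plays the role of
infinity. -/
noncomputable def wdist (G : SimpleGraph V) (w : V → V → ℕ) (B : ℕ) (x y : V) : ℕ :=
  sInf ({m | ∃ p : G.Walk x y, wt w p = m} ∪ {B})

section wdist

variable {w : V → V → ℕ} {B : ℕ} {x y z : V}

theorem wdist_le_bound : wdist G w B x y ≤ B := Nat.sInf_le (Or.inr rfl)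

theorem wdist_le (p : G.Walk x y) : wdist G w B x y ≤ wt w p := Nat.sInf_le (Or.inl ⟨p, rfl⟩)

theorem exists_walk_of_wdist_lt (h : wdist G w B x y < B) :
    ∃ p : G.Walk x y, wt w p = wdist G w B x y := by
  have := Nat.sInf_mem (s := {m | ∃ p : G.Walk x y, wt w p = m} ∪ {B}) ⟨B, Or.inr rfl⟩
  rcases this with h' | h'
  · exact h'
  · exact absurd h' h.ne

theorem le_wdist {m : ℕ} (hB : m ≤ B) (h : ∀ p : G.Walk x y, m ≤ wt w p) :
    m ≤ wdist G w B x y := by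
  rcases (wdist_le_bound (G := G) (w := w) (B := B) (x := x) (y := y)).lt_or_eq with h' | h'
  · obtain ⟨p, hp⟩ := exists_walk_of_wdist_lt h'
    exact hp ▸ h p
  · rw [h']; exact hB

@[simp] theorem wdist_self : wdist G w B x x = 0 :=
  Nat.le_zero.1 (wdist_le (Walk.nil : G.Walk x x))

theorem wdist_triangle : wdist G w B x z ≤ wdist G w B x y + wdist G w B y z := by
  rcases (wdist_le_bound (G := G) (w := w) (B := B) (x := x) (y := y)).lt_or_eq with h | h
  · rcases (wdist_le_bound (G := G) (w := w) (B := B) (x := y) (y := z)).lt_or_eq with h' | h'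
    · obtain ⟨p, hp⟩ := exists_walk_of_wdist_lt h
      obtain ⟨q, hq⟩ := exists_walk_of_wdist_lt h'
      rw [← hp, ← hq, ← wt_append]
      exact wdist_le _
    · rw [h']; exact wdist_le_bound.trans (Nat.le_add_left _ _)
  · rw [h]; exact wdist_le_bound.trans (Nat.le_add_right _ _)

theorem wdist_comm (hw : ∀ x y, w x y = w y x) : wdist G w B x y = wdist G w B y x := by
  have key : ∀ x y, wdist G w B x y ≤ wdist G w B y x := fun x y =>
    le_wdist wdist_le_bound fun p => wt_reverse hw p ▸ wdist_le p.reverse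
  exact le_antisymm (key _ _) (key _ _)

end wdist

/-- The Bellman-Ford iteration: the least weight of a walk with at most `k` steps, cut off
at `B`. -/
theorem bellmanFord {n : ℕ} (G : SimpleGraph (Fin n)) (w : Fin n → Fin n → ℕ) (B : ℕ)
    (step : Fin n → Fin n → ℕ) (hself : ∀ x, step x x = 0)
    (hadj : ∀ x y, G.Adj x y → step x y = w x y)
    (hnot : ∀ x y, x ≠ y → ¬ G.Adj x y → step x y = B)
    (D : ℕ → Fin n → Fin n → ℕ) (h0 : ∀ x y, D 0 x y = if x = y then 0 else B)
    (hD : ∀ k < n, ∀ x y, D (k + 1) x y = ⨅ z, (D k x z + step z y)) (x y : Fin n) :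
    D n x y = wdist G w B x y := by
  have hn : Nonempty (Fin n) := ⟨x⟩
  have upper : ∀ k ≤ n, ∀ x y, D k x y ≤ B ∧
      ∀ p : G.Walk x y, p.length ≤ k → D k x y ≤ wt w p := by
    intro k
    induction k with
    | zero =>
      intro _ x y
      rw [h0]
      refine ⟨by split_ifs <;> simp, fun p hp => ?_⟩
      have := Walk.eq_of_length_eq_zero (Nat.le_zero.1 hp)
      simp [this]
    | succ k ih =>
      intro hk x y
      have hle : ∀ z, D (k + 1) x y ≤ D k x z + step z y := fun z => by
        rw [hD k (by omega)]; exact ciInf_le (OrderBot.bddBelow _) z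
      have hmono : D (k + 1) x y ≤ D k x y := by simpa [hself] using hle y
      refine ⟨hmono.trans (ih (by omega) x y).1, fun p hp => ?_⟩
      obtain ⟨q, hq, hqp⟩ : ∃ q : G.Walk y x, q = p.reverse ∧ q.length = p.length :=
        ⟨_, rfl, by simp⟩
      cases q with
      | nil => exact hmono.trans ((ih (by omega) x _).2 p (by simp at hqp; omega))
      | @cons _ z _ hyz q =>
        have hp' : p = q.reverse.concat hyz.symm := by
          rw [← p.reverse_reverse, ← hq]; simp [Walk.concat_eq_append]
        subst hp'
        refine (hle z).trans ?_
        rw [hadj z y hyz.symm, Walk.concat_eq_append, wt_append]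
        have := (ih (by omega) x z).2 q.reverse (by simp at hqp hp ⊢; omega)
        simpa using this
  have lower : ∀ k ≤ n, ∀ x y, wdist G w B x y ≤ D k x y := by
    intro k
    induction k with
    | zero =>
      intro _ x y
      rw [h0]
      split_ifs with h
      · subst h; simp
      · exact wdist_le_bound
    | succ k ih =>
      intro hk x y
      rw [hD k (by omega)]
      refine le_ciInf fun z => ?_
      by_cases hzy : z = y
      · subst hzy; simpa [hself] using ih (by omega) x z
      · by_cases ha : G.Adj z y
        · rw [hadj z y ha]
          refine wdist_triangle.trans (Nat.add_le_add (ih (by omega) x z) ?_)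
          simpa using wdist_le (w := w) (B := B) (Walk.cons ha Walk.nil)
        · rw [hnot z y hzy ha]
          exact wdist_le_bound.trans (Nat.le_add_left _ _)
  refine le_antisymm ?_ (lower n le_rfl x y)
  refine le_wdist (upper n le_rfl x y).1 fun p => ?_
  obtain ⟨q, hq, hqp⟩ := exists_short_walk w p
  exact ((upper n le_rfl x y).2 q (by simpa using hq.le)).trans hqp

/-! ### Hop distances and missing edges -/

section hop

variable {n : ℕ} {G H H₀ : SimpleGraph (Fin n)} {s t u v x y z : Fin n}

/-- The distance in `G`, with the value `n + 3` for pairs in different components.  (The surplus is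
such that a distance that is too large by at most two is still less than that value.) -/
noncomputable def hd (G : SimpleGraph (Fin n)) (x y : Fin n) : ℕ :=
  wdist G (fun _ _ => 1) (n + 3) x y

theorem hd_le (p : G.Walk x y) : hd G x y ≤ p.length := wt_one p ▸ wdist_le p

theorem hd_comm : hd G x y = hd G y x := wdist_comm fun _ _ => rfl

theorem hd_triangle : hd G x z ≤ hd G x y + hd G y z := wdist_triangle

@[simp] theorem hd_self : hd G x x = 0 := wdist_self

theorem hd_le_one (h : G.Adj x y) : hd G x y ≤ 1 := hd_le (Walk.cons h Walk.nil)

theorem exists_walk_of_hd_lt (h : hd G x y < n) : ∃ p : G.Walk x y, p.length = hd G x y := by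
  obtain ⟨p, hp⟩ := exists_walk_of_wdist_lt (h.trans (Nat.lt_add_of_pos_right three_pos))
  exact ⟨p, wt_one p ▸ hp⟩

theorem hd_lt_of_walk (p : G.Walk x y) : hd G x y < n := by
  obtain ⟨q, hq, -⟩ := exists_short_walk (fun _ _ => 1) p
  exact (hd_le q).trans_lt (by simpa using hq)

theorem hd_lt_of_lt_add_three (h : hd G x y < n + 3) : hd G x y < n := by
  obtain ⟨p, -⟩ := exists_walk_of_wdist_lt h
  exact hd_lt_of_walk p

theorem hd_lt_iff : hd G x y < n ↔ G.Reachable x y :=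
  ⟨fun h => (exists_walk_of_hd_lt h).elim fun p _ => ⟨p⟩, fun ⟨p⟩ => hd_lt_of_walk p⟩

theorem hd_eq_dist (h : G.Reachable x y) : hd G x y = G.dist x y := by
  obtain ⟨p, hp⟩ := h.exists_walk_length_eq_dist
  obtain ⟨q, hq⟩ := exists_walk_of_hd_lt (hd_lt_iff.2 h)
  exact le_antisymm (hp ▸ hd_le p) (hq ▸ dist_le q)

theorem hd_mono (h : H ≤ G) : hd G x y ≤ hd H x y := by
  refine le_wdist (wdist_le_bound (G := G) (w := fun _ _ => 1)) fun p => ?_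
  rw [wt_one, ← p.length_map (Hom.ofLE h)]
  exact hd_le _

open Classical in
/-- The number of steps of a walk in `G` that are not edges of `H₀`. -/
noncomputable def miss (H₀ : SimpleGraph (Fin n)) (p : G.Walk x y) : ℕ :=
  wt (fun x y => if H₀.Adj x y then 0 else 1) p

theorem miss_nil : miss H₀ (Walk.nil : G.Walk x x) = 0 := rfl

theorem miss_append (p : G.Walk x y) (q : G.Walk y z) :
    miss H₀ (p.append q) = miss H₀ p + miss H₀ q := wt_append _ _ _

theorem miss_reverse (p : G.Walk x y) : miss H₀ p.reverse = miss H₀ p :=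
  wt_reverse (fun x y => by congr 1; exact propext (H₀.adj_comm x y)) p

theorem miss_le_length (p : G.Walk x y) : miss H₀ p ≤ p.length :=
  wt_le_length (fun x y => by split_ifs <;> simp) p

open Classical in
/-- The lexicographic distance: walks of `G` are compared by their length first, and by their
number of steps outside `H₀` second.  The pair `(l, m)` is written as the number `l * n + m`. -/
noncomputable def ld (G H₀ : SimpleGraph (Fin n)) (x y : Fin n) : ℕ :=
  wdist G (fun x y => n + if H₀.Adj x y then 0 else 1) (n * n) x y

/-- The least number of steps outside `H₀` on a shortest walk. -/
noncomputable def mc (G H₀ : SimpleGraph (Fin n)) (x y : Fin n) : ℕ := ld G H₀ x y - n * hd G x y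

theorem ld_comm : ld G H₀ x y = ld G H₀ y x := wdist_comm fun x y => by
  congr 2; exact propext (H₀.adj_comm x y)

theorem mc_comm : mc G H₀ x y = mc G H₀ y x := by rw [mc, mc, ld_comm, hd_comm]

theorem ld_le (p : G.Walk x y) : ld G H₀ x y ≤ n * p.length + miss H₀ p := by
  rw [miss, ← wt_const_add]; exact wdist_le p

theorem exists_min_walk (h : hd G x y < n) : ∃ p : G.Walk x y, p.length = hd G x y ∧
    miss H₀ p = mc G H₀ x y ∧ ld G H₀ x y = n * hd G x y + mc G H₀ x y ∧
    mc G H₀ x y ≤ hd G x y ∧ ld G H₀ x y < n * n := by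
  obtain ⟨q, hq⟩ := exists_walk_of_hd_lt h
  have h1 := ld_le (H₀ := H₀) q
  have h2 := miss_le_length (H₀ := H₀) q
  have h3 : n * q.length + n ≤ n * n := by
    calc n * q.length + n = n * (q.length + 1) := by ring
      _ ≤ n * n := Nat.mul_le_mul_left _ (by omega)
  have h4 : ld G H₀ x y < n * n := by omega
  obtain ⟨p, hp⟩ := exists_walk_of_wdist_lt h4
  rw [wt_const_add] at hp
  change n * p.length + miss H₀ p = ld G H₀ x y at hp
  have h5 : p.length = hd G x y := by
    refine le_antisymm ?_ (hd_le p)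
    by_contra hcon
    have : n * (q.length + 1) ≤ n * p.length := Nat.mul_le_mul_left _ (by omega)
    have : n * (q.length + 1) = n * q.length + n := by ring
    omega
  have h6 : miss H₀ p = mc G H₀ x y := by
    unfold mc; rw [← hp, h5]; omega
  refine ⟨p, h5, h6, by rw [← hp, h5, h6], ?_, h4⟩
  rw [← h6, ← h5]; exact miss_le_length p

theorem ld_lt_iff : ld G H₀ x y < n * n ↔ hd G x y < n := by
  refine ⟨fun h => ?_, fun h => (exists_min_walk h).choose_spec.2.2.2.2⟩
  obtain ⟨p, -⟩ := exists_walk_of_wdist_lt h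
  exact hd_lt_of_walk p

theorem ld_eq (h : hd G x y < n) : ld G H₀ x y = n * hd G x y + mc G H₀ x y :=
  (exists_min_walk h).choose_spec.2.2.1

/-- A walk is lexicographically shortest. -/
def IsMinWalk (H₀ : SimpleGraph (Fin n)) (p : G.Walk x y) : Prop :=
  p.length = hd G x y ∧ miss H₀ p = mc G H₀ x y

theorem isMinWalk_of_le (p : G.Walk x y) (h : n * p.length + miss H₀ p ≤ ld G H₀ x y) :
    IsMinWalk H₀ p := by
  have hr := hd_lt_of_walk p
  obtain ⟨-, -, -, h3, h4, -⟩ := exists_min_walk (H₀ := H₀) hr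
  rw [h3] at h
  have h5 : p.length = hd G x y := by
    refine le_antisymm ?_ (hd_le p)
    by_contra hcon
    have h6 : n * (hd G x y + 1) ≤ n * p.length := Nat.mul_le_mul_left _ (by omega)
    have : n * (hd G x y + 1) = n * hd G x y + n := by ring
    omega
  refine ⟨h5, le_antisymm ?_ ?_⟩
  · rw [h5] at h; omega
  · have := ld_le (H₀ := H₀) p
    rw [h3, h5] at this; omega

theorem IsMinWalk.reverse {p : G.Walk x y} (h : IsMinWalk H₀ p) : IsMinWalk H₀ p.reverse :=
  ⟨by rw [Walk.length_reverse, hd_comm, h.1], by rw [miss_reverse, mc_comm, h.2]⟩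

theorem IsMinWalk.of_append {p : G.Walk x y} {q : G.Walk y z}
    (h : IsMinWalk H₀ (p.append q)) : IsMinWalk H₀ p ∧ IsMinWalk H₀ q := by
  have hr := hd_lt_of_walk (p.append q)
  have h1 : n * (p.append q).length + miss H₀ (p.append q) = ld G H₀ x z := by
    rw [h.1, h.2, ld_eq hr]
  rw [Walk.length_append, miss_append, mul_add] at h1
  have h2 : ld G H₀ x z ≤ ld G H₀ x y + ld G H₀ y z := wdist_triangle
  have h3 := ld_le (H₀ := H₀) p
  have h4 := ld_le (H₀ := H₀) q
  exact ⟨isMinWalk_of_le p (by omega), isMinWalk_of_le q (by omega)⟩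

theorem IsMinWalk.ld_add {p : G.Walk x y} {q : G.Walk y z}
    (h : IsMinWalk H₀ (p.append q)) : ld G H₀ x y + ld G H₀ y z = ld G H₀ x z := by
  obtain ⟨hp, hq⟩ := h.of_append
  rw [ld_eq (hd_lt_of_walk p), ld_eq (hd_lt_of_walk q), ld_eq (hd_lt_of_walk (p.append q)),
    ← hp.1, ← hp.2, ← hq.1, ← hq.2, ← h.1, ← h.2, Walk.length_append, miss_append]
  ring

/-- A vertex at which the lexicographic triangle inequality is tight lies on a shortest walk with
the fewest steps outside `H₀`. -/
theorem exists_min_append (hr : hd G x z < n) (h : ld G H₀ x y + ld G H₀ y z = ld G H₀ x z) :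
    ∃ (p : G.Walk x y) (q : G.Walk y z), IsMinWalk H₀ (p.append q) := by
  have h1 := (ld_lt_iff (H₀ := H₀)).2 hr
  obtain ⟨p, p1, p2, p3, -, -⟩ := exists_min_walk (H₀ := H₀)
    (ld_lt_iff.1 (by omega : ld G H₀ x y < n * n))
  obtain ⟨q, q1, q2, q3, -, -⟩ := exists_min_walk (H₀ := H₀)
    (ld_lt_iff.1 (by omega : ld G H₀ y z < n * n))
  refine ⟨p, q, isMinWalk_of_le _ ?_⟩
  rw [Walk.length_append, miss_append, mul_add]
  rw [← p1, ← p2] at p3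
  rw [← q1, ← q2] at q3
  omega

theorem miss_split (p : G.Walk x y) (a b : ℕ) (h : miss H₀ p ≤ a + b) :
    ∃ (u : Fin n) (p₁ : G.Walk x u) (p₂ : G.Walk u y),
      p = p₁.append p₂ ∧ miss H₀ p₁ ≤ a ∧ miss H₀ p₂ ≤ b := by
  induction p generalizing a with
  | nil => exact ⟨_, .nil, .nil, rfl, by simp [miss_nil], by simp [miss_nil]⟩
  | @cons u v w e p ih =>
    by_cases hc : miss H₀ (Walk.cons e p) ≤ b
    · exact ⟨u, .nil, .cons e p, rfl, by simp [miss_nil], hc⟩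
    · simp only [miss, wt_cons] at h hc
      by_cases hH : H₀.Adj u v
      · simp only [hH, if_true, zero_add] at h
        obtain ⟨x, p₁, p₂, rfl, h1, h2⟩ := ih a h
        exact ⟨x, .cons e p₁, p₂, rfl, by simpa [miss, hH] using h1, h2⟩
      · simp only [hH, if_false] at h hc
        obtain ⟨x, p₁, p₂, rfl, h1, h2⟩ := ih (a - 1) (by unfold miss; omega)
        refine ⟨x, .cons e p₁, p₂, rfl, ?_, h2⟩
        simp only [miss, wt_cons, hH, if_false] at h1 ⊢
        omega

/-- The positions of the first `j` steps of a walk that are not edges of `H₀`. -/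
theorem exists_missing_positions (p : G.Walk x y) (j : ℕ) (hj : j ≤ miss H₀ p) :
    ∃ K : Finset ℕ, K.card = j ∧ ∀ k ∈ K, ∃ (u v : Fin n) (e : G.Adj u v) (p₁ : G.Walk x u)
      (p₂ : G.Walk v y), p = p₁.append (.cons e p₂) ∧ p₁.length = k ∧ ¬ H₀.Adj u v ∧
        miss H₀ p₁ < j := by
  induction p generalizing j with
  | nil => exact ⟨∅, by simp [miss_nil] at hj; simp [hj], by simp⟩
  | @cons a b c e p ih =>
    simp only [miss, wt_cons] at hj
    by_cases hH : H₀.Adj a b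
    · simp only [hH, if_true, zero_add] at hj
      obtain ⟨K, hK, h⟩ := ih j hj
      refine ⟨K.map ⟨Nat.succ, Nat.succ_injective⟩, by simpa using hK, ?_⟩
      simp only [Finset.mem_map, Function.Embedding.coeFn_mk, forall_exists_index, and_imp]
      rintro _ k hk rfl
      obtain ⟨u, v, e', p₁, p₂, rfl, h1, h2, h3⟩ := h k hk
      exact ⟨u, v, e', .cons e p₁, p₂, rfl, by simp [h1], h2, by simpa [miss, hH] using h3⟩
    · simp only [hH, if_false] at hj
      cases j with
      | zero => exact ⟨∅, rfl, by simp⟩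
      | succ j =>
        obtain ⟨K, hK, h⟩ := ih j (by unfold miss; omega)
        refine ⟨insert 0 (K.map ⟨Nat.succ, Nat.succ_injective⟩), ?_, ?_⟩
        · rw [Finset.card_insert_of_notMem (by simp)]; simpa using hK
        · intro k hk
          rcases Finset.mem_insert.1 hk with rfl | hk'
          · exact ⟨a, b, e, .nil, p, rfl, rfl, hH, by simp [miss_nil]⟩
          · simp only [Finset.mem_map, Function.Embedding.coeFn_mk] at hk'
            obtain ⟨l, hl, rfl⟩ := hk'
            obtain ⟨u, v, e', p₁, p₂, rfl, h1, h2, h3⟩ := h l hl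
            refine ⟨u, v, e', .cons e p₁, p₂, rfl, by simp [h1], h2, ?_⟩
            simp only [miss, wt_cons, hH, if_false] at h3 ⊢
            omega

end hop

end PairSpanner

namespace PairSpanner

open SimpleGraph

section cluster

variable {n : ℕ} {G H H₀ : SimpleGraph (Fin n)} {s t u v x y z : Fin n}

/-! ### Adding a walk to a subgraph -/

/-- The number of edges. -/
noncomputable def ecard (H : SimpleGraph (Fin n)) : ℕ := H.edgeSet.ncard

/-- `H` together with the edges of a walk. -/
def addWalk (H : SimpleGraph (Fin n)) (p : G.Walk x y) : SimpleGraph (Fin n) :=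
  H ⊔ fromEdgeSet {e | e ∈ p.edges}

theorem addWalk_adj {p : G.Walk x y} : (addWalk H p).Adj u v ↔ H.Adj u v ∨ s(u, v) ∈ p.edges := by
  simp only [addWalk, sup_adj, fromEdgeSet_adj, Set.mem_ofPred_eq]
  refine or_congr_right ⟨fun h => h.1, fun h => ⟨h, (p.adj_of_mem_edges h).ne⟩⟩

theorem le_addWalk (p : G.Walk x y) : H ≤ addWalk H p := le_sup_left

theorem addWalk_le (hH : H ≤ G) (p : G.Walk x y) : addWalk H p ≤ G := by
  intro u v h
  rcases addWalk_adj.1 h with h | h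
  · exact hH h
  · exact p.adj_of_mem_edges h

theorem hd_addWalk_le {p : G.Walk x y} (q : G.Walk u v) (h : ∀ e ∈ q.edges, e ∈ p.edges) :
    hd (addWalk H p) u v ≤ q.length := by
  have hq : ∀ e ∈ q.edges, e ∈ (addWalk H p).edgeSet := by
    intro e he
    induction e with | _ a b => exact addWalk_adj.2 (Or.inr (h _ he))
  have := hd_le (q.transfer _ hq)
  simpa using this

theorem ncard_missing_le (p : G.Walk x y) :
    {e | e ∈ p.edges ∧ e ∉ H₀.edgeSet}.ncard ≤ miss H₀ p := by
  induction p with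
  | nil => simp
  | @cons a b c e p ih =>
    simp only [miss, wt_cons]
    by_cases h : H₀.Adj a b
    · refine le_trans (le_of_eq ?_) (ih.trans (Nat.le_add_left _ _))
      congr 1
      ext f
      simp only [Walk.edges_cons, List.mem_cons, Set.mem_ofPred_eq]
      constructor
      · rintro ⟨rfl | h1, h2⟩
        · exact absurd h h2
        · exact ⟨h1, h2⟩
      · rintro ⟨h1, h2⟩; exact ⟨Or.inr h1, h2⟩
    · simp only [h, if_false]
      refine (Set.ncard_le_ncard (t := insert s(a, b) {e | e ∈ p.edges ∧ e ∉ H₀.edgeSet})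
        ?_ (Set.toFinite _)).trans ((Set.ncard_insert_le _ _).trans ?_)
      · rintro f ⟨h1, h2⟩
        simp only [Walk.edges_cons, List.mem_cons] at h1
        rcases h1 with rfl | h1
        · exact Or.inl rfl
        · exact Or.inr ⟨h1, h2⟩
      · have := ih
        simp only [miss] at this
        omega

theorem ecard_addWalk_le (hH : H₀ ≤ H) (p : G.Walk x y) :
    ecard (addWalk H p) ≤ ecard H + miss H₀ p := by
  have h : (addWalk H p).edgeSet ⊆ H.edgeSet ∪ {e | e ∈ p.edges ∧ e ∉ H₀.edgeSet} := by
    intro e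
    induction e with | _ a b =>
    intro he
    by_cases hab : H.Adj a b
    · exact Or.inl hab
    · rcases addWalk_adj.1 he with h | h
      · exact absurd h hab
      · exact Or.inr ⟨h, fun h' => hab (hH h')⟩
  exact (Set.ncard_le_ncard h (Set.toFinite _)).trans
    ((Set.ncard_union_le _ _).trans (Nat.add_le_add_left (ncard_missing_le p) _))

theorem ecard_le_of_subset_image (S : Finset (Fin n × Fin n))
    (h : ∀ u v, H.Adj u v → (u, v) ∈ S ∨ (v, u) ∈ S) : ecard H ≤ S.card := by
  classical
  have : H.edgeSet ⊆ ((S.image fun p => s(p.1, p.2) : Finset (Sym2 (Fin n))) : Set _) := by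
    intro e
    induction e with | _ a b =>
    intro he
    simp only [Finset.coe_image, Set.mem_image, Finset.mem_coe, Prod.exists]
    rcases h a b he with h | h
    · exact ⟨a, b, h, rfl⟩
    · exact ⟨b, a, h, Sym2.eq_swap⟩
  refine (Set.ncard_le_ncard this (Set.toFinite _)).trans ?_
  rw [Set.ncard_coe_finset]
  exact Finset.card_image_le

/-! ### Clusters -/

open Classical in
/-- A clustering with parameter `h`: disjoint stars with at least `h` leaves, where `cl c y` says
that `y` is a leaf of the star with center `c`, such that every vertex has at most `h` neighbours
outside of the stars.  (A center need not be a leaf of a star itself.)  The graph `H₀` consists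
of the stars and of all edges with an endpoint that is no leaf. -/
structure IsClustering (G H₀ : SimpleGraph (Fin n)) (cl : Fin n → Fin n → Prop) (h : ℕ) : Prop where
  adj : ∀ c y, cl c y → G.Adj c y
  unique : ∀ c c' y, cl c y → cl c' y → c = c'
  base : ∀ x y, H₀.Adj x y ↔
    G.Adj x y ∧ ((∀ c, ¬ cl c x) ∨ (∀ c, ¬ cl c y) ∨ cl x y ∨ cl y x)
  large : ∀ c, (∃ y, cl c y) → h ≤ (Finset.univ.filter fun y => cl c y).card
  sparse : ∀ v, (Finset.univ.filter fun y => G.Adj v y ∧ ∀ c, ¬ cl c y).card ≤ h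

open Classical in
/-- The centers of the stars. -/
noncomputable def centers (cl : Fin n → Fin n → Prop) : Finset (Fin n) :=
  Finset.univ.filter fun c => ∃ y, cl c y

variable {cl : Fin n → Fin n → Prop} {h : ℕ}

theorem mem_centers {c : Fin n} : c ∈ centers cl ↔ ∃ y, cl c y := by simp [centers]

theorem IsClustering.le (hc : IsClustering G H₀ cl h) : H₀ ≤ G := fun x y hxy =>
  ((hc.base x y).1 hxy).1

theorem IsClustering.adj_base (hc : IsClustering G H₀ cl h) {c y : Fin n} (hy : cl c y) :
    H₀.Adj c y := (hc.base c y).2 ⟨hc.adj c y hy, by tauto⟩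

theorem IsClustering.exists_center (hc : IsClustering G H₀ cl h) (huv : G.Adj u v)
    (hn : ¬ H₀.Adj u v) : ∃ c, cl c u := by
  by_contra hcon
  push Not at hcon
  exact hn ((hc.base u v).2 ⟨huv, Or.inl hcon⟩)

theorem IsClustering.card_centers (hc : IsClustering G H₀ cl h) : (centers cl).card * h ≤ n := by
  classical
  calc (centers cl).card * h = ∑ _c ∈ centers cl, h := by simp
    _ ≤ ∑ c ∈ centers cl, (Finset.univ.filter fun y => cl c y).card :=
        Finset.sum_le_sum fun c hcc => hc.large c (mem_centers.1 hcc)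
    _ = ((centers cl).biUnion fun c => Finset.univ.filter fun y => cl c y).card := by
        rw [Finset.card_biUnion]
        intro c _ c' _ hne
        rw [Function.onFun, Finset.disjoint_left]
        intro y h1 h2
        exact hne (hc.unique c c' y (by simpa using h1) (by simpa using h2))
    _ ≤ n := (Finset.card_le_univ _).trans (by simp)

theorem IsClustering.ecard_le (hc : IsClustering G H₀ cl h) : ecard H₀ ≤ n + n * h := by
  classical
  let A : Finset (Fin n × Fin n) := Finset.univ.filter fun p => cl p.1 p.2
  let B : Finset (Fin n × Fin n) := Finset.univ.filter fun p => G.Adj p.1 p.2 ∧ ∀ c, ¬ cl c p.2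
  have hA : A.card ≤ n := by
    refine (Finset.card_le_card_of_injOn Prod.snd (t := Finset.univ) (by simp) ?_).trans (by simp)
    rintro ⟨a, b⟩ h1 ⟨a', b'⟩ h2 (rfl : b = b')
    have := hc.unique a a' b (by simpa [A] using h1) (by simpa [A] using h2)
    rw [this]
  have hB : B.card ≤ n * h := by
    have : B ⊆ Finset.univ.biUnion fun v : Fin n =>
        (Finset.univ.filter fun y => G.Adj v y ∧ ∀ c, ¬ cl c y).image fun y => (v, y) := by
      rintro ⟨v, y⟩ hp
      simp only [B, Finset.mem_filter, Finset.mem_univ, true_and] at hp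
      simp only [Finset.mem_biUnion, Finset.mem_image, Finset.mem_filter, Finset.mem_univ, true_and]
      exact ⟨v, y, hp, rfl⟩
    refine (Finset.card_le_card this).trans (Finset.card_biUnion_le.trans ?_)
    refine (Finset.sum_le_sum fun v _ => Finset.card_image_le.trans (hc.sparse v)).trans ?_
    simp
  refine (ecard_le_of_subset_image (A ∪ B) ?_).trans
    ((Finset.card_union_le _ _).trans (Nat.add_le_add hA hB))
  intro u v huv
  obtain ⟨hG, h1 | h1 | h1 | h1⟩ := (hc.base u v).1 huv
  · exact Or.inr (by simp [B, hG.symm, h1])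
  · exact Or.inl (by simp [B, hG, h1])
  · exact Or.inl (by simp [A, h1])
  · exact Or.inr (by simp [A, h1])

/-- A shortest walk meets a star at most three times, so its first `j` steps outside `H₀` start in
at least `j / 3` different stars. -/
theorem IsClustering.exists_centers (hc : IsClustering G H₀ cl h) (p : G.Walk s t)
    (hp : p.length = hd G s t) {j : ℕ} (hj : j ≤ miss H₀ p) :
    ∃ C : Finset (Fin n), j ≤ 3 * C.card ∧ ∀ c ∈ C, ∃ (u : Fin n) (p₁ : G.Walk s u)
      (p₂ : G.Walk u t), cl c u ∧ p = p₁.append p₂ ∧ miss H₀ p₁ < j := by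
  classical
  obtain ⟨K, hK, hKp⟩ := exists_missing_positions p j hj
  have hKp' : ∀ k, ∃ c, k ∈ K → ∃ (u : Fin n) (p₁ : G.Walk s u) (p₂ : G.Walk u t), cl c u ∧
      p = p₁.append p₂ ∧ miss H₀ p₁ < j ∧ p₁.length = k := by
    intro k
    by_cases hk : k ∈ K
    · obtain ⟨u, v, e, p₁, p₂, h1, h2, h3, h4⟩ := hKp k hk
      obtain ⟨c, hcu⟩ := hc.exists_center e h3
      exact ⟨c, fun _ => ⟨u, p₁, _, hcu, h1, h4, h2⟩⟩
    · exact ⟨s, fun h => absurd h hk⟩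
  choose f hf using hKp'
  refine ⟨K.image f, ?_, ?_⟩
  · rw [← hK]
    refine Finset.card_le_mul_card_image (f := f) K 3 fun c _ => ?_
    by_contra hcon
    push Not at hcon
    have hne : (K.filter fun k => f k = c).Nonempty := Finset.card_pos.1 (by omega)
    set m := (K.filter fun k => f k = c).min' hne
    have hsub : (K.filter fun k => f k = c) ⊆ Finset.Icc m (m + 2) := by
      intro k hk
      rw [Finset.mem_Icc]
      refine ⟨Finset.min'_le _ _ hk, ?_⟩
      have hm := Finset.min'_mem _ hne
      obtain ⟨hm1, hm2⟩ := Finset.mem_filter.1 hm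
      obtain ⟨hk1, hk2⟩ := Finset.mem_filter.1 hk
      obtain ⟨u, p₁, p₂, h1, h2, -, h4⟩ := hf _ hm1
      obtain ⟨u', q₁, q₂, g1, g2, -, g4⟩ := hf _ hk1
      rw [hm2] at h1
      rw [hk2] at g1
      -- the detour through the center is a walk from `s` to `t`
      have h5 := hd_le (p₁.append (Walk.cons (hc.adj _ _ h1).symm
        (Walk.cons (hc.adj _ _ g1) q₂)))
      have h6 := congrArg Walk.length g2
      simp only [Walk.length_append, Walk.length_cons] at h5 h6
      change p₁.length = m at h4
      omega
    have := Finset.card_le_card hsub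
    simp at this
    omega
  · intro c hcc
    obtain ⟨k, hk, rfl⟩ := Finset.mem_image.1 hcc
    obtain ⟨u, p₁, p₂, h1, h2, h3, -⟩ := hf k hk
    exact ⟨u, p₁, p₂, h1, h2, h3⟩

/-! ### The cost of connecting centers -/

open Classical in
/-- The pairs in `A × B` whose distance in `H` exceeds that in `G` by at most `k`. -/
noncomputable def nearPairs (G H : SimpleGraph (Fin n)) (A B : Finset (Fin n)) (k : ℕ) :
    Finset (Fin n × Fin n) :=
  (A ×ˢ B).filter fun p => hd H p.1 p.2 ≤ hd G p.1 p.2 + k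

theorem nearPairs_mono {H H' : SimpleGraph (Fin n)} (hH : H ≤ H') (A B : Finset (Fin n)) (k : ℕ) :
    nearPairs G H A B k ⊆ nearPairs G H' A B k := by
  intro p hp
  simp only [nearPairs, Finset.mem_filter] at hp ⊢
  exact ⟨hp.1, (hd_mono hH).trans hp.2⟩

/-- The potential that pays for the walks between centers. -/
noncomputable def potential (G H : SimpleGraph (Fin n)) (S C : Finset (Fin n)) (κ : ℕ) : ℕ :=
  κ * (nearPairs G H C C 0).card + 3 * ∑ k ∈ Finset.range 3, (nearPairs G H S C k).card

theorem card_nearPairs_le (A B : Finset (Fin n)) (k : ℕ) :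
    (nearPairs G H A B k).card ≤ A.card * B.card := by
  rw [← Finset.card_product]; exact Finset.card_filter_le _ _

theorem potential_le (S C : Finset (Fin n)) (κ : ℕ) :
    potential G H S C κ ≤ κ * (C.card * C.card) + 9 * (S.card * C.card) := by
  unfold potential
  have h1 := Nat.mul_le_mul_left κ (card_nearPairs_le (G := G) (H := H) C C 0)
  have h2 : ∑ k ∈ Finset.range 3, (nearPairs G H S C k).card ≤ 3 * (S.card * C.card) :=
    (Finset.sum_le_sum fun k _ => card_nearPairs_le S C k).trans (by simp)
  omega

theorem potential_short {S C : Finset (Fin n)} {κ : ℕ} {p : G.Walk x y} (hx : x ∈ C) (hy : y ∈ C)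
    (hp : IsMinWalk H₀ p) (hκ : hd G x y ≤ κ) (hH : H₀ ≤ H) (hlt : hd G x y < hd H x y) :
    ecard (addWalk H p) + potential G H S C κ ≤ ecard H + potential G (addWalk H p) S C κ := by
  have h1 := ecard_addWalk_le hH p
  have h2 : miss H₀ p ≤ κ := (miss_le_length p).trans (hp.1 ▸ hκ)
  have h3 : ∑ k ∈ Finset.range 3, (nearPairs G H S C k).card ≤
      ∑ k ∈ Finset.range 3, (nearPairs G (addWalk H p) S C k).card :=
    Finset.sum_le_sum fun k _ => Finset.card_le_card (nearPairs_mono (le_addWalk p) _ _ _)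
  have h4 : (nearPairs G H C C 0).card + 1 ≤ (nearPairs G (addWalk H p) C C 0).card := by
    refine Finset.card_lt_card ⟨nearPairs_mono (le_addWalk p) _ _ _, fun hsub => ?_⟩
    have hm : (x, y) ∈ nearPairs G (addWalk H p) C C 0 := by
      simp only [nearPairs, Finset.mem_filter, Finset.mem_product]
      exact ⟨⟨hx, hy⟩, (hd_addWalk_le p fun _ h => h).trans (by rw [hp.1]; exact le_rfl)⟩
    have := hsub hm
    simp only [nearPairs, Finset.mem_filter] at this
    omega
  have h5 := Nat.mul_le_mul_left κ h4
  rw [mul_add, mul_one] at h5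
  unfold potential
  omega

/-- A walk between two special vertices whose distance in `H` is too large by more than two pays
for itself: every star that it meets gets closer to one of the two. -/
theorem IsClustering.potential_far (hc : IsClustering G H₀ cl h) {S : Finset (Fin n)} {κ : ℕ}
    {p : G.Walk x y} (hx : x ∈ S) (hy : y ∈ S) (hp : IsMinWalk H₀ p) (hH : H₀ ≤ H)
    (hlt : hd G x y + 2 < hd H x y) :
    ecard (addWalk H p) + potential G H S (centers cl) κ ≤
      ecard H + potential G (addWalk H p) S (centers cl) κ := by
  classical
  have h1 := ecard_addWalk_le hH p
  have h2 : (nearPairs G H (centers cl) (centers cl) 0).card ≤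
      (nearPairs G (addWalk H p) (centers cl) (centers cl) 0).card :=
    Finset.card_le_card (nearPairs_mono (le_addWalk p) _ _ _)
  obtain ⟨C, hC, hCp⟩ := hc.exists_centers p hp.1 le_rfl
  -- the pairs that become near, for each of the three tolerances
  let N : ℕ → Finset (Fin n × Fin n) := fun k =>
    nearPairs G (addWalk H p) S (centers cl) k \ nearPairs G H S (centers cl) k
  have hN : ∀ k, (N k).card + (nearPairs G H S (centers cl) k).card =
      (nearPairs G (addWalk H p) S (centers cl) k).card := fun k =>
    Finset.card_sdiff_add_card_eq_card (nearPairs_mono (le_addWalk p) _ _ _)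
  have hsub : C ⊆ (Finset.range 3).biUnion fun k => (N k).image Prod.snd := by
    intro c hcC
    obtain ⟨u, p₁, p₂, hcu, rfl, -⟩ := hCp c hcC
    have hadj := hc.adj_base hcu
    have hcen : c ∈ centers cl := mem_centers.2 ⟨u, hcu⟩
    have hlen := hp.1
    rw [Walk.length_append] at hlen
    have e1 : hd (addWalk H (p₁.append p₂)) x u ≤ p₁.length := hd_addWalk_le p₁ (by simp; tauto)
    have e2 : hd (addWalk H (p₁.append p₂)) u y ≤ p₂.length := hd_addWalk_le p₂ (by simp; tauto)
    have e3 : hd (addWalk H (p₁.append p₂)) c u ≤ 1 := hd_le_one (le_addWalk _ (hH hadj))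
    have e4 : hd G c u ≤ 1 := hd_le_one (hc.le hadj)
    have f1 := hd_le p₁
    have f2 := hd_le p₂
    have t1 := hd_triangle (G := G) (x := x) (y := u) (z := y)
    have t2 := hd_triangle (G := G) (x := x) (y := c) (z := u)
    have t3 := hd_triangle (G := G) (x := y) (y := c) (z := u)
    have t4 := hd_triangle (G := addWalk H (p₁.append p₂)) (x := x) (y := u) (z := c)
    have t5 := hd_triangle (G := addWalk H (p₁.append p₂)) (x := y) (y := u) (z := c)
    have t6 := hd_triangle (G := G) (x := x) (y := u) (z := c)
    have t7 := hd_triangle (G := G) (x := y) (y := u) (z := c)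
    have t8 := hd_triangle (G := H) (x := x) (y := c) (z := y)
    rw [hd_comm (x := u) (y := c)] at t4 t5 t6 t7
    rw [hd_comm (x := y) (y := u)] at t3 t5 t7
    rw [hd_comm (x := c) (y := y)] at t8
    -- one of the two ends was too far from the center before
    have key : ∀ z ∈ S, ∀ m, hd (addWalk H (p₁.append p₂)) z c ≤ m + 1 → m + 1 < hd H z c →
        hd G z c ≤ m + 1 → m ≤ hd G z c + 1 →
        c ∈ (Finset.range 3).biUnion fun k => (N k).image Prod.snd := by
      intro z hz m k1 k2 k3 k4
      simp only [Finset.mem_biUnion, Finset.mem_range, Finset.mem_image, Prod.exists,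
        exists_eq_right]
      refine ⟨m + 1 - hd G z c, by omega, z, ?_⟩
      simp only [N, nearPairs, Finset.mem_sdiff, Finset.mem_filter, Finset.mem_product]
      refine ⟨⟨⟨hz, hcen⟩, by omega⟩, fun h => ?_⟩
      have := h.2
      omega
    by_cases hfar : p₁.length + 1 < hd H x c
    · exact key x hx p₁.length (by omega) hfar (by omega) (by omega)
    · exact key y hy p₂.length (by omega) (by omega) (by omega) (by omega)
  have h3 : C.card ≤ ∑ k ∈ Finset.range 3, (N k).card :=
    (Finset.card_le_card hsub).trans (Finset.card_biUnion_le.trans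
      (Finset.sum_le_sum fun k _ => Finset.card_image_le))
  have h4 : ∑ k ∈ Finset.range 3, (N k).card +
      ∑ k ∈ Finset.range 3, (nearPairs G H S (centers cl) k).card =
      ∑ k ∈ Finset.range 3, (nearPairs G (addWalk H p) S (centers cl) k).card := by
    rw [← Finset.sum_add_distrib]; exact Finset.sum_congr rfl fun k _ => hN k
  have h5 := Nat.mul_le_mul_left κ h2
  unfold potential
  omega

end cluster

end PairSpanner

namespace PairSpanner

open SimpleGraph

/-! ### Greedy hitting sets -/

section hitting

variable {n : ℕ} {ι : Type*}

open Classical in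
/-- The members of the family `A` that `S` does not meet. -/
noncomputable def unhit (I : Finset ι) (A : ι → Fin n → Prop) (S : Finset (Fin n)) : Finset ι :=
  I.filter fun i => ∀ c ∈ S, ¬ A i c

open Classical in
/-- The number of members of the family that `c`, but no element of `S`, belongs to. -/
noncomputable def gain (I : Finset ι) (A : ι → Fin n → Prop) (S : Finset (Fin n)) (c : Fin n) : ℕ :=
  ((unhit I A S).filter fun i => A i c).card

/-- One step of the greedy algorithm: an element of largest gain is added to `S`, if there is an
element of positive gain. -/
def GreedyStep (I : Finset ι) (A : ι → Fin n → Prop) (S S' : Finset (Fin n)) : Prop :=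
  ((∀ c, gain I A S c = 0) ∧ S' = S) ∨
    ∃ c, 0 < gain I A S c ∧ (∀ c', gain I A S c' ≤ gain I A S c) ∧ S' = insert c S

variable {I : Finset ι} {A : ι → Fin n → Prop} {S : Finset (Fin n)}

theorem card_unhit_insert (c : Fin n) :
    (unhit I A (insert c S)).card + gain I A S c = (unhit I A S).card := by
  classical
  rw [gain, add_comm, ← Finset.card_filter_add_card_filter_not (fun i => A i c)
    (s := unhit I A S)]
  congr 2
  ext i
  simp only [unhit, Finset.mem_filter, Finset.mem_insert, forall_eq_or_imp]
  tauto

theorem notMem_of_gain_pos {c : Fin n} (h : 0 < gain I A S c) : c ∉ S := by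
  intro hc
  obtain ⟨i, hi⟩ := Finset.card_pos.1 h
  simp only [unhit, Finset.mem_filter] at hi
  exact hi.1.2 c hc hi.2

open Classical in
theorem card_unhit_mul_le {C : Finset (Fin n)} {j g : ℕ} (hC : ∀ i ∈ I, ∀ c, A i c → c ∈ C)
    (hj : ∀ i ∈ I, j ≤ 3 * (Finset.univ.filter fun c => A i c).card)
    (hg : ∀ c, gain I A S c ≤ g) : (unhit I A S).card * j ≤ 3 * C.card * g := by
  calc (unhit I A S).card * j = ∑ _i ∈ unhit I A S, j := by simp
    _ ≤ ∑ i ∈ unhit I A S, 3 * (C.filter fun c => A i c).card := by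
        refine Finset.sum_le_sum fun i hi => ?_
        have hi' := (Finset.mem_filter.1 hi).1
        refine (hj i hi').trans (Nat.mul_le_mul_left _ (Finset.card_le_card fun c hc => ?_))
        simp only [Finset.mem_filter, Finset.mem_univ, true_and] at hc ⊢
        exact ⟨hC i hi' c hc, hc⟩
    _ = 3 * ∑ c ∈ C, gain I A S c := by
        rw [← Finset.mul_sum]
        congr 1
        simp only [gain, Finset.card_filter]
        exact Finset.sum_comm
    _ ≤ 3 * (C.card * g) := by
        refine Nat.mul_le_mul_left _ ?_
        exact (Finset.sum_le_sum fun c _ => hg c).trans (by simp)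
    _ = 3 * C.card * g := by ring

open Classical in
theorem greedy_hitting {C : Finset (Fin n)} {j : ℕ} (hj0 : 0 < j)
    (hC : ∀ i ∈ I, ∀ c, A i c → c ∈ C)
    (hj : ∀ i ∈ I, j ≤ 3 * (Finset.univ.filter fun c => A i c).card)
    (T : ℕ → Finset (Fin n)) (h0 : T 0 = ∅) (hT : ∀ r < n, GreedyStep I A (T r) (T (r + 1))) :
    (∀ i ∈ I, ∃ c ∈ T n, A i c) ∧ T n ⊆ C ∧
      ((T n).card : ℝ) ≤ 1 + 3 * C.card / j * Real.log I.card := by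
  set ρ : ℝ := 1 - j / (3 * C.card) with hρ
  have hInv : ∀ r ≤ n, T r ⊆ C ∧ (unhit I A (T r) = ∅ ∨ r ≤ (T r).card) ∧
      ((unhit I A (T r)).card : ℝ) ≤ I.card * ρ ^ (T r).card ∧
      ((T r).card ≠ 0 → (1 : ℝ) ≤ I.card * ρ ^ ((T r).card - 1)) := by
    intro r
    induction r with
    | zero =>
      intro _
      rw [h0]
      refine ⟨by simp, by simp, ?_, by simp⟩
      simp only [Finset.card_empty, pow_zero, mul_one, Nat.cast_le]
      exact Finset.card_le_card (Finset.filter_subset _ _)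
    | succ r ih =>
      intro hr
      obtain ⟨i1, i2, i3, i4⟩ := ih (by omega)
      rcases hT r (by omega) with ⟨hz, he⟩ | ⟨c, hc, hmax, he⟩
      · rw [he]
        refine ⟨i1, Or.inl ?_, i3, i4⟩
        have := card_unhit_mul_le hC hj (S := T r) (g := 0) (fun c => (hz c).le)
        rw [mul_zero, Nat.le_zero, mul_eq_zero] at this
        exact Finset.card_eq_zero.1 (this.resolve_right hj0.ne')
      · have hnot := notMem_of_gain_pos hc
        have hsum := card_unhit_insert (I := I) (A := A) (S := T r) c
        have hpig := card_unhit_mul_le hC hj hmax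
        have hcC : c ∈ C := by
          obtain ⟨i, hi⟩ := Finset.card_pos.1 hc
          simp only [unhit, Finset.mem_filter] at hi
          exact hC i hi.1.1 c hi.2
        have hCpos : (0 : ℝ) < C.card := by exact_mod_cast Finset.card_pos.2 ⟨c, hcC⟩
        have hpig' : ((unhit I A (T r)).card : ℝ) * j ≤ 3 * C.card * gain I A (T r) c := by
          exact_mod_cast hpig
        have hsum' : ((unhit I A (insert c (T r))).card : ℝ) + gain I A (T r) c =
            (unhit I A (T r)).card := by exact_mod_cast hsum
        have hcard : (insert c (T r)).card = (T r).card + 1 := Finset.card_insert_of_notMem hnot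
        have hstep : ((unhit I A (insert c (T r))).card : ℝ) ≤ (unhit I A (T r)).card * ρ := by
          have h1 : ((unhit I A (T r)).card : ℝ) * (j / (3 * C.card)) ≤ gain I A (T r) c := by
            rw [← mul_div_assoc, div_le_iff₀ (by positivity)]
            linarith
          rw [hρ, mul_sub, mul_one]
          linarith
        have hone : (1 : ℝ) ≤ (unhit I A (T r)).card := by
          have : 1 ≤ (unhit I A (T r)).card := by omega
          exact_mod_cast this
        have hρ0 : 0 ≤ ρ := by
          by_contra hneg
          push Not at hneg
          have : ((unhit I A (T r)).card : ℝ) * ρ < 0 := mul_neg_of_pos_of_neg (by linarith) hneg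
          have : (0 : ℝ) ≤ (unhit I A (insert c (T r))).card := Nat.cast_nonneg _
          linarith
        rw [he, hcard]
        refine ⟨Finset.insert_subset hcC i1, ?_, ?_, fun _ => ?_⟩
        · rcases i2 with i2 | i2
          · rw [i2] at hone; norm_num at hone
          · right; omega
        · rw [pow_succ, ← mul_assoc]
          exact hstep.trans (mul_le_mul_of_nonneg_right i3 hρ0)
        · rw [Nat.add_sub_cancel]
          exact hone.trans i3
  obtain ⟨h1, h2, h3, h4⟩ := hInv n le_rfl
  refine ⟨fun i hi => ?_, h1, ?_⟩
  · by_contra hcon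
    push Not at hcon
    have hmem : i ∈ unhit I A (T n) := Finset.mem_filter.2 ⟨hi, hcon⟩
    rcases h2 with h2 | h2
    · rw [h2] at hmem; simp at hmem
    · have huniv : T n = Finset.univ := Finset.eq_univ_of_card _
        (le_antisymm (Finset.card_le_univ _) (by simpa using h2))
      have hpos : 0 < (Finset.univ.filter fun c => A i c).card := by
        have := hj i hi; omega
      obtain ⟨c, hc⟩ := Finset.card_pos.1 hpos
      exact hcon c (huniv ▸ Finset.mem_univ c) (by simpa using hc)
  · by_cases hs : (T n).card = 0
    · rw [hs]
      have : 0 ≤ Real.log I.card := Real.log_natCast_nonneg _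
      simp only [Nat.cast_zero]
      positivity
    · have h5 := h4 hs
      have hCpos : (0 : ℝ) < C.card := by
        have : 0 < C.card := lt_of_lt_of_le (Nat.pos_of_ne_zero hs) (Finset.card_le_card h1)
        exact_mod_cast this
      have hI : (0 : ℝ) < I.card := by
        rcases Nat.eq_zero_or_pos I.card with h0 | h0
        · rw [h0] at h5; norm_num at h5
        · exact_mod_cast h0
      by_cases hρ0 : 0 ≤ ρ
      · have h6 : ρ ≤ Real.exp (-(j / (3 * C.card))) := by
          have := Real.add_one_le_exp (-((j : ℝ) / (3 * C.card)))
          rw [hρ]; linarith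
        have h7 : (1 : ℝ) ≤ I.card * Real.exp (-(j / (3 * C.card)) * ((T n).card - 1 : ℕ)) := by
          refine h5.trans (mul_le_mul_of_nonneg_left ?_ hI.le)
          rw [mul_comm (-_), Real.exp_nat_mul]
          exact pow_le_pow_left₀ hρ0 h6 _
        have h8 := Real.log_le_log one_pos h7
        rw [Real.log_one, Real.log_mul hI.ne' (Real.exp_ne_zero _), Real.log_exp] at h8
        rw [Nat.cast_sub (by omega), Nat.cast_one] at h8
        have hj' : (0 : ℝ) < j := by exact_mod_cast hj0
        have h9 : ((T n).card - 1 : ℝ) * (j / (3 * C.card)) ≤ Real.log I.card := by linarith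
        have h10 : ((T n).card - 1 : ℝ) ≤ Real.log I.card / (j / (3 * C.card)) :=
          (le_div_iff₀ (by positivity)).2 h9
        have h11 : Real.log I.card / (j / (3 * C.card)) = 3 * C.card / j * Real.log I.card := by
          field_simp
        linarith
      · -- a negative factor means that the first element met everything
        have hle : (T n).card ≤ 1 := by
          by_contra hcon
          have hI2 : I.Nonempty := Finset.card_pos.1 (by exact_mod_cast hI)
          obtain ⟨i, hi⟩ := hI2
          have h6 : j ≤ 3 * C.card := (hj i hi).trans (Nat.mul_le_mul_left _
            (Finset.card_le_card fun c hc => hC i hi c (by simpa using hc)))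
          have h7 : (j : ℝ) / (3 * C.card) ≤ 1 := by
            rw [div_le_one (by positivity)]; exact_mod_cast h6
          exact hρ0 (by rw [hρ]; linarith)
        have : 0 ≤ Real.log I.card := Real.log_natCast_nonneg _
        have : 0 ≤ 3 * (C.card : ℝ) / j * Real.log I.card := by positivity
        have : ((T n).card : ℝ) ≤ 1 := by exact_mod_cast hle
        linarith

end hitting

/-! ### Short detours through the clusters -/

section detour

variable {n : ℕ} {G H H₀ : SimpleGraph (Fin n)} {s t u v : Fin n}
  {cl : Fin n → Fin n → Prop} {h τ : ℕ} {S₁ S₂ : Finset (Fin n)}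

/-- The star of `c` meets a shortest walk from `s` to `t` within the first `τ` steps
outside `H₀`. -/
def MeetsFirst (G H₀ : SimpleGraph (Fin n)) (cl : Fin n → Fin n → Prop) (τ : ℕ)
    (s t c : Fin n) : Prop :=
  ∃ u, cl c u ∧ ld G H₀ s u + ld G H₀ u t = ld G H₀ s t ∧ mc G H₀ s u ≤ τ

/-- The star of `c` meets a shortest walk from `s` to `t` within the last `τ` steps outside `H₀`,
and the same walk meets the star of an element of `S₁` within the first `τ` such steps. -/
def MeetsLast (G H₀ : SimpleGraph (Fin n)) (cl : Fin n → Fin n → Prop) (τ : ℕ)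
    (S₁ : Finset (Fin n)) (s t c : Fin n) : Prop :=
  ∃ v, cl c v ∧ mc G H₀ t v ≤ τ ∧ ∃ u, (∃ c₁ ∈ S₁, cl c₁ u) ∧
    ld G H₀ s u + ld G H₀ u t = ld G H₀ s t ∧ mc G H₀ s u ≤ τ ∧
    ld G H₀ u v + ld G H₀ v t = ld G H₀ u t

open Classical in
theorem IsClustering.card_meetsFirst (hc : IsClustering G H₀ cl h) (hr : hd G s t < n)
    (hm : 2 * τ < mc G H₀ s t) :
    τ + 1 ≤ 3 * (Finset.univ.filter fun c => MeetsFirst G H₀ cl τ s t c).card := by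
  obtain ⟨p, p1, p2, -⟩ := exists_min_walk (H₀ := H₀) hr
  obtain ⟨C, hC, hCp⟩ := hc.exists_centers p p1 (j := τ + 1) (by omega)
  refine hC.trans (Nat.mul_le_mul_left _ (Finset.card_le_card fun c hcC => ?_))
  obtain ⟨u, q₁, q₂, h1, rfl, h3⟩ := hCp c hcC
  have hmin : IsMinWalk H₀ (q₁.append q₂) := ⟨p1, p2⟩
  simp only [Finset.mem_filter, Finset.mem_univ, true_and]
  exact ⟨u, h1, hmin.ld_add, by rw [← hmin.of_append.1.2]; omega⟩

open Classical in
theorem IsClustering.card_meetsLast (hc : IsClustering G H₀ cl h) (hr : hd G s t < n)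
    (hm : 2 * τ < mc G H₀ s t) (hS : ∃ c ∈ S₁, MeetsFirst G H₀ cl τ s t c) :
    τ + 1 ≤ 3 * (Finset.univ.filter fun c => MeetsLast G H₀ cl τ S₁ s t c).card := by
  obtain ⟨c₁, hc₁, u, hu, h1, h2⟩ := hS
  obtain ⟨p, q, hpq⟩ := exists_min_append hr h1
  obtain ⟨hp, hq⟩ := hpq.of_append
  have h3 := hpq.2
  rw [miss_append, hp.2] at h3
  obtain ⟨C, hC, hCp⟩ := hc.exists_centers q.reverse hq.reverse.1 (j := τ + 1)
    (by rw [miss_reverse]; omega)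
  refine hC.trans (Nat.mul_le_mul_left _ (Finset.card_le_card fun c hcC => ?_))
  obtain ⟨v, q₁, q₂, g1, g2, g3⟩ := hCp c hcC
  have hmin := hq.reverse
  rw [g2] at hmin
  simp only [Finset.mem_filter, Finset.mem_univ, true_and]
  refine ⟨v, g1, by rw [← hmin.of_append.1.2]; omega, u, ⟨c₁, hc₁, hu⟩, h1, h2, ?_⟩
  have := hmin.ld_add
  rw [ld_comm (x := u) (y := v), ld_comm (x := v) (y := t), ld_comm (x := u) (y := t)]
  omega

/-- A cheap detour exists for every pair: exactly shortest if the walk has few steps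
outside `H₀`, through two special centers if it is long, and through any two centers that are
joined by a shortest walk if it is short. -/
theorem IsClustering.exists_detour (hc : IsClustering G H₀ cl h) {κ a b : ℕ} (hH : H₀ ≤ H)
    (hr : hd G s t < n)
    (hshort : ∀ c₁ ∈ centers cl, ∀ c₂ ∈ centers cl, hd G c₁ c₂ < n → hd G c₁ c₂ ≤ κ →
      hd H c₁ c₂ ≤ hd G c₁ c₂)
    (hfar : ∀ c₁ ∈ S₁ ∪ S₂, ∀ c₂ ∈ S₁ ∪ S₂, hd G c₁ c₂ < n → hd H c₁ c₂ ≤ hd G c₁ c₂ + 2)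
    (hhit : 2 * τ < mc G H₀ s t → ∃ c ∈ S₂, MeetsLast G H₀ cl τ S₁ s t c)
    (hab : 2 * τ < mc G H₀ s t → 2 * b ≤ a * hd G s t ∨ hd G s t + 2 ≤ κ) :
    ∃ u v, hd G s u < n ∧ hd H u v < n ∧ hd G t v < n ∧ mc G H₀ s u ≤ τ ∧ mc G H₀ t v ≤ τ ∧
      b * (hd G s u + hd H u v + hd G t v) ≤ (a + b) * hd G s t + 4 * b := by
  obtain ⟨p, p1, p2, -⟩ := exists_min_walk (H₀ := H₀) hr
  have hpmin : IsMinWalk H₀ p := ⟨p1, p2⟩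
  -- two stars on a shortest walk, at `u` and at `v`, whose centers are close in `H`
  have key : ∀ {u v c₁ c₂ : Fin n} {m : ℕ} (hm2 : m ≤ 2) (q₁ : G.Walk s u) (q₂ : G.Walk u v)
      (q₃ : G.Walk v t),
      IsMinWalk H₀ (q₁.append (q₂.append q₃)) → cl c₁ u → cl c₂ v → mc G H₀ s u ≤ τ →
      mc G H₀ t v ≤ τ → (hd G c₁ c₂ < n → hd G c₁ c₂ ≤ hd G s t + 2 →
        hd H c₁ c₂ ≤ hd G c₁ c₂ + m) → b * (hd G s t + 4 + m) ≤ (a + b) * hd G s t + 4 * b →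
      ∃ u v, hd G s u < n ∧ hd H u v < n ∧ hd G t v < n ∧ mc G H₀ s u ≤ τ ∧ mc G H₀ t v ≤ τ ∧
      b * (hd G s u + hd H u v + hd G t v) ≤ (a + b) * hd G s t + 4 * b := by
    intro u v c₁ c₂ m hm2 q₁ q₂ q₃ hmin h1 h2 h3 h4 h5 h6
    have a1 := hd_le_one (hc.adj_base h1)
    have a2 := hd_le_one (hc.adj_base h2)
    have b1 := (hd_mono hc.le).trans a1
    have b2 := (hd_mono hc.le).trans a2
    have e1 := hd_mono (x := c₁) (y := u) hH
    have e2 := hd_mono (x := c₂) (y := v) hH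
    have hlen := hmin.1
    simp only [Walk.length_append] at hlen
    have f1 := hd_le q₁
    have f2 := hd_le q₂
    have f3 := hd_le q₃
    have t1 := hd_triangle (G := G) (x := c₁) (y := u) (z := c₂)
    have t2 := hd_triangle (G := G) (x := u) (y := v) (z := c₂)
    have t3 := hd_triangle (G := H) (x := u) (y := c₁) (z := v)
    have t4 := hd_triangle (G := H) (x := c₁) (y := c₂) (z := v)
    rw [hd_comm (x := v) (y := c₂)] at t2
    rw [hd_comm (x := u) (y := c₁)] at t3
    have hcc : hd G c₁ c₂ < n := hd_lt_of_walk (Walk.cons (hc.adj _ _ h1)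
      (q₂.append (Walk.cons (hc.adj _ _ h2).symm .nil)))
    have h7 := h5 hcc (by omega)
    have h8 := hd_lt_iff.1 (hd_lt_of_lt_add_three (by omega : hd H c₁ c₂ < n + 3))
    refine ⟨u, v, hd_lt_of_walk q₁, hd_lt_iff.2 ?_, hd_lt_of_walk q₃.reverse, h3, h4, ?_⟩
    · exact ((hH (hc.adj_base h1)).symm.reachable.trans h8).trans (hH (hc.adj_base h2)).reachable
    · refine le_trans (Nat.mul_le_mul_left b ?_) h6
      rw [hd_comm (x := t) (y := v)]
      omega
  by_cases hm : mc G H₀ s t ≤ 2 * τ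
  · obtain ⟨u, p₁, p₂, rfl, h1, h2⟩ := miss_split (H₀ := H₀) p τ τ (by omega)
    obtain ⟨g1, g2⟩ := hpmin.of_append
    refine ⟨u, u, hd_lt_of_walk p₁, by simpa using u.pos, hd_lt_of_walk p₂.reverse,
      by rw [← g1.2]; exact h1, by rw [mc_comm, ← g2.2]; exact h2, ?_⟩
    rw [Walk.length_append] at p1
    rw [hd_self, hd_comm (x := t) (y := u), ← g1.1, ← g2.1, add_zero, p1]
    nlinarith
  · push Not at hm
    rcases hab hm with hb | hκ
    · obtain ⟨c₂, hc₂, v, hv, h1, u, ⟨c₁, hc₁, hu⟩, h2, h3, h4⟩ := hhit hm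
      obtain ⟨q₁, q, hq⟩ := exists_min_append hr h2
      obtain ⟨q₂, q₃, hq'⟩ := exists_min_append (hd_lt_of_walk q) h4
      have hmin : IsMinWalk H₀ (q₁.append (q₂.append q₃)) := by
        refine isMinWalk_of_le _ ?_
        have e1 := hq.of_append
        rw [Walk.length_append, miss_append, e1.1.1, e1.1.2, hq'.1, hq'.2, ← h2,
          ld_eq (hd_lt_of_walk q₁), ld_eq (hd_lt_of_walk q)]
        exact le_of_eq (by ring)
      refine key (m := 2) le_rfl q₁ q₂ q₃ hmin hu hv h3 h1 (fun h _ => hfar c₁ ?_ c₂ ?_ h) ?_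
      · exact Finset.mem_union_left _ hc₁
      · exact Finset.mem_union_right _ hc₂
      · nlinarith
    · -- the first and the last step outside `H₀` have endpoints in stars
      obtain ⟨C, hC, hCp⟩ := hc.exists_centers p p1 (j := 1) (by omega)
      obtain ⟨c₁, hc₁⟩ := Finset.card_pos.1 (by omega : 0 < C.card)
      obtain ⟨u, q₁, q, hu, rfl, hq₁⟩ := hCp c₁ hc₁
      obtain ⟨e1, e2⟩ := hpmin.of_append
      rw [miss_append] at p2
      obtain ⟨C', hC', hCp'⟩ := hc.exists_centers q.reverse e2.reverse.1 (j := 1)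
        (by rw [miss_reverse]; omega)
      obtain ⟨c₂, hc₂⟩ := Finset.card_pos.1 (by omega : 0 < C'.card)
      obtain ⟨v, q₃, q₂, hv, hq, hq₃⟩ := hCp' c₂ hc₂
      have hq' : q = q₂.reverse.append q₃.reverse := by
        rw [← Walk.reverse_append, ← hq, Walk.reverse_reverse]
      have e3 := e2.reverse
      rw [hq] at e3
      rw [hq'] at hpmin
      refine key (m := 0) (by omega) q₁ q₂.reverse q₃.reverse hpmin hu hv
        (by rw [← e1.2]; omega) (by rw [← e3.of_append.1.2]; omega) (fun h h' => ?_) (by nlinarith)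
      exact hshort c₁ (mem_centers.2 ⟨u, hu⟩) c₂ (mem_centers.2 ⟨v, hv⟩) h (by omega)

end detour

end PairSpanner

namespace PairSpanner

open SimpleGraph

/-! ### Graphs without short cycles -/

section girth

variable {n : ℕ} {G H : SimpleGraph (Fin n)} {x y : Fin n} {L k d : ℕ}

/-- There is no detour of length at most `L` around an edge, that is, no cycle of length at most
`L + 1`. -/
def NoShortCycle (H : SimpleGraph (Fin n)) (L : ℕ) : Prop :=
  ∀ u v, H.Adj u v → ∀ p : H.Walk u v, s(u, v) ∉ p.edges → L < p.length

theorem NoShortCycle.mono {H' : SimpleGraph (Fin n)} (h : NoShortCycle H L) (hle : H' ≤ H) :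
    NoShortCycle H' L := by
  intro u v huv p hp
  have := h u v (hle huv) (p.mapLe hle) (by simpa using hp)
  simpa using this

/-- A walk in a graph with one more edge either avoids the edge, or consists of walks to the first,
and from the last, of its passages through that edge. -/
theorem walk_sup_edge {u v : Fin n} (p : (H ⊔ edge x y).Walk u v) :
    (∃ q : H.Walk u v, q.length ≤ p.length ∧ ∀ e ∈ q.edges, e ∈ p.edges) ∨
    (s(x, y) ∈ p.edges ∧ ∃ (a b : Fin n) (q : H.Walk u a) (r : H.Walk b v), s(a, b) = s(x, y) ∧
      q.length + r.length + 1 ≤ p.length ∧ ∀ e ∈ r.edges, e ∈ p.edges) := by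
  induction p with
  | nil => exact Or.inl ⟨.nil, by simp⟩
  | @cons u w v huw p ih =>
    by_cases hH : H.Adj u w
    · rcases ih with ⟨q, h1, h2⟩ | ⟨h0, a, b, q, r, h1, h2, h3⟩
      · refine Or.inl ⟨.cons hH q, by simpa using h1, fun e he => ?_⟩
        simp only [Walk.edges_cons, List.mem_cons] at he ⊢
        exact he.imp_right (h2 e)
      · refine Or.inr ⟨by simp [h0], a, b, .cons hH q, r, h1, by simp; omega, fun e he => ?_⟩
        simp [h3 e he]
    · have hxy : s(u, w) = s(x, y) := by
        rcases huw with h | h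
        · exact absurd h hH
        · rw [edge_adj] at h
          rcases h.1 with ⟨rfl, rfl⟩ | ⟨rfl, rfl⟩
          · rfl
          · exact Sym2.eq_swap
      rcases ih with ⟨q, h1, h2⟩ | ⟨h0, a, b, q, r, h1, h2, h3⟩
      · refine Or.inr ⟨by simp [hxy], u, w, .nil, q, hxy, by simpa using h1, fun e he => ?_⟩
        simp [h2 e he]
      · have hab : s(a, b) = s(u, w) := h1.trans hxy.symm
        rcases Sym2.eq_iff.1 hab with ⟨rfl, rfl⟩ | ⟨rfl, rfl⟩
        · refine Or.inr ⟨by simp [hxy], a, b, .nil, r, h1, by simp; omega, fun e he => ?_⟩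
          simp [h3 e he]
        · refine Or.inl ⟨r, by simp; omega, fun e he => ?_⟩
          simp [h3 e he]

theorem NoShortCycle.sup_edge (h : NoShortCycle H L) (hxy : ∀ q : H.Walk x y, L < q.length) :
    NoShortCycle (H ⊔ edge x y) L := by
  intro u v huv p hp
  have hsymm : ∀ a b, s(a, b) = s(x, y) → ∀ q : H.Walk a b, L < q.length := by
    intro a b hab q
    rcases Sym2.eq_iff.1 hab with ⟨rfl, rfl⟩ | ⟨rfl, rfl⟩
    · exact hxy q
    · simpa using hxy q.reverse
  by_cases hH : H.Adj u v
  · rcases walk_sup_edge p with ⟨q, h1, h2⟩ | ⟨-, a, b, q, r, h1, h2, -⟩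
    · exact (h u v hH q fun he => hp (h2 _ he)).trans_le h1
    · have := hsymm a b h1 (q.reverse.append (.cons hH r.reverse))
      simp at this
      omega
  · have huvxy : s(u, v) = s(x, y) := by
      rcases huv with h | h
      · exact absurd h hH
      · rw [edge_adj] at h
        rcases h.1 with ⟨rfl, rfl⟩ | ⟨rfl, rfl⟩
        · rfl
        · exact Sym2.eq_swap
    rcases walk_sup_edge p with ⟨q, h1, -⟩ | ⟨h0, -⟩
    · exact (hsymm u v huvxy q).trans_le h1
    · exact absurd (huvxy ▸ h0) hp

/-- A vertex at distance at least `i` from `r` has at most one neighbour at distance at most `i`,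
since two of them would close a cycle of length at most `2 * i + 2`. -/
theorem NoShortCycle.unique_parent (h : NoShortCycle H L) {r v w₁ w₂ : Fin n} {i : ℕ}
    (hi : 2 * i + 1 ≤ L) (hv : ∀ p : H.Walk r v, i ≤ p.length) (h₁ : H.Adj v w₁) (h₂ : H.Adj v w₂)
    (p₁ : H.Walk r w₁) (p₂ : H.Walk r w₂) (hp₁ : p₁.length ≤ i) (hp₂ : p₂.length ≤ i) :
    w₁ = w₂ := by
  classical
  by_contra hne
  have key : ∀ {w : Fin n}, H.Adj v w → ∀ p : H.Walk r w, p.length ≤ i → v ∉ p.support := by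
    intro w hw p hp hvp
    have h1 := hv (p.takeUntil v hvp)
    have h2 := congrArg Walk.length (p.take_spec hvp)
    rw [Walk.length_append] at h2
    exact hw.ne (Walk.eq_of_length_eq_zero (p := p.dropUntil v hvp) (by omega))
  have := h v w₁ h₁ (.cons h₂ (p₂.reverse.append p₁)) ?_
  · simp at this; omega
  · simp only [Walk.edges_cons, Walk.edges_append, Walk.edges_reverse, List.mem_cons,
      List.mem_append, List.mem_reverse, not_or]
    refine ⟨fun he => ?_, fun he => ?_, fun he => ?_⟩
    · rcases Sym2.eq_iff.1 he with ⟨-, h'⟩ | ⟨h', -⟩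
      · exact hne h'
      · exact h₂.ne h'
    · exact key h₂ p₂ hp₂ (p₂.fst_mem_support_of_mem_edges he)
    · exact key h₁ p₁ hp₁ (p₁.fst_mem_support_of_mem_edges he)

open Classical in
/-- In a graph of large girth whose degrees are zero or large, spheres grow exponentially. -/
theorem NoShortCycle.pow_le (h : NoShortCycle H L) (hk : 2 * k ≤ L + 1) {r : Fin n}
    (hr : ∃ w, H.Adj r w)
    (hdeg : ∀ v, (∃ w, H.Adj v w) → d < (Finset.univ.filter fun w => H.Adj v w).card) :
    d ^ k ≤ n := by
  let S : ℕ → Finset (Fin n) := fun i => Finset.univ.filter fun v =>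
    (∃ w, H.Adj v w) ∧ (∃ p : H.Walk r v, p.length ≤ i) ∧ ∀ p : H.Walk r v, i ≤ p.length
  have hS : ∀ i ≤ k, d ^ i ≤ (S i).card := by
    intro i
    induction i with
    | zero =>
      intro _
      rw [pow_zero, Nat.one_le_iff_ne_zero, Finset.card_ne_zero]
      exact ⟨r, by simp only [S, Finset.mem_filter, Finset.mem_univ, true_and]
                   exact ⟨hr, ⟨.nil, by simp⟩, by simp⟩⟩
    | succ i ih =>
      intro hik
      have hch : ∀ v ∈ S i, d ≤ ((S (i + 1)).filter fun w => H.Adj v w).card := by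
        intro v hv
        simp only [S, Finset.mem_filter, Finset.mem_univ, true_and] at hv
        obtain ⟨hv1, ⟨p, hp⟩, hv3⟩ := hv
        let Nb := Finset.univ.filter fun w => H.Adj v w
        let Low := Nb.filter fun w => ∃ q : H.Walk r w, q.length ≤ i
        have hlow : Low.card ≤ 1 := by
          rw [Finset.card_le_one]
          intro a ha b hb
          simp only [Low, Nb, Finset.mem_filter, Finset.mem_univ, true_and] at ha hb
          obtain ⟨ha1, qa, hqa⟩ := ha
          obtain ⟨hb1, qb, hqb⟩ := hb
          exact h.unique_parent (by omega) hv3 ha1 hb1 qa qb hqa hqb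
        have hsub : Nb \ Low ⊆ (S (i + 1)).filter fun w => H.Adj v w := by
          intro w hw
          simp only [Low, Nb, Finset.mem_sdiff, Finset.mem_filter, Finset.mem_univ, true_and,
            not_and, not_exists, not_le] at hw
          simp only [S, Finset.mem_filter, Finset.mem_univ, true_and]
          refine ⟨⟨⟨v, hw.1.symm⟩, ⟨p.concat hw.1, by simpa using hp⟩, fun q => ?_⟩, hw.1⟩
          exact hw.2 hw.1 q
        have h1 := hdeg v hv1
        have h2 := Finset.le_card_sdiff Low Nb
        have h3 := Finset.card_le_card hsub
        change d < Nb.card at h1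
        omega
      calc d ^ (i + 1) = d ^ i * d := pow_succ _ _
        _ ≤ (S i).card * d := Nat.mul_le_mul_right _ (ih (by omega))
        _ = ∑ _v ∈ S i, d := by simp
        _ ≤ ∑ v ∈ S i, ((S (i + 1)).filter fun w => H.Adj v w).card := Finset.sum_le_sum hch
        _ = ((S i).biUnion fun v => (S (i + 1)).filter fun w => H.Adj v w).card := by
            rw [Finset.card_biUnion]
            intro v hv v' hv' hne
            rw [Function.onFun, Finset.disjoint_left]
            intro w hw hw'
            simp only [S, Finset.coe_filter, Set.mem_ofPred_eq, Finset.mem_filter, Finset.mem_univ,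
              true_and] at hv hv' hw hw'
            obtain ⟨-, ⟨q, hq⟩, -⟩ := hv
            obtain ⟨-, ⟨q', hq'⟩, -⟩ := hv'
            exact hne (h.unique_parent (v := w) (by omega)
              (fun p => (Nat.le_succ i).trans (hw.1.2.2 p)) hw.2.symm hw'.2.symm q q' hq hq')
        _ ≤ (S (i + 1)).card := Finset.card_le_card fun w hw => by
            obtain ⟨v, -, hw⟩ := Finset.mem_biUnion.1 hw
            exact (Finset.mem_filter.1 hw).1
  exact (hS k le_rfl).trans ((Finset.card_le_univ _).trans (by simp))

/-- The subgraph on a set of vertices, on the same vertex type. -/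
def restrict (H : SimpleGraph (Fin n)) (W : Finset (Fin n)) : SimpleGraph (Fin n) where
  Adj u v := H.Adj u v ∧ u ∈ W ∧ v ∈ W
  symm := ⟨fun _ _ h => ⟨h.1.symm, h.2.2, h.2.1⟩⟩
  loopless := ⟨fun _ h => h.1.ne rfl⟩

open Classical in
/-- The Moore bound. -/
theorem NoShortCycle.ecard_le (h : NoShortCycle H L) (hk : 2 * k ≤ L + 1) (hd : n < d ^ k) :
    ecard H ≤ n * d := by
  have key : ∀ (m : ℕ) (W : Finset (Fin n)), W.card = m → ecard (restrict H W) ≤ m * d := by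
    intro m
    induction m with
    | zero =>
      intro W hW
      rw [Finset.card_eq_zero] at hW
      refine (ecard_le_of_subset_image ∅ fun u v huv => ?_).trans (by simp)
      simp [restrict, hW] at huv
    | succ m ih =>
      intro W hW
      -- a vertex of small degree can be removed
      obtain ⟨v, hvW, hv⟩ : ∃ v ∈ W,
          (Finset.univ.filter fun w => (restrict H W).Adj v w).card ≤ d := by
        by_contra hcon
        push Not at hcon
        obtain ⟨r, hr⟩ := Finset.card_pos.1 (by omega : 0 < W.card)
        have hdeg : ∀ v, (∃ w, (restrict H W).Adj v w) →
            d < (Finset.univ.filter fun w => (restrict H W).Adj v w).card :=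
          fun v ⟨w, hw⟩ => hcon v hw.2.1
        have hr' : ∃ w, (restrict H W).Adj r w := by
          obtain ⟨w, hw⟩ := Finset.card_pos.1 (Nat.zero_lt_of_lt (hcon r hr))
          exact ⟨w, by simpa using hw⟩
        have := (h.mono (H' := restrict H W) fun _ _ h => h.1).pow_le hk hr' hdeg
        omega
      have hsub : (restrict H W).edgeSet ⊆ (restrict H (W.erase v)).edgeSet ∪
          (((Finset.univ.filter fun w => (restrict H W).Adj v w).image fun w => s(v, w) :
            Finset (Sym2 (Fin n))) : Set (Sym2 (Fin n))) := by
        intro e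
        induction e with | _ a b =>
        intro he
        by_cases hav : a = v
        · subst hav
          refine Or.inr ?_
          simp only [Finset.coe_image, Set.mem_image, Finset.mem_coe, Finset.mem_filter,
            Finset.mem_univ, true_and]
          exact ⟨b, he, rfl⟩
        · by_cases hbv : b = v
          · subst hbv
            refine Or.inr ?_
            simp only [Finset.coe_image, Set.mem_image, Finset.mem_coe, Finset.mem_filter,
              Finset.mem_univ, true_and]
            exact ⟨a, he.symm, Sym2.eq_swap⟩
          · exact Or.inl ⟨he.1, Finset.mem_erase.2 ⟨hav, he.2.1⟩, Finset.mem_erase.2 ⟨hbv, he.2.2⟩⟩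
      refine (Set.ncard_le_ncard hsub (Set.toFinite _)).trans ((Set.ncard_union_le _ _).trans ?_)
      rw [Set.ncard_coe_finset]
      have h1 := ih (W.erase v) (by rw [Finset.card_erase_of_mem hvW, hW]; rfl)
      have h2 := (Finset.card_image_le (s := Finset.univ.filter fun w => (restrict H W).Adj v w)
        (f := fun w => s(v, w))).trans hv
      unfold ecard at h1
      rw [add_mul, one_mul]
      omega
  have h1 := key n Finset.univ (by simp)
  have h2 : restrict H Finset.univ = H := by ext; simp [restrict]
  rwa [h2] at h1

theorem hd_le_mul_hd (hstr : ∀ u v, G.Adj u v → hd H u v ≤ L) (hr : hd G x y < n) :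
    hd H x y ≤ L * hd G x y := by
  obtain ⟨p, hp⟩ := exists_walk_of_hd_lt hr
  rw [← hp]
  clear hp hr
  induction p with
  | nil => simp
  | cons e p ih =>
    rw [Walk.length_cons, mul_add, mul_one, add_comm]
    exact hd_triangle.trans (Nat.add_le_add (hstr _ _ e) ih)

end girth

end PairSpanner

namespace MatProg

open PairSpanner SimpleGraph

/-! ### Derived terms -/

namespace Term

/-- `t < u`.  Truth is represented by any number other than zero. -/
def lt (t u : Term) : Term := .sub u t
/-- Conjunction. -/
def and (t u : Term) : Term := .ite t u (.lit 0)
/-- Disjunction. -/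
def or (t u : Term) : Term := .add t u
/-- Negation. -/
def not (t : Term) : Term := .ite t (.lit 0) (.lit 1)
/-- Existence of a vertex `x`. -/
def ex (x : ℕ) (t : Term) : Term := .sum x t
/-- Equality. -/
def eq (t u : Term) : Term := .not (.add (.sub t u) (.sub u t))
/-- The truth value of `t` as `0` or `1`. -/
def bool (t : Term) : Term := .ite t (.lit 1) (.lit 0)
/-- The product of `t` and `u`, provided that `u` is at most the number of vertices; `x` is an
auxiliary variable that does not occur in `t` and `u`. -/
def mul (x : ℕ) (t u : Term) : Term := .sum x (.ite (.lt (.idx x) u) t (.lit 0))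

end Term

section eval

variable {n : ℕ} {I : Inst n} {σ : Mats n} {e : Env n}

/-- The term `t` holds. -/
def Holds (I : Inst n) (σ : Mats n) (t : Term) (e : Env n) : Prop := t.eval I σ e ≠ 0

@[simp] theorem holds_lt {t u : Term} :
    Holds I σ (.lt t u) e ↔ t.eval I σ e < u.eval I σ e := by
  simp only [Holds, Term.lt, Term.eval]; omega

@[simp] theorem holds_and {t u : Term} : Holds I σ (.and t u) e ↔
    Holds I σ t e ∧ Holds I σ u e := by
  simp only [Holds, Term.and, Term.eval]; split_ifs <;> simp_all

@[simp] theorem holds_or {t u : Term} : Holds I σ (.or t u) e ↔ Holds I σ t e ∨ Holds I σ u e := by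
  simp only [Holds, Term.or, Term.eval]; omega

@[simp] theorem holds_not {t : Term} : Holds I σ (.not t) e ↔ ¬ Holds I σ t e := by
  simp only [Holds, Term.not, Term.eval]; split_ifs <;> simp_all

@[simp] theorem holds_ex {t : Term} {x : ℕ} :
    Holds I σ (.ex x t) e ↔ ∃ i, Holds I σ t (Function.update e x i) := by
  simp only [Holds, Term.ex, Term.eval, ne_eq, Finset.sum_eq_zero_iff, Finset.mem_univ,
    true_imp_iff, not_forall]

@[simp] theorem holds_eq {t u : Term} :
    Holds I σ (.eq t u) e ↔ t.eval I σ e = u.eval I σ e := by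
  unfold Term.eq
  rw [holds_not]
  simp only [Holds, Term.eval]; omega

@[simp] theorem holds_graph {x y : ℕ} :
    Holds I σ (.graph x y) e ↔ I.graph (e x) (e y) ≠ 0 := Iff.rfl

@[simp] theorem holds_pairs {x y : ℕ} :
    Holds I σ (.pairs x y) e ↔ I.pairs (e x) (e y) ≠ 0 := Iff.rfl

@[simp] theorem holds_entry {k x y : ℕ} :
    Holds I σ (.entry k x y) e ↔ σ k (e x) (e y) ≠ 0 := Iff.rfl

open Classical in
theorem eval_ite {c t u : Term} : (Term.ite c t u).eval I σ e =
    if Holds I σ c e then t.eval I σ e else u.eval I σ e := by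
  simp only [Term.eval, Holds]; congr

open Classical in
theorem eval_bool {t : Term} : (Term.bool t).eval I σ e = if Holds I σ t e then 1 else 0 :=
  eval_ite

theorem eval_mul {x : ℕ} {t u : Term} {a b : ℕ}
    (ht : ∀ i, t.eval I σ (Function.update e x i) = a)
    (hu : ∀ i, u.eval I σ (Function.update e x i) = b) :
    (Term.mul x t u).eval I σ e = a * min b n := by
  classical
  have : ∀ i : Fin n, (Term.ite (.lt (.idx x) u) t (.lit 0)).eval I σ (Function.update e x i) =
      if (i : ℕ) < b then a else 0 := by
    intro i
    rw [eval_ite]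
    simp only [holds_lt, hu, ht, Term.eval, Function.update_self]
  rw [Term.mul, Term.eval, Finset.sum_congr rfl fun i _ => this i, ← Finset.sum_filter,
    Finset.sum_const, smul_eq_mul, mul_comm]
  congr 1
  rw [Fin.card_filter_val_lt, min_comm]

theorem foldUpTo_induct {α : Type*} {f : Fin n → α → α} {a : α} (P : ℕ → α → Prop) (h0 : P 0 a)
    (hs : ∀ (i : ℕ) (h : i < n) (a : α), P i a → P (i + 1) (f ⟨i, h⟩ a)) :
    P n (foldUpTo f a n) := by
  have : ∀ i ≤ n, P i (foldUpTo f a i) := by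
    intro i
    induction i with
    | zero => intro _; exact h0
    | succ i ih =>
      intro hi
      rw [foldUpTo, dif_pos (by omega)]
      exact hs i _ _ (ih (by omega))
  exact this n le_rfl

/-- A loop that keeps an invariant and, for each index, establishes a fact that is not destroyed
later on. -/
theorem foldUpTo_forall {α : Type*} {f : Fin n → α → α} {a : α} (Inv : α → Prop)
    (Q : Fin n → α → Prop) (h0 : Inv a) (hs : ∀ i a, Inv a → Inv (f i a) ∧ Q i (f i a))
    (hQ : ∀ i j a, Inv a → Q i a → Q i (f j a)) :
    Inv (foldUpTo f a n) ∧ ∀ i, Q i (foldUpTo f a n) := by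
  have := foldUpTo_induct (f := f) (a := a)
    (fun i a => Inv a ∧ ∀ j : Fin n, (j : ℕ) < i → Q j a) ⟨h0, by simp⟩ ?_
  · exact ⟨this.1, fun i => this.2 i i.2⟩
  · rintro i hi a ⟨h1, h2⟩
    refine ⟨(hs _ a h1).1, fun j hj => ?_⟩
    rcases Nat.lt_succ_iff_lt_or_eq.1 hj with h | h
    · exact hQ _ _ _ h1 (h2 j h)
    · obtain rfl : j = ⟨i, hi⟩ := Fin.ext h
      exact (hs _ a h1).2

/-- The matrices that a statement may change. -/
def Stmt.writes : Stmt → List ℕ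
  | .fill k _ => [k]
  | .seq S S' => S.writes ++ S'.writes
  | .loop _ S => S.writes

theorem Stmt.run_of_notMem {k : ℕ} : ∀ (S : Stmt) (e : Env n) (σ : Mats n), k ∉ S.writes →
    S.run I e σ k = σ k := by
  intro S
  induction S with
  | fill m t =>
    intro e σ h
    exact Function.update_of_ne (by simpa [writes] using h) _ _
  | seq S S' ih ih' =>
    intro e σ h
    simp only [writes, List.mem_append, not_or] at h
    exact (ih' e _ h.2).trans (ih e σ h.1)
  | loop x S ih =>
    intro e σ h
    exact foldUpTo_induct (f := fun i σ => S.run I (Function.update e x i) σ)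
      (fun _ σ' => σ' k = σ k) rfl fun i hi σ' hσ' => (ih _ σ' h).trans hσ'

/-- A matrix represents a relation by its entries other than zero. -/
def Rep (M : Fin n → Fin n → ℕ) (r : Fin n → Fin n → Prop) : Prop := ∀ x y, M x y ≠ 0 ↔ r x y

/-! ### Shortest distances -/

/-- Puts the distances of a graph with weighted edges into the matrix `D`.  The edges and their
weights are given by terms in the variables `2` and `1`. -/
def distances (D : ℕ) (adj w B : Term) : Stmt :=
  .seq (.fill D (.ite (.eq (.idx 0) (.idx 1)) (.lit 0) B))
    (.loop 9 (.fill D (.inf 2 (.add (.entry D 0 2)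
      (.ite (.eq (.idx 2) (.idx 1)) (.lit 0) (.ite adj w B))))))

open Classical in
theorem run_distances {D : ℕ} {adj w B : Term} {E : SimpleGraph (Fin n)} {W : Fin n → Fin n → ℕ}
    {b : ℕ} (hadj : ∀ M e, Holds I (Function.update σ D M) adj e ↔ E.Adj (e 2) (e 1))
    (hw : ∀ M e, w.eval I (Function.update σ D M) e = W (e 2) (e 1))
    (hB : ∀ M e, B.eval I (Function.update σ D M) e = b) (hB' : ∀ e, B.eval I σ e = b) :
    (distances D adj w B).run I e σ = Function.update σ D (wdist E W b) := by
  let step : Fin n → Fin n → ℕ := fun x y => if x = y then 0 else if E.Adj x y then W x y else b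
  let D0 : Fin n → Fin n → ℕ := fun x y => if x = y then 0 else b
  let Dk : ℕ → Fin n → Fin n → ℕ :=
    fun k => Nat.rec D0 (fun _ M x y => ⨅ z, (M x z + step z y)) k
  have key : (distances D adj w B).run I e σ = Function.update σ D (Dk n) := by
    rw [distances, Stmt.run]
    have h0 : (Stmt.fill D (.ite (.eq (.idx 0) (.idx 1)) (.lit 0) B)).run I e σ =
        Function.update σ D D0 := by
      rw [Stmt.run]
      congr 1
      funext x y
      rw [eval_ite, hB']
      simp [Term.eval, D0, Fin.ext_iff]
    rw [h0]
    refine foldUpTo_induct (fun i σ' => σ' = Function.update σ D (Dk i)) rfl ?_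
    rintro i hi _ rfl
    rw [Stmt.run, Function.update_idem]
    congr 1
    funext x y
    change _ = ⨅ z, (Dk i x z + step z y)
    rw [Term.eval]
    congr 1
    funext z
    rw [Term.eval, eval_ite, eval_ite, hw, hB]
    simp only [hadj]
    simp [Term.eval, step, Fin.ext_iff]
  rw [key]
  congr 1
  funext x y
  exact bellmanFord E W b step (fun x => by simp [step])
    (fun x y h => by simp [step, h, h.ne]) (fun x y h h' => by simp [step, h, h']) Dk
    (fun x y => rfl) (fun k _ x y => rfl) x y

/-- Puts the hop distances of the graph that is given by a term into the matrix `D`. -/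
def hops (D : ℕ) (adj : Term) : Stmt := distances D adj (.lit 1) (.add .size (.lit 3))

theorem run_hops {D : ℕ} {adj : Term} {E : SimpleGraph (Fin n)}
    (hadj : ∀ M e, Holds I (Function.update σ D M) adj e ↔ E.Adj (e 2) (e 1)) :
    (hops D adj).run I e σ = Function.update σ D (hd E) :=
  run_distances hadj (W := fun _ _ => 1) (fun _ _ => rfl) (fun _ _ => rfl) fun _ => rfl

end eval

/-! ### The matrices of the algorithm -/

/-- The hop distances of the input graph. -/
abbrev mDG : ℕ := 0
/-- The best spanner so far. -/
abbrev mBest : ℕ := 1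
/-- The spanner under construction. -/
abbrev mH : ℕ := 2
/-- The hop distances of the spanner under construction. -/
abbrev mDH : ℕ := 3
/-- The stars of the clustering: the row is the center, the column the leaf. -/
abbrev mCl : ℕ := 4
/-- The graph of the clustering. -/
abbrev mBase : ℕ := 5
/-- The lexicographic distances. -/
abbrev mLd : ℕ := 6
/-- The gains of the vertices, in the greedy algorithm for hitting sets. -/
abbrev mGain : ℕ := 7
/-- The first hitting set.  A set of vertices is given by the diagonal. -/
abbrev mS₁ : ℕ := 8
/-- The second hitting set. -/
abbrev mS₂ : ℕ := 9
/-- The current vertex of a walk; a vertex is given by a constant matrix. -/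
abbrev mCur : ℕ := 10
/-- The next vertex of a walk. -/
abbrev mNext : ℕ := 11
/-- A truth value, given by a constant matrix. -/
abbrev mFlag : ℕ := 12

section buy

variable {n : ℕ} {I : Inst n} {σ : Mats n} {e : Env n} {G H H₀ : SimpleGraph (Fin n)}

/-- Puts the lexicographic distances into their matrix. -/
def lexDistances : Stmt :=
  distances mLd (.graph 2 1) (.add .size (.ite (.entry mBase 2 1) (.lit 0) (.lit 1))) (.sum 3 .size)

theorem run_lexDistances (hG : Rep I.graph G.Adj) (hH₀ : Rep (σ mBase) H₀.Adj) :
    lexDistances.run I e σ = Function.update σ mLd (ld G H₀) := by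
  classical
  refine run_distances (fun M e => hG _ _)
    (W := fun x y => n + if H₀.Adj x y then 0 else 1) (fun M e => ?_) (fun M e => ?_) fun e => ?_
  · rw [Term.eval, eval_ite]
    have := hH₀ (e 2) (e 1)
    simp only [holds_entry, Function.update_of_ne (show mBase ≠ mLd by decide), this, Term.eval]
  · simp [Term.eval]
  · simp [Term.eval]

/-- The term for a neighbour of the vertex in `mCur` that precedes it on a lexicographically
shortest walk from the vertex `s`; its value is `n` if there is none. -/
def prevTerm (s : ℕ) : Term :=
  .inf 2 (.ite (.ex 3 (.and (.eq (.idx 3) (.entry mCur 0 0)) (.and (.graph 2 3)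
    (.eq (.add (.add (.entry mLd s 2) .size) (.ite (.entry mBase 2 3) (.lit 0) (.lit 1)))
      (.entry mLd s 3))))) (.idx 2) .size)

/-- One step of `buy`. -/
def buyStep (s : ℕ) : Stmt :=
  .seq (.fill mNext (prevTerm s)) (.seq
    (.fill mH (.or (.entry mH 0 1) (.or
      (.and (.eq (.idx 0) (.entry mCur 0 0)) (.eq (.idx 1) (.entry mNext 0 0)))
      (.and (.eq (.idx 1) (.entry mCur 0 0)) (.eq (.idx 0) (.entry mNext 0 0))))))
    (.fill mCur (.entry mNext 0 0)))

/-- Adds a lexicographically shortest walk from the vertex `s`, a variable, to the vertex in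
`mCur` to the spanner, by going backwards from the latter.  Nothing happens if `mCur` holds no
vertex. -/
def buy (s : ℕ) : Stmt := .loop 9 (buyStep s)

open Classical in
theorem miss_single {z v : Fin n} (h : G.Adj z v) :
    miss H₀ (Walk.cons h Walk.nil) = if H₀.Adj z v then 0 else 1 := by
  simp [miss]

open Classical in
/-- The edge `z v` closes a lexicographically shortest walk from `s`. -/
def Tight (G H₀ : SimpleGraph (Fin n)) (s z v : Fin n) : Prop :=
  G.Adj z v ∧ ld G H₀ s z + n + (if H₀.Adj z v then 0 else 1) = ld G H₀ s v

theorem exists_tight {s v : Fin n} (hr : hd G s v < n) (hne : s ≠ v) : ∃ z, Tight G H₀ s z v := by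
  obtain ⟨p, p1, p2, -⟩ := exists_min_walk (H₀ := H₀) hr
  obtain ⟨q, hq⟩ : ∃ q : G.Walk v s, q = p.reverse := ⟨_, rfl⟩
  cases q with
  | nil => exact absurd rfl hne
  | @cons _ z _ hvz q =>
    have hp : p = q.reverse.append (Walk.cons hvz.symm Walk.nil) := by
      rw [← p.reverse_reverse, ← hq]; simp
    have hmin : IsMinWalk H₀ (q.reverse.append (Walk.cons hvz.symm Walk.nil)) :=
      ⟨by rw [← hp]; exact p1, by rw [← hp]; exact p2⟩
    refine ⟨z, hvz.symm, ?_⟩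
    have h1 := hmin.ld_add
    have h2 := hmin.of_append.2
    rw [ld_eq (hd_lt_of_walk (Walk.cons hvz.symm Walk.nil)), ← h2.1, ← h2.2, miss_single] at h1
    rw [← h1]
    simp [add_assoc]

/-- What one step of `buy` does, if `mCur` holds the number `c`. -/
theorem run_buyStep {s : ℕ} (hs : s ≠ 0 ∧ s ≠ 1 ∧ s ≠ 2 ∧ s ≠ 3) (hG : Rep I.graph G.Adj)
    (hH₀ : Rep (σ mBase) H₀.Adj) (hLd : σ mLd = ld G H₀) {c : ℕ} (hc : ∀ x y, σ mCur x y = c) :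
    ∃ c' : ℕ, (∀ x y, (buyStep s).run I e σ mCur x y = c') ∧
      (∀ x y, (buyStep s).run I e σ mH x y ≠ 0 ↔ (σ mH x y ≠ 0 ∨
        ((x : ℕ) = c ∧ (y : ℕ) = c' ∨ (y : ℕ) = c ∧ (x : ℕ) = c'))) ∧
      ((∃ z v : Fin n, c' = z ∧ c = v ∧ Tight G H₀ (e s) z v) ∨
        c' = n ∧ ∀ z v : Fin n, c = v → ¬ Tight G H₀ (e s) z v) := by
  classical
  let tight : Fin n → Prop := fun z => ∃ v : Fin n, (v : ℕ) = c ∧ Tight G H₀ (e s) z v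
  let c' : ℕ := ⨅ z : Fin n, if tight z then (z : ℕ) else n
  have hnext : ∀ x y, (prevTerm s).eval I σ
      (Function.update (Function.update e 0 x) 1 y) = c' := by
    intro x y
    rw [prevTerm, Term.eval]
    congr 1
    funext z
    rw [eval_ite]
    simp only [holds_ex, holds_and, holds_eq, holds_graph, hG _ _, hH₀ _ _,
      Term.eval, hc, hLd, Function.update_apply, hs.1, hs.2.1, hs.2.2.1, hs.2.2.2, tight, Tight,
      if_true, if_false]
    norm_num
    congr
  have hne : Nonempty (Fin n) := ⟨e 0⟩
  refine ⟨c', ?_, ?_, ?_⟩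
  · intro x y
    simp only [buyStep, Stmt.run, Function.update_self, Term.eval]
    rw [Function.update_of_ne (by decide), Function.update_self]
    exact hnext _ _
  · intro x y
    simp only [buyStep, Stmt.run]
    rw [Function.update_of_ne (by decide), Function.update_self]
    change Holds _ _ _ _ ↔ _
    simp only [holds_or, holds_and, holds_eq, holds_entry, Term.eval, Function.update_self,
      Function.update_of_ne (show mH ≠ mNext by decide),
      Function.update_of_ne (show mCur ≠ mNext by decide), hc, hnext]
    simp
  · by_cases ht : ∃ z, tight z
    · left
      obtain ⟨z, hz⟩ := ht
      obtain ⟨w, hw⟩ : c' ∈ Set.range _ := Nat.sInf_mem (Set.range_nonempty _)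
      have hle : c' ≤ (if tight z then (z : ℕ) else n) := ciInf_le (OrderBot.bddBelow _) z
      rw [if_pos hz] at hle
      by_cases hw' : tight w
      · obtain ⟨v, hv, hv'⟩ := hw'
        refine ⟨w, v, ?_, hv.symm, hv'⟩
        rw [← hw]; exact if_pos ⟨v, hv, hv'⟩
      · have : (if tight w then (w : ℕ) else n) = n := if_neg hw'
        have := z.2
        simp only at hw
        omega
    · right
      push Not at ht
      refine ⟨?_, fun z v hv h => ht z ⟨v, hv.symm, h⟩⟩
      simp only [c', ht, if_false, ciInf_const]

theorem buyStep_writes {s : ℕ} : (buyStep s).writes = [mNext, mH, mCur] := rfl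

theorem run_buy {s : ℕ} (hs : s ≠ 0 ∧ s ≠ 1 ∧ s ≠ 2 ∧ s ≠ 3 ∧ s ≠ 9) (hG : Rep I.graph G.Adj)
    (hH₀ : Rep (σ mBase) H₀.Adj) (hLd : σ mLd = ld G H₀) (hH : Rep (σ mH) H.Adj) {t : Fin n}
    (hr : hd G (e s) t < n) (hc : ∀ x y, σ mCur x y = t) :
    ∃ p : G.Walk (e s) t, IsMinWalk H₀ p ∧ Rep ((buy s).run I e σ mH) (addWalk H p).Adj := by
  classical
  have hn : 0 < n := (e 0).pos
  let Inv : ℕ → Mats n → Prop := fun i σ' => σ' mBase = σ mBase ∧ σ' mLd = σ mLd ∧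
    ((∃ (v : Fin n) (q : G.Walk v t), (∀ x y, σ' mCur x y = v) ∧
        Rep (σ' mH) (addWalk H q).Adj ∧ q.length = i ∧ hd G (e s) v < n ∧
        ld G H₀ (e s) v + (n * q.length + miss H₀ q) = ld G H₀ (e s) t) ∨
      ∃ q : G.Walk (e s) t, (∀ x y, σ' mCur x y = n) ∧ Rep (σ' mH) (addWalk H q).Adj ∧
        n * q.length + miss H₀ q = ld G H₀ (e s) t)
  have hfin : Inv n ((buy s).run I e σ) := by
    refine foldUpTo_induct Inv ⟨rfl, rfl, Or.inl ⟨t, .nil, hc, ?_, rfl, hr, ?_⟩⟩ ?_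
    · intro x y; rw [hH x y, addWalk_adj]; simp
    · simp [miss]
    · rintro i hi σ' ⟨h1, h2, h3⟩
      have hbase : (buyStep s).run I (Function.update e 9 ⟨i, hi⟩) σ' mBase = σ mBase :=
        (Stmt.run_of_notMem _ _ _ (by rw [buyStep_writes]; decide)).trans h1
      have hld : (buyStep s).run I (Function.update e 9 ⟨i, hi⟩) σ' mLd = σ mLd :=
        (Stmt.run_of_notMem _ _ _ (by rw [buyStep_writes]; decide)).trans h2
      refine ⟨hbase, hld, ?_⟩
      have hes : Function.update e 9 (⟨i, hi⟩ : Fin n) s = e s :=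
        Function.update_of_ne hs.2.2.2.2 _ _
      have hs' : s ≠ 0 ∧ s ≠ 1 ∧ s ≠ 2 ∧ s ≠ 3 := ⟨hs.1, hs.2.1, hs.2.2.1, hs.2.2.2.1⟩
      rcases h3 with ⟨v, q, g1, g2, g3, g4, g5⟩ | ⟨q, g1, g2, g3⟩
      · obtain ⟨c', k1, k2, k3⟩ := run_buyStep (e := Function.update e 9 ⟨i, hi⟩) hs' hG
          (h1 ▸ hH₀) (h2.trans hLd) g1
        rw [hes] at k3
        rcases k3 with ⟨z, v', rfl, hv, k3⟩ | ⟨rfl, k3⟩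
        · obtain rfl : v = v' := Fin.ext hv
          refine Or.inl ⟨z, .cons k3.1 q, k1, ?_, by simp [g3], ?_, ?_⟩
          · intro x y
            rw [k2 x y, g2 x y, addWalk_adj, addWalk_adj, Walk.edges_cons, List.mem_cons,
              Sym2.eq_iff, or_assoc]
            simp only [← Fin.ext_iff]
            tauto
          · exact hd_lt_iff.2 ((hd_lt_iff.1 g4).trans k3.1.symm.reachable)
          · have := k3.2
            have e1 : miss H₀ (Walk.cons k3.1 q) = (if H₀.Adj z v then 0 else 1) + miss H₀ q := by
              simp [miss]
            rw [e1, Walk.length_cons, mul_add, mul_one]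
            omega
        · by_cases hv : e s = v
          · subst hv
            refine Or.inr ⟨q, k1, ?_, ?_⟩
            · intro x y
              rw [k2 x y, g2 x y]
              have := x.2; have := y.2
              constructor
              · rintro (h | h | h)
                · exact h
                · omega
                · omega
              · exact Or.inl
            · rw [← g5]; simp [ld]
          · obtain ⟨z, hz⟩ := exists_tight (H₀ := H₀) g4 hv
            exact absurd hz (k3 z v rfl)
      · obtain ⟨c', k1, k2, k3⟩ := run_buyStep (e := Function.update e 9 ⟨i, hi⟩) hs' hG
          (h1 ▸ hH₀) (h2.trans hLd) g1
        rcases k3 with ⟨z, v', -, hv, -⟩ | ⟨rfl, -⟩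
        · have := v'.2; omega
        · refine Or.inr ⟨q, k1, ?_, g3⟩
          intro x y
          rw [k2 x y, g2 x y]
          have := x.2; have := y.2
          constructor
          · rintro (h | h | h)
            · exact h
            · omega
            · omega
          · exact Or.inl
  obtain ⟨-, -, ⟨v, q, g1, g2, g3, g4, g5⟩ | ⟨q, g1, g2, g3⟩⟩ := hfin
  · -- the walk would be too long
    have := ld_lt_iff (H₀ := H₀) |>.2 hr
    rw [g3] at g5
    omega
  · exact ⟨q, isMinWalk_of_le q g3.le, g2⟩

theorem run_buy_none {s : ℕ} (hs : s ≠ 0 ∧ s ≠ 1 ∧ s ≠ 2 ∧ s ≠ 3 ∧ s ≠ 9) (hG : Rep I.graph G.Adj)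
    (hH₀ : Rep (σ mBase) H₀.Adj) (hLd : σ mLd = ld G H₀) (hH : Rep (σ mH) H.Adj)
    (hc : ∀ x y, σ mCur x y = n) : Rep ((buy s).run I e σ mH) H.Adj := by
  let Inv : ℕ → Mats n → Prop := fun _ σ' => σ' mBase = σ mBase ∧ σ' mLd = σ mLd ∧
    (∀ x y, σ' mCur x y = n) ∧ Rep (σ' mH) H.Adj
  have hfin : Inv n ((buy s).run I e σ) := by
    refine foldUpTo_induct Inv ⟨rfl, rfl, hc, hH⟩ ?_
    rintro i hi σ' ⟨h1, h2, g1, g2⟩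
    refine ⟨(Stmt.run_of_notMem _ _ _ (by rw [buyStep_writes]; decide)).trans h1,
      (Stmt.run_of_notMem _ _ _ (by rw [buyStep_writes]; decide)).trans h2, ?_⟩
    obtain ⟨c', k1, k2, k3⟩ := run_buyStep (e := Function.update e 9 ⟨i, hi⟩)
      ⟨hs.1, hs.2.1, hs.2.2.1, hs.2.2.2.1⟩ hG (h1 ▸ hH₀) (h2.trans hLd) g1
    rcases k3 with ⟨z, v', -, hv, -⟩ | ⟨rfl, -⟩
    · have := v'.2; omega
    · refine ⟨k1, fun x y => ?_⟩
      rw [k2 x y, g2 x y]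
      have := x.2; have := y.2
      constructor
      · rintro (h | h | h)
        · exact h
        · omega
        · omega
      · exact Or.inl
  exact hfin.2.2.2

/-- Adds a lexicographically shortest walk from the vertex `s` to the vertex `t` to the spanner,
if the condition holds. -/
def buyIf (c : Term) (s t : ℕ) : Stmt :=
  .seq (.fill mCur (.ite c (.idx t) .size)) (buy s)

theorem run_buyIf {c : Term} {s t : ℕ} (hs : s ≠ 0 ∧ s ≠ 1 ∧ s ≠ 2 ∧ s ≠ 3 ∧ s ≠ 9)
    (ht : t ≠ 0 ∧ t ≠ 1) (hG : Rep I.graph G.Adj)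
    (hH₀ : Rep (σ mBase) H₀.Adj) (hLd : σ mLd = ld G H₀) (hH : Rep (σ mH) H.Adj) (C : Prop)
    (hc : ∀ x y, Holds I σ c (Function.update (Function.update e 0 x) 1 y) ↔ C)
    (hr : C → hd G (e s) (e t) < n) :
    (C ∧ ∃ p : G.Walk (e s) (e t), IsMinWalk H₀ p ∧
      Rep ((buyIf c s t).run I e σ mH) (addWalk H p).Adj) ∨
    (¬ C ∧ Rep ((buyIf c s t).run I e σ mH) H.Adj) := by
  classical
  have hcur : ∀ x y, (Stmt.fill mCur (.ite c (.idx t) .size)).run I e σ mCur x y =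
      if C then (e t : ℕ) else n := by
    intro x y
    rw [Stmt.run, Function.update_self, eval_ite]
    simp only [hc, Term.eval, Function.update_of_ne ht.1, Function.update_of_ne ht.2]
  have hother : ∀ k, k ≠ mCur → (Stmt.fill mCur (.ite c (.idx t) .size)).run I e σ k = σ k :=
    fun k hk => Function.update_of_ne hk _ _
  by_cases hC : C
  · left
    refine ⟨hC, run_buy hs hG ?_ ?_ ?_ (hr hC) fun x y => (hcur x y).trans (if_pos hC)⟩
    · rw [hother _ (by decide)]; exact hH₀
    · rw [hother _ (by decide)]; exact hLd
    · rw [hother _ (by decide)]; exact hH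
  · right
    refine ⟨hC, run_buy_none (H₀ := H₀) hs hG ?_ ?_ ?_ fun x y => (hcur x y).trans (if_neg hC)⟩
    · rw [hother _ (by decide)]; exact hH₀
    · rw [hother _ (by decide)]; exact hLd
    · rw [hother _ (by decide)]; exact hH

end buy

end MatProg

namespace MatProg

open PairSpanner SimpleGraph

/-! ### Computing a clustering -/

/-- The variable of the outer loop that holds the predecessor of the cluster parameter `h`. -/
abbrev vH : ℕ := 31
/-- The variable that holds the number `τ` of edges which may be bought at one end of a pair. -/
abbrev vT : ℕ := 32
/-- The variable that holds the distance `κ` up to which centers are joined by shortest walks. -/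
abbrev vK : ℕ := 33

section cluster

variable {n : ℕ} {I : Inst n} {σ : Mats n} {e : Env n} {G H H₀ : SimpleGraph (Fin n)}

theorem foldUpTo_succ {α : Type*} {f : Fin n → α → α} {a : α} {r : ℕ} (hr : r < n) :
    foldUpTo f a (r + 1) = f ⟨r, hr⟩ (foldUpTo f a r) := by
  rw [foldUpTo, dif_pos hr]

/-- A loop with an invariant, where each round establishes a fact that later rounds do not
destroy, since they change the matrices along a preorder only. -/
theorem run_loop_forall {x : ℕ} {S : Stmt} (Inv : Mats n → Prop) (R : Mats n → Mats n → Prop)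
    (Q : Fin n → Mats n → Prop) (hrefl : ∀ a, R a a) (htrans : ∀ a b c, R a b → R b c → R a c)
    (hQ : ∀ i a b, Inv a → R a b → Q i a → Q i b) (h0 : Inv σ)
    (hs : ∀ i a, Inv a → R σ a → Inv (S.run I (Function.update e x i) a) ∧
      R a (S.run I (Function.update e x i) a) ∧ Q i (S.run I (Function.update e x i) a)) :
    Inv ((Stmt.loop x S).run I e σ) ∧ R σ ((Stmt.loop x S).run I e σ) ∧
      ∀ i, Q i ((Stmt.loop x S).run I e σ) := by
  have := foldUpTo_forall (f := fun i a => S.run I (Function.update e x i) a) (a := σ)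
    (fun a => Inv a ∧ R σ a) Q ⟨h0, hrefl _⟩ ?_ ?_
  · exact ⟨this.1.1, this.1.2, this.2⟩
  · rintro i a ⟨h1, h2⟩
    obtain ⟨g1, g2, g3⟩ := hs i a h1 h2
    exact ⟨⟨g1, htrans _ _ _ h2 g2⟩, g3⟩
  · rintro i j a ⟨h1, h2⟩ h3
    exact hQ i _ _ h1 (hs j a h1 h2).2.1 h3

/-- The vertex `y` is no leaf. -/
def isFree (y : ℕ) : Term := .not (.ex 2 (.entry mCl 2 y))

/-- Computes a clustering: each vertex in turn takes all of its neighbours that are no leaves so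
far, if there are sufficiently many. -/
def cluster : Stmt :=
  .seq (.fill mCl (.lit 0)) (.seq
    (.loop 20 (.fill mCl (.or (.entry mCl 0 1) (.and (.eq (.idx 0) (.idx 20))
      (.and (.graph 20 1) (.and (isFree 1)
        (.lt (.idx vH) (.sum 3 (.bool (.and (.graph 20 3) (isFree 3)))))))))))
    (.fill mBase (.and (.graph 0 1) (.or (isFree 0) (.or (isFree 1)
      (.or (.entry mCl 0 1) (.entry mCl 1 0)))))))

theorem cluster_writes : cluster.writes = [mCl, mCl, mBase] := rfl

theorem holds_isFree {y : ℕ} (hy : y ≠ 2) {cl : Fin n → Fin n → Prop} (hcl : Rep (σ mCl) cl) :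
    Holds I σ (isFree y) e ↔ ∀ c, ¬ cl c (e y) := by
  simp [isFree, Function.update_of_ne hy, hcl _ _, -ne_eq]

theorem eval_sum_bool {x : ℕ} {t : Term} {p : Fin n → Prop} [DecidablePred p]
    (h : ∀ i, Holds I σ t (Function.update e x i) ↔ p i) :
    (Term.sum x (.bool t)).eval I σ e = (Finset.univ.filter p).card := by
  rw [Term.eval, Finset.card_filter]
  refine Finset.sum_congr rfl fun i _ => ?_
  rw [eval_bool]
  by_cases hp : p i
  · rw [if_pos hp, if_pos ((h i).2 hp)]
  · rw [if_neg hp, if_neg (mt (h i).1 hp)]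

open Classical in
/-- A clustering in which only the first `i` vertices have had their turn. -/
structure IsPartialClustering (G : SimpleGraph (Fin n)) (cl : Fin n → Fin n → Prop)
    (h i : ℕ) : Prop where
  adj : ∀ c y, cl c y → G.Adj c y
  unique : ∀ c c' y, cl c y → cl c' y → c = c'
  large : ∀ c, (∃ y, cl c y) → h ≤ (Finset.univ.filter fun y => cl c y).card
  sparse : ∀ v : Fin n, v < i →
    (Finset.univ.filter fun y => G.Adj v y ∧ ∀ c, ¬ cl c y).card ≤ h

open Classical in
theorem IsPartialClustering.step {cl cl' : Fin n → Fin n → Prop} {h : ℕ} {v : Fin n}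
    (hc : IsPartialClustering G cl h v) (hcl' : ∀ c y, cl' c y ↔ cl c y ∨
      (c = v ∧ G.Adj v y ∧ (∀ c, ¬ cl c y) ∧
        h ≤ (Finset.univ.filter fun y => G.Adj v y ∧ ∀ c, ¬ cl c y).card)) :
    IsPartialClustering G cl' h (v + 1) := by
  constructor
  · intro c y hcy
    rcases (hcl' c y).1 hcy with h1 | ⟨rfl, h1, -⟩
    · exact hc.adj _ _ h1
    · exact h1
  · intro c c' y h1 h2
    rcases (hcl' c y).1 h1 with h1 | ⟨rfl, -, h1, -⟩ <;>
      rcases (hcl' c' y).1 h2 with h2 | ⟨rfl, -, h2, -⟩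
    · exact hc.unique _ _ _ h1 h2
    · exact absurd h1 (h2 _)
    · exact absurd h2 (h1 _)
    · rfl
  · rintro c ⟨y, hy⟩
    rcases (hcl' c y).1 hy with h1 | ⟨rfl, -, -, h1⟩
    · refine (hc.large c ⟨y, h1⟩).trans (Finset.card_le_card fun z hz => ?_)
      simp only [Finset.mem_filter, Finset.mem_univ, true_and] at hz ⊢
      exact (hcl' c z).2 (Or.inl hz)
    · refine h1.trans (Finset.card_le_card fun z hz => ?_)
      simp only [Finset.mem_filter, Finset.mem_univ, true_and] at hz ⊢
      exact (hcl' c z).2 (Or.inr ⟨rfl, hz.1, hz.2, h1⟩)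
  · intro w hw
    by_cases hwv : w = v
    · subst hwv
      by_cases hh : h ≤ (Finset.univ.filter fun y => G.Adj w y ∧ ∀ c, ¬ cl c y).card
      · rw [Finset.filter_false_of_mem]
        · simp
        · rintro y - ⟨h1, h2⟩
          exact h2 w ((hcl' w y).2 (Or.inr ⟨rfl, h1, fun c hcy => h2 c ((hcl' c y).2 (Or.inl hcy)),
            hh⟩))
      · refine le_trans (Finset.card_le_card fun y hy => ?_) (not_le.1 hh).le
        simp only [Finset.mem_filter, Finset.mem_univ, true_and] at hy ⊢
        exact ⟨hy.1, fun c hcy => hy.2 c ((hcl' c y).2 (Or.inl hcy))⟩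
    · have hw' : (w : ℕ) < v := by
        have : (w : ℕ) ≠ v := fun h => hwv (Fin.ext h)
        omega
      refine (Finset.card_le_card fun y hy => ?_).trans (hc.sparse w hw')
      simp only [Finset.mem_filter, Finset.mem_univ, true_and] at hy ⊢
      exact ⟨hy.1, fun c hcy => hy.2 c ((hcl' c y).2 (Or.inl hcy))⟩

theorem run_cluster (hG : Rep I.graph G.Adj) :
    ∃ cl H₀, IsClustering G H₀ cl (e vH + 1) ∧ Rep (cluster.run I e σ mCl) cl ∧
      Rep (cluster.run I e σ mBase) H₀.Adj := by
  classical
  let S : Stmt := .fill mCl (.or (.entry mCl 0 1) (.and (.eq (.idx 0) (.idx 20))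
      (.and (.graph 20 1) (.and (isFree 1)
        (.lt (.idx vH) (.sum 3 (.bool (.and (.graph 20 3) (isFree 3)))))))))
  let σ₀ : Mats n := (Stmt.fill mCl (.lit 0)).run I e σ
  obtain ⟨cl, hrep, hcl⟩ : ∃ cl, Rep ((Stmt.loop 20 S).run I e σ₀ mCl) cl ∧
      IsPartialClustering G cl (e vH + 1) n := by
    refine foldUpTo_induct (f := fun i a => S.run I (Function.update e 20 i) a)
      (fun i a => ∃ cl, Rep (a mCl) cl ∧ IsPartialClustering G cl (e vH + 1) i) ?_ ?_
    · refine ⟨fun _ _ => False, fun x y => ?_, ?_, ?_, ?_, ?_⟩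
      · simp [σ₀, Stmt.run, Term.eval]
      · simp
      · simp
      · simp
      · simp
    · rintro i hi a ⟨cl, h1, h2⟩
      refine ⟨fun x y => S.run I (Function.update e 20 ⟨i, hi⟩) a mCl x y ≠ 0,
        fun x y => Iff.rfl, h2.step (v := ⟨i, hi⟩) fun c y => ?_⟩
      simp only [S, Stmt.run, Function.update_self]
      change Holds _ _ _ _ ↔ _
      simp only [holds_or, holds_and, holds_eq, holds_graph, holds_entry, holds_lt,
        holds_isFree (show 1 ≠ 2 by decide) h1, hG _ _, h1 _ _]
      rw [eval_sum_bool (p := fun y => G.Adj ⟨i, hi⟩ y ∧ ∀ c, ¬ cl c y)]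
      · simp [Term.eval, Fin.ext_iff]
      · intro z
        simp only [holds_and, holds_graph, hG _ _, holds_isFree (show 3 ≠ 2 by decide) h1]
        simp
  let H₀ : SimpleGraph (Fin n) :=
    { Adj := fun x y => G.Adj x y ∧ ((∀ c, ¬ cl c x) ∨ (∀ c, ¬ cl c y) ∨ cl x y ∨ cl y x)
      symm := ⟨fun x y h => ⟨h.1.symm, by tauto⟩⟩
      loopless := ⟨fun x h => h.1.ne rfl⟩ }
  refine ⟨cl, H₀, ⟨hcl.adj, hcl.unique, fun x y => Iff.rfl, hcl.large,
    fun v => hcl.sparse v v.2⟩, ?_, ?_⟩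
  · change Rep ((Stmt.fill mBase (.and (.graph 0 1) (.or (isFree 0) (.or (isFree 1)
      (.or (.entry mCl 0 1) (.entry mCl 1 0)))))).run I e ((Stmt.loop 20 S).run I e σ₀) mCl) cl
    rw [Stmt.run_of_notMem _ _ _ (by decide)]
    exact hrep
  · intro x y
    change Stmt.run I (Stmt.fill mBase _) e ((Stmt.loop 20 S).run I e σ₀) mBase x y ≠ 0 ↔ _
    rw [Stmt.run, Function.update_self]
    change Holds _ _ _ _ ↔ _
    simp only [holds_or, holds_and, holds_graph, holds_entry,
      holds_isFree (show 1 ≠ 2 by decide) hrep,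
      holds_isFree (show 0 ≠ 2 by decide) hrep, hG _ _, hrep _ _, H₀]
    simp

end cluster

/-! ### Computing a hitting set -/

section hit

variable {n : ℕ} {I : Inst n} {σ : Mats n} {e : Env n} {G H H₀ : SimpleGraph (Fin n)}

/-- Computes, with the greedy algorithm, a set of vertices that meets the set of all `c` with `A c`
for all pairs `(4, 5)` of vertices with `act`. -/
def hit (S : ℕ) (act : Term) (A : ℕ → Term) : Stmt :=
  .seq (.fill S (.lit 0)) (.loop 21 (.seq
    (.fill mGain (.sum 4 (.sum 5 (.bool (.and act
      (.and (.not (.ex 6 (.and (.entry S 6 6) (A 6)))) (A 0)))))))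
    (.fill S (.or (.entry S 0 0) (.and (.lt (.lit 0) (.entry mGain 0 0)) (.eq (.idx 0)
      (.inf 2 (.ite (.ex 3 (.lt (.entry mGain 2 2) (.entry mGain 3 3))) .size (.idx 2)))))))))

theorem hit_writes {S : ℕ} {act : Term} {A : ℕ → Term} :
    (hit S act A).writes = [S, mGain, S] := rfl

/-- The set that is given by the diagonal of a matrix. -/
def diagSet (M : Fin n → Fin n → ℕ) : Finset (Fin n) := Finset.univ.filter fun x => M x x ≠ 0

theorem mem_diagSet {M : Fin n → Fin n → ℕ} {x : Fin n} : x ∈ diagSet M ↔ M x x ≠ 0 := by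
  simp [diagSet]

theorem run_hit {S : ℕ} (hS : S ≠ mGain) {act : Term} {A : ℕ → Term}
    {J : Finset (Fin n × Fin n)} {B : Fin n × Fin n → Fin n → Prop}
    (hact : ∀ (a : Mats n) (e' : Env n), (∀ k, k ≠ S → k ≠ mGain → a k = σ k) → e' vT = e vT →
      (Holds I a act e' ↔ (e' 4, e' 5) ∈ J))
    (hA : ∀ (a : Mats n) (e' : Env n) (x : ℕ), (∀ k, k ≠ S → k ≠ mGain → a k = σ k) →
      e' vT = e vT → x = 0 ∨ x = 6 → (Holds I a (A x) e' ↔ B (e' 4, e' 5) (e' x)))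
    {C : Finset (Fin n)} {j : ℕ} (hj0 : 0 < j) (hC : ∀ i ∈ J, ∀ c, B i c → c ∈ C)
    (hj : ∀ i ∈ J, j ≤ 3 * (letI := Classical.decPred (B i);
      (Finset.univ.filter fun c => B i c).card)) :
    (∀ i ∈ J, ∃ c ∈ diagSet ((hit S act A).run I e σ S), B i c) ∧
      diagSet ((hit S act A).run I e σ S) ⊆ C ∧
      ((diagSet ((hit S act A).run I e σ S)).card : ℝ) ≤ 1 + 3 * C.card / j * Real.log J.card := by
  classical
  let Z : Stmt := .seq
    (.fill mGain (.sum 4 (.sum 5 (.bool (.and act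
      (.and (.not (.ex 6 (.and (.entry S 6 6) (A 6)))) (A 0)))))))
    (.fill S (.or (.entry S 0 0) (.and (.lt (.lit 0) (.entry mGain 0 0)) (.eq (.idx 0)
      (.inf 2 (.ite (.ex 3 (.lt (.entry mGain 2 2) (.entry mGain 3 3))) .size (.idx 2)))))))
  let σ₀ : Mats n := (Stmt.fill S (.lit 0)).run I e σ
  let st : ℕ → Mats n := foldUpTo (fun i a => Z.run I (Function.update e 21 i) a) σ₀
  have hframe : ∀ r ≤ n, ∀ k, k ≠ S → k ≠ mGain → st r k = σ k := by
    intro r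
    induction r with
    | zero => intro _ k hk _; exact Function.update_of_ne hk _ _
    | succ r ih =>
      intro hr k hk hk'
      simp only [st]
      rw [foldUpTo_succ (by omega)]
      exact (Stmt.run_of_notMem _ _ _ (by simp [Z, Stmt.writes, hk, hk'])).trans
        (ih (by omega) k hk hk')
  have key := greedy_hitting hj0 hC (fun i hi => by convert hj i hi)
    (fun r => diagSet (st r S)) ?_ ?_
  · exact key
  · ext x
    simp [mem_diagSet, st, foldUpTo, σ₀, Stmt.run, Term.eval]
  · intro r hr
    have hstep : st (r + 1) = Z.run I (Function.update e 21 ⟨r, hr⟩) (st r) := foldUpTo_succ hr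
    have hfr := hframe r hr.le
    set a := st r with ha
    set T := diagSet (a S) with hT
    let g : Fin n → ℕ := gain J B T
    let a' : Mats n := (Stmt.fill mGain (.sum 4 (.sum 5 (.bool (.and act
      (.and (.not (.ex 6 (.and (.entry S 6 6) (A 6)))) (A 0))))))).run I
      (Function.update e 21 ⟨r, hr⟩) a
    have hgain : ∀ x y, a' mGain x y = g x := by
      intro x y
      simp only [a', Stmt.run, Function.update_self]
      have : ∀ s, (Term.sum 5 (.bool (.and act
          (.and (.not (.ex 6 (.and (.entry S 6 6) (A 6)))) (A 0))))).eval I a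
          (Function.update (Function.update (Function.update (Function.update e 21 ⟨r, hr⟩) 0 x)
            1 y) 4 s) =
          (Finset.univ.filter fun t => (s, t) ∈ J ∧ (∀ c ∈ T, ¬ B (s, t) c) ∧ B (s, t) x).card := by
        intro s
        refine eval_sum_bool fun t => ?_
        simp only [holds_and, holds_not, holds_ex, holds_entry]
        rw [hact a _ hfr (by simp ),
          hA a _ 0 hfr (by simp ) (Or.inl rfl)]
        refine and_congr (by simp ) (and_congr ?_
          (by simp ))
        rw [not_exists]
        refine forall_congr' fun c => ?_
        rw [hA a _ 6 hfr (by simp ) (Or.inr rfl), hT, mem_diagSet]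
        simp
      rw [Term.eval, Finset.sum_congr rfl fun s _ => this s]
      simp only [g, gain, unhit, Finset.card_filter, Finset.sum_filter]
      rw [← Finset.univ_inter J, ← Finset.sum_ite_mem, Fintype.sum_prod_type]
      refine Finset.sum_congr rfl fun s _ => Finset.sum_congr rfl fun t _ => ?_
      simp only [ite_and, Finset.univ_inter]
    have haS : a' S = a S := Function.update_of_ne hS _ _
    have hnext : ∀ x y, st (r + 1) S x y ≠ 0 ↔ x ∈ T ∨ 0 < g x ∧
        (x : ℕ) = ⨅ z : Fin n, if ∃ w, g z < g w then n else (z : ℕ) := by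
      intro x y
      have : (Term.inf 2 (.ite (.ex 3 (.lt (.entry mGain 2 2) (.entry mGain 3 3))) .size
          (.idx 2))).eval I a' (Function.update (Function.update
            (Function.update e 21 ⟨r, hr⟩) 0 x) 1 y) =
          ⨅ z : Fin n, if ∃ w, g z < g w then n else (z : ℕ) := by
        rw [Term.eval]
        congr 1
        funext z
        rw [eval_ite]
        simp only [holds_ex, holds_lt, Term.eval, hgain]
        simp
      rw [hstep]
      simp only [Z, Stmt.run, Function.update_self]
      change Holds I a' _ _ ↔ _
      simp only [holds_or, holds_and, holds_eq, holds_entry, holds_lt, this]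
      simp only [Term.eval, hgain, haS, hT, mem_diagSet]
      simp
    change GreedyStep J B T (diagSet (st (r + 1) S))
    by_cases h0 : ∀ c, g c = 0
    · refine Or.inl ⟨h0, ?_⟩
      ext x
      rw [mem_diagSet, hnext, h0]
      simp
    · right
      push Not at h0
      obtain ⟨c₀, hc₀⟩ := h0
      have hne : Nonempty (Fin n) := ⟨c₀⟩
      obtain ⟨m, hm⟩ := Finite.exists_max g
      obtain ⟨c, hc⟩ : (⨅ z : Fin n, if ∃ w, g z < g w then n else (z : ℕ)) ∈ Set.range _ :=
        Nat.sInf_mem (Set.range_nonempty _)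
      have hle : (⨅ z : Fin n, if ∃ w, g z < g w then n else (z : ℕ)) ≤
          (if ∃ w, g m < g w then n else (m : ℕ)) := ciInf_le (OrderBot.bddBelow _) m
      rw [if_neg (by push Not; exact hm)] at hle
      have hcmax : ¬ ∃ w, g c < g w := by
        intro h
        have : (if ∃ w, g c < g w then n else (c : ℕ)) = n := if_pos h
        have := m.2
        simp only at hc
        omega
      have hcv : (⨅ z : Fin n, if ∃ w, g z < g w then n else (z : ℕ)) = c := by
        rw [← hc]; exact if_neg hcmax
      push Not at hcmax
      have hpos : 0 < g c := lt_of_lt_of_le (Nat.pos_of_ne_zero hc₀) (hcmax c₀)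
      refine ⟨c, hpos, hcmax, ?_⟩
      ext x
      rw [mem_diagSet, hnext, hcv, Finset.mem_insert, ← Fin.ext_iff]
      constructor
      · rintro (h | ⟨-, h⟩)
        · exact Or.inr h
        · exact Or.inl h
      · rintro (rfl | h)
        · exact Or.inr ⟨hpos, rfl⟩
        · exact Or.inl h

end hit

end MatProg

namespace MatProg

open PairSpanner SimpleGraph

/-! ### Computing the two hitting sets -/

section stages

variable {n : ℕ} {I : Inst n} {σ : Mats n} {e : Env n} {G H H₀ H₁ : SimpleGraph (Fin n)}
  {cl : Fin n → Fin n → Prop} {P : Finset (Fin n × Fin n)}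

/-- The matrices hold the distances of the graph, a clustering, its graph, and the lexicographic
distances. -/
structure Setup (I : Inst n) (σ : Mats n) (G H₀ : SimpleGraph (Fin n))
    (cl : Fin n → Fin n → Prop) : Prop where
  graph : Rep I.graph G.Adj
  dist : σ mDG = hd G
  base : Rep (σ mBase) H₀.Adj
  star : Rep (σ mCl) cl
  lex : σ mLd = ld G H₀

theorem Setup.congr (hs : Setup I σ G H₀ cl) {a : Mats n} (h1 : a mDG = σ mDG)
    (h2 : a mBase = σ mBase) (h3 : a mCl = σ mCl) (h4 : a mLd = σ mLd) : Setup I a G H₀ cl :=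
  ⟨hs.graph, h1.trans hs.dist, by rw [h2]; exact hs.base, by rw [h3]; exact hs.star,
    h4.trans hs.lex⟩

/-- The number of edges outside the graph of the clustering on a lexicographically shortest
walk. -/
def mcTerm (s t : ℕ) : Term := .sub (.entry mLd s t) (.sum 8 (.entry mDG s t))

theorem Setup.eval_mc (hs : Setup I σ G H₀ cl) {s t : ℕ} (h1 : s ≠ 8) (h2 : t ≠ 8) :
    (mcTerm s t).eval I σ e = mc G H₀ (e s) (e t) := by
  simp [mcTerm, Term.eval, hs.dist, hs.lex, mc, Function.update_of_ne h1, Function.update_of_ne h2]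

/-- The pair `(4, 5)` needs to be served by centers. -/
def active : Term := .and (.pairs 4 5) (.and (.lt (.entry mDG 4 5) .size)
  (.lt (.add (.idx vT) (.idx vT)) (mcTerm 4 5)))

/-- See `PairSpanner.MeetsFirst`. -/
def meetsFirst (x : ℕ) : Term := .ex 11 (.and (.entry mCl x 11) (.and
  (.eq (.add (.entry mLd 4 11) (.entry mLd 11 5)) (.entry mLd 4 5))
  (.not (.lt (.idx vT) (mcTerm 4 11)))))

/-- See `PairSpanner.MeetsLast`. -/
def meetsLast (x : ℕ) : Term := .ex 11 (.and (.entry mCl x 11) (.and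
  (.not (.lt (.idx vT) (mcTerm 5 11))) (.ex 12 (.and
    (.ex 13 (.and (.entry mS₁ 13 13) (.entry mCl 13 12))) (.and
    (.eq (.add (.entry mLd 4 12) (.entry mLd 12 5)) (.entry mLd 4 5)) (.and
    (.not (.lt (.idx vT) (mcTerm 4 12)))
    (.eq (.add (.entry mLd 12 11) (.entry mLd 11 5)) (.entry mLd 12 5))))))))

theorem Setup.holds_active (hs : Setup I σ G H₀ cl) (hP : ∀ s t, I.pairs s t ≠ 0 ↔ (s, t) ∈ P) :
    Holds I σ active e ↔ (e 4, e 5) ∈ P ∧ hd G (e 4) (e 5) < n ∧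
      2 * (e vT : ℕ) < mc G H₀ (e 4) (e 5) := by
  simp only [active, holds_and, holds_pairs, holds_lt, hs.eval_mc (show 4 ≠ 8 by decide)
    (show 5 ≠ 8 by decide), hP, two_mul]
  simp only [Term.eval, hs.dist]

theorem Setup.holds_meetsFirst (hs : Setup I σ G H₀ cl) {x : ℕ} (hx : x ≠ 11) :
    Holds I σ (meetsFirst x) e ↔ MeetsFirst G H₀ cl (e vT) (e 4) (e 5) (e x) := by
  simp only [meetsFirst, holds_ex, holds_and, holds_entry, holds_eq, holds_not, holds_lt,
    hs.eval_mc (show 4 ≠ 8 by decide) (show 11 ≠ 8 by decide), hs.star _ _, not_lt, MeetsFirst,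
    Term.eval, hs.lex, Function.update_self, Function.update_of_ne hx,
    Function.update_of_ne (show (4 : ℕ) ≠ 11 by decide),
    Function.update_of_ne (show (5 : ℕ) ≠ 11 by decide),
    Function.update_of_ne (show vT ≠ 11 by decide)]

theorem Setup.holds_meetsLast (hs : Setup I σ G H₀ cl) {x : ℕ} (hx : x ≠ 11) :
    Holds I σ (meetsLast x) e ↔
      MeetsLast G H₀ cl (e vT) (diagSet (σ mS₁)) (e 4) (e 5) (e x) := by
  simp only [meetsLast, holds_ex, holds_and, holds_entry, holds_eq, holds_not, holds_lt,
    hs.eval_mc (show 4 ≠ 8 by decide) (show 12 ≠ 8 by decide),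
    hs.eval_mc (show 5 ≠ 8 by decide) (show 11 ≠ 8 by decide), hs.star _ _, not_lt, MeetsLast,
    Term.eval, hs.lex, Function.update_self, Function.update_of_ne hx, mem_diagSet,
    Function.update_of_ne (show (4 : ℕ) ≠ 11 by decide),
    Function.update_of_ne (show (5 : ℕ) ≠ 11 by decide),
    Function.update_of_ne (show vT ≠ 11 by decide),
    Function.update_of_ne (show (4 : ℕ) ≠ 12 by decide),
    Function.update_of_ne (show (5 : ℕ) ≠ 12 by decide),
    Function.update_of_ne (show (11 : ℕ) ≠ 12 by decide),
    Function.update_of_ne (show (12 : ℕ) ≠ 13 by decide),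
    Function.update_of_ne (show vT ≠ 12 by decide)]

/-- Computes two sets of centers: the first one meets an early part of each active walk, the second
one a late part. -/
def hitBoth : Stmt := .seq (hit mS₁ active meetsFirst) (hit mS₂ active meetsLast)

theorem hitBoth_writes : hitBoth.writes = [mS₁, mGain, mS₁, mS₂, mGain, mS₂] := rfl

theorem run_hitBoth (hs : Setup I σ G H₀ cl) {h : ℕ} (hc : IsClustering G H₀ cl h)
    (hP : ∀ s t, I.pairs s t ≠ 0 ↔ (s, t) ∈ P) :
    (∀ s t, (s, t) ∈ P → hd G s t < n → 2 * (e vT : ℕ) < mc G H₀ s t →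
      ∃ c ∈ diagSet (hitBoth.run I e σ mS₂),
        MeetsLast G H₀ cl (e vT) (diagSet (hitBoth.run I e σ mS₁)) s t c) ∧
    ((diagSet (hitBoth.run I e σ mS₁)).card : ℝ) ≤
      1 + 3 * (centers cl).card / ((e vT : ℕ) + 1 : ℕ) * Real.log P.card ∧
    ((diagSet (hitBoth.run I e σ mS₂)).card : ℝ) ≤
      1 + 3 * (centers cl).card / ((e vT : ℕ) + 1 : ℕ) * Real.log P.card := by
  classical
  let J : Finset (Fin n × Fin n) :=
    P.filter fun p => hd G p.1 p.2 < n ∧ 2 * (e vT : ℕ) < mc G H₀ p.1 p.2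
  have hlog : (1 : ℝ) + 3 * (centers cl).card / ((e vT : ℕ) + 1 : ℕ) * Real.log J.card ≤
      1 + 3 * (centers cl).card / ((e vT : ℕ) + 1 : ℕ) * Real.log P.card := by
    refine add_le_add_right (mul_le_mul_of_nonneg_left ?_ (by positivity)) _
    rcases Nat.eq_zero_or_pos J.card with h0 | h0
    · rw [h0, Nat.cast_zero, Real.log_zero]; exact Real.log_natCast_nonneg _
    · exact Real.log_le_log (by exact_mod_cast h0)
        (by exact_mod_cast Finset.card_le_card (Finset.filter_subset _ _))
  obtain ⟨a₁, ha₁'⟩ : ∃ a, a = (hit mS₁ active meetsFirst).run I e σ := ⟨_, rfl⟩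
  have hset : ∀ a : Mats n, a mDG = σ mDG → a mBase = σ mBase → a mCl = σ mCl → a mLd = σ mLd →
      Setup I a G H₀ cl := fun a => hs.congr
  have h1 := run_hit (I := I) (σ := σ) (e := e) (S := mS₁) (by decide) (act := active)
    (A := meetsFirst) (J := J)
    (B := fun p c => MeetsFirst G H₀ cl (e vT) p.1 p.2 c) ?_ ?_ (C := centers cl)
    (j := (e vT : ℕ) + 1) (by omega) ?_ ?_
  rotate_left
  · intro a e' ha he
    rw [(hset a (ha _ (by decide) (by decide)) (ha _ (by decide) (by decide))
      (ha _ (by decide) (by decide)) (ha _ (by decide) (by decide))).holds_active hP, he]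
    simp [J]
  · rintro a e' x ha he hx
    rw [(hset a (ha _ (by decide) (by decide)) (ha _ (by decide) (by decide))
      (ha _ (by decide) (by decide)) (ha _ (by decide) (by decide))).holds_meetsFirst
        (by omega), he]
  · rintro p - c ⟨u, hu, -⟩
    exact mem_centers.2 ⟨u, hu⟩
  · rintro p hp
    obtain ⟨-, g1, g2⟩ := Finset.mem_filter.1 hp
    exact hc.card_meetsFirst g1 g2
  rw [← ha₁'] at h1
  have ha₁ : ∀ k, k ≠ mS₁ → k ≠ mGain → a₁ k = σ k := fun k hk hk' => ha₁' ▸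
    Stmt.run_of_notMem _ _ _ (by simp [hit_writes, hk, hk'])
  have h2 := run_hit (I := I) (σ := a₁) (e := e) (S := mS₂) (by decide) (act := active)
    (A := meetsLast) (J := J)
    (B := fun p c => MeetsLast G H₀ cl (e vT) (diagSet (a₁ mS₁)) p.1 p.2 c) ?_ ?_ (C := centers cl)
    (j := (e vT : ℕ) + 1) (by omega) ?_ ?_
  rotate_left
  · intro a e' ha he
    rw [(hset a ((ha _ (by decide) (by decide)).trans (ha₁ _ (by decide) (by decide)))
      ((ha _ (by decide) (by decide)).trans (ha₁ _ (by decide) (by decide)))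
      ((ha _ (by decide) (by decide)).trans (ha₁ _ (by decide) (by decide)))
      ((ha _ (by decide) (by decide)).trans (ha₁ _ (by decide) (by decide)))).holds_active hP, he]
    simp [J]
  · rintro a e' x ha he hx
    rw [(hset a ((ha _ (by decide) (by decide)).trans (ha₁ _ (by decide) (by decide)))
      ((ha _ (by decide) (by decide)).trans (ha₁ _ (by decide) (by decide)))
      ((ha _ (by decide) (by decide)).trans (ha₁ _ (by decide) (by decide)))
      ((ha _ (by decide) (by decide)).trans (ha₁ _ (by decide) (by decide)))).holds_meetsLast
        (by omega), he, ha mS₁ (by decide) (by decide)]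
  · rintro p - c ⟨u, hu, -⟩
    exact mem_centers.2 ⟨u, hu⟩
  · rintro p hp
    obtain ⟨-, g1, g2⟩ := Finset.mem_filter.1 hp
    exact hc.card_meetsLast g1 g2 (h1.1 p hp)
  have e0 : hitBoth.run I e σ = (hit mS₂ active meetsLast).run I e a₁ := by
    rw [ha₁', hitBoth, Stmt.run]
  have e1 : (hit mS₂ active meetsLast).run I e a₁ mS₁ = a₁ mS₁ :=
    Stmt.run_of_notMem (hit mS₂ active meetsLast) e a₁ (by rw [hit_writes]; decide)
  rw [e0, e1]
  exact ⟨fun s t hst g1 g2 => h2.1 (s, t) (Finset.mem_filter.2 ⟨hst, g1, g2⟩),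
    h1.2.2.trans hlog, h2.2.2.trans hlog⟩

/-! ### Joining the centers -/

/-- The matrix of the spanner under construction gets no new zeros. -/
def Grow (a b : Mats n) : Prop := ∀ x y, a mH x y ≠ 0 → b mH x y ≠ 0

theorem Grow.le {a b : Mats n} (h : Grow a b) (hH : Rep (a mH) H.Adj) (hH₁ : Rep (b mH) H₁.Adj) :
    H ≤ H₁ := fun x y hxy => (hH₁ x y).1 (h x y ((hH x y).2 hxy))

theorem Rep.grow {a b : Mats n} (hH : Rep (a mH) H.Adj) (hH₁ : Rep (b mH) H₁.Adj) (h : H ≤ H₁) :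
    Grow a b := fun x y hxy => (hH₁ x y).2 (h ((hH x y).1 hxy))

theorem Rep.graph_eq {M : Fin n → Fin n → ℕ} (hH : Rep M H.Adj) (hH₁ : Rep M H₁.Adj) : H = H₁ := by
  ext x y
  rw [← hH x y, hH₁ x y]

/-- The vertex `x` is a center. -/
def isCenter (x : ℕ) : Term := .ex 8 (.entry mCl x 8)

/-- The vertex `x` belongs to one of the hitting sets. -/
def isSpecial (x : ℕ) : Term := .or (.entry mS₁ x x) (.entry mS₂ x x)

/-- The centers `22` and `23` have to be joined. -/
def shouldJoin : Term := .or
  (.and (.and (isCenter 22) (isCenter 23)) (.and (.and (.lt (.entry mDG 22 23) .size)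
    (.not (.lt (.idx vK) (.entry mDG 22 23)))) (.lt (.entry mDG 22 23) (.entry mDH 22 23))))
  (.and (.and (isSpecial 22) (isSpecial 23)) (.and (.lt (.entry mDG 22 23) .size)
    (.lt (.add (.entry mDG 22 23) (.lit 2)) (.entry mDH 22 23))))

/-- Puts the hop distances of the spanner under construction into their matrix. -/
def refresh : Stmt := hops mDH (.entry mH 2 1)

theorem run_refresh (hH : Rep (σ mH) H.Adj) :
    refresh.run I e σ = Function.update σ mDH (hd H) :=
  run_hops fun M e => by
    rw [holds_entry, Function.update_of_ne (by decide)]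
    exact hH _ _

/-- Joins centers at distance at most `κ` by shortest walks, and centers in the hitting sets by
walks that are at most by two longer. -/
def joinCenters : Stmt := .loop 22 (.loop 23 (.seq refresh (buyIf shouldJoin 22 23)))

theorem joinCenters_writes : joinCenters.writes = [mDH, mDH, mCur, mNext, mH, mCur] := rfl

theorem run_joinCenters (hs : Setup I σ G H₀ cl) {h : ℕ} (hc : IsClustering G H₀ cl h)
    (hH : Rep (σ mH) H₀.Adj) {S : Finset (Fin n)} (hS : S = diagSet (σ mS₁) ∪ diagSet (σ mS₂)) :
    ∃ H, Rep (joinCenters.run I e σ mH) H.Adj ∧ H₀ ≤ H ∧ H ≤ G ∧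
      (∀ x ∈ centers cl, ∀ y ∈ centers cl, hd G x y < n → hd G x y ≤ e vK →
        hd H x y ≤ hd G x y) ∧
      (∀ x ∈ S, ∀ y ∈ S, hd G x y < n → hd H x y ≤ hd G x y + 2) ∧
      ecard H ≤ ecard H₀ + ((e vK : ℕ) * ((centers cl).card * (centers cl).card) +
        9 * (S.card * (centers cl).card)) := by
  classical
  let pot : SimpleGraph (Fin n) → ℕ := fun H => potential G H S (centers cl) (e vK)
  let Inv : Mats n → Prop := fun a => (∀ k, k ∉ joinCenters.writes → a k = σ k) ∧
    ∃ H, Rep (a mH) H.Adj ∧ H₀ ≤ H ∧ H ≤ G ∧ ecard H + pot H₀ ≤ ecard H₀ + pot H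
  let Q : Fin n → Fin n → Mats n → Prop := fun x y a => ∀ H, Rep (a mH) H.Adj →
    (x ∈ centers cl → y ∈ centers cl → hd G x y < n → hd G x y ≤ e vK → hd H x y ≤ hd G x y) ∧
    (x ∈ S → y ∈ S → hd G x y < n → hd H x y ≤ hd G x y + 2)
  have hQ : ∀ x y a b, Inv a → Grow a b → Q x y a → Q x y b := by
    rintro x y a b ⟨-, H, hH, -⟩ hab hq H' hH'
    have hle : hd H' x y ≤ hd H x y := hd_mono (hab.le hH hH')
    exact ⟨fun g1 g2 g3 g4 => hle.trans ((hq H hH).1 g1 g2 g3 g4),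
      fun g1 g2 g3 => hle.trans ((hq H hH).2 g1 g2 g3)⟩
  have hrefl : ∀ a : Mats n, Grow a a := fun a x y h => h
  have htrans : ∀ a b c : Mats n, Grow a b → Grow b c → Grow a c :=
    fun a b c h1 h2 x y h => h2 x y (h1 x y h)
  have hmain : Inv (joinCenters.run I e σ) ∧ Grow σ (joinCenters.run I e σ) ∧
      ∀ x y, Q x y (joinCenters.run I e σ) := by
    refine run_loop_forall Inv Grow (fun x a => ∀ y, Q x y a) hrefl htrans
      (fun x a b g1 g2 g3 y => hQ x y a b g1 g2 (g3 y))
      ⟨fun _ _ => rfl, H₀, hH, le_rfl, hc.le, le_rfl⟩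
      fun x a ha _ => ?_
    refine run_loop_forall Inv Grow (fun y a => Q x y a) hrefl htrans
      (fun y a b g1 g2 g3 => hQ x y a b g1 g2 g3) ha fun y a ha _ => ?_
    obtain ⟨hfr, H, hHa, h1, h2, h3⟩ := ha
    set e' := Function.update (Function.update e 22 x) 23 y with he'
    let a' := refresh.run I e' a
    have ha' : a' = Function.update a mDH (hd H) := run_refresh hHa
    have hk : ∀ k, k ≠ mDH → a' k = a k := fun k hk => by rw [ha', Function.update_of_ne hk]
    have hsa : Setup I a' G H₀ cl := hs.congr
      ((hk _ (by decide)).trans (hfr _ (by rw [joinCenters_writes]; decide)))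
      ((hk _ (by decide)).trans (hfr _ (by rw [joinCenters_writes]; decide)))
      ((hk _ (by decide)).trans (hfr _ (by rw [joinCenters_writes]; decide)))
      ((hk _ (by decide)).trans (hfr _ (by rw [joinCenters_writes]; decide)))
    have hS₁ : a' mS₁ = σ mS₁ :=
      (hk _ (by decide)).trans (hfr _ (by rw [joinCenters_writes]; decide))
    have hS₂ : a' mS₂ = σ mS₂ :=
      (hk _ (by decide)).trans (hfr _ (by rw [joinCenters_writes]; decide))
    have hDH : a' mDH = hd H := by rw [ha', Function.update_self]
    have hHa' : Rep (a' mH) H.Adj := by rw [hk _ (by decide)]; exact hHa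
    have hx : e' 22 = x := by simp [he']
    have hy : e' 23 = y := by simp [he']
    have hK : e' vK = e vK := by simp [he']
    have hcond : ∀ i j, Holds I a' shouldJoin (Function.update (Function.update e' 0 i) 1 j) ↔
        (((x ∈ centers cl ∧ y ∈ centers cl) ∧ (hd G x y < n ∧ hd G x y ≤ e vK) ∧
          hd G x y < hd H x y) ∨
        ((x ∈ S ∧ y ∈ S) ∧ hd G x y < n ∧ hd G x y + 2 < hd H x y)) := by
      intro i j
      simp only [shouldJoin, isCenter, isSpecial, holds_or, holds_and, holds_ex, holds_not,
        holds_lt, holds_entry, not_lt, Term.eval, hsa.star _ _, hsa.dist, hS₁, hS₂, hDH,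
        mem_centers, hS, Finset.mem_union, mem_diagSet]
      simp [hx, hy, hK]
    have hfr' : ∀ k, k ∉ joinCenters.writes →
        (Stmt.seq refresh (buyIf shouldJoin 22 23)).run I e' a k = σ k := fun k hk =>
      (Stmt.run_of_notMem (.seq refresh (buyIf shouldJoin 22 23)) _ _ hk).trans (hfr k hk)
    have hrun : (Stmt.seq refresh (buyIf shouldJoin 22 23)).run I e' a =
      (buyIf shouldJoin 22 23).run I e' a' := rfl
    have hbuy := run_buyIf (I := I) (σ := a') (e := e') (s := 22) (t := 23) (c := shouldJoin)
      (by decide) (by decide) hs.graph hsa.base hsa.lex hHa' _ hcond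
      (by rw [hx, hy]; rintro (⟨-, ⟨h, -⟩, -⟩ | ⟨-, h, -⟩) <;> exact h)
    rw [← hrun, hx, hy] at hbuy
    rcases hbuy with ⟨hC, p, hp, hrep⟩ | ⟨hC, hrep⟩
    · have hle : H ≤ addWalk H p := le_addWalk p
      have hd1 : hd (addWalk H p) x y ≤ hd G x y := hp.1 ▸ hd_addWalk_le p fun _ h => h
      refine ⟨⟨hfr', _, hrep, h1.trans hle, addWalk_le h2 p, ?_⟩, hHa.grow hrep hle, ?_⟩
      · have : ecard (addWalk H p) + pot H ≤ ecard H + pot (addWalk H p) := by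
          rcases hC with ⟨⟨g1, g2⟩, ⟨-, g3⟩, g4⟩ | ⟨⟨g1, g2⟩, -, g4⟩
          · exact potential_short g1 g2 hp g3 h1 g4
          · exact hc.potential_far g1 g2 hp h1 g4
        omega
      · intro H' hH'
        obtain rfl := hrep.graph_eq hH'
        exact ⟨fun _ _ _ _ => hd1, fun _ _ _ => hd1.trans (by omega)⟩
    · refine ⟨⟨hfr', H, hrep, h1, h2, h3⟩, hHa.grow hrep le_rfl, ?_⟩
      intro H' hH'
      obtain rfl := hrep.graph_eq hH'
      rw [not_or] at hC
      refine ⟨fun g1 g2 g3 g4 => not_lt.1 fun g5 => hC.1 ⟨⟨g1, g2⟩, ⟨g3, g4⟩, g5⟩,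
        fun g1 g2 g3 => not_lt.1 fun g5 => hC.2 ⟨⟨g1, g2⟩, g3, g5⟩⟩
  obtain ⟨⟨-, H, g1, g2, g3, g4⟩, -, g5⟩ := hmain
  refine ⟨H, g1, g2, g3, fun x hx y hy => (g5 x y H g1).1 hx hy,
    fun x hx y hy => (g5 x y H g1).2 hx hy, ?_⟩
  have := potential_le (G := G) (H := H) S (centers cl) (e vK)
  simp only [pot] at g4
  omega

end stages

end MatProg

namespace MatProg

open PairSpanner SimpleGraph

/-! ### Joining the pairs -/

section stages

variable {n : ℕ} {I : Inst n} {σ : Mats n} {e : Env n} {G H H₀ H₁ : SimpleGraph (Fin n)}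
  {cl : Fin n → Fin n → Prop} {P : Finset (Fin n × Fin n)}

/-- The distance of `s` and `t` in `H` is at most `(1 + a / b) d + 4`, where `d` is their distance
in `G`. -/
def Good (a b : ℕ) (G H : SimpleGraph (Fin n)) (s t : Fin n) : Prop :=
  hd G s t < n → hd H s t < n ∧ b * hd H s t ≤ (a + b) * hd G s t + 4 * b

theorem Good.mono {a b : ℕ} {s t : Fin n} (h : Good a b G H s t) (hle : H ≤ H₁) :
    Good a b G H₁ s t := fun hr =>
  ⟨(hd_mono hle).trans_lt (h hr).1, (Nat.mul_le_mul_left b (hd_mono hle)).trans (h hr).2⟩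

theorem good_self {a b : ℕ} {s t : Fin n} : Good a b G G s t := fun hr =>
  ⟨hr, by rw [add_mul]; omega⟩

/-- There is a sufficiently short detour from `s` to `t` through `u` and `v` that needs few edges
outside of `H`. -/
def Detour (a b τ : ℕ) (G H₀ H : SimpleGraph (Fin n)) (s t u v : Fin n) : Prop :=
  hd G s u < n ∧ hd H u v < n ∧ hd G t v < n ∧ mc G H₀ s u ≤ τ ∧ mc G H₀ t v ≤ τ ∧
    b * (hd G s u + hd H u v + hd G t v) ≤ (a + b) * hd G s t + 4 * b

theorem Detour.mono {a b τ : ℕ} {s t u v : Fin n} (h : Detour a b τ G H₀ H s t u v)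
    (hle : H ≤ H₁) : Detour a b τ G H₀ H₁ s t u v := by
  obtain ⟨h1, h2, h3, h4, h5, h6⟩ := h
  have := hd_mono (x := u) (y := v) hle
  refine ⟨h1, this.trans_lt h2, h3, h4, h5, le_trans (Nat.mul_le_mul_left _ ?_) h6⟩
  omega

/-- The product of a distance by `b`. -/
def mulDenom (t : Term) : Term := .mul 8 .denom t

/-- The bound `(a + b) d + 4 b`. -/
def budget (s t : ℕ) : Term := .add (.mul 8 (.add .numer .denom) (.entry mDG s t))
  (.add (.add .denom .denom) (.add .denom .denom))

/-- The pair is not served well enough. -/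
def isBad (s t : ℕ) : Term := .and (.lt (.entry mDG s t) .size)
  (.or (.not (.lt (.entry mDH s t) .size))
    (.lt (budget s t) (mulDenom (.entry mDH s t))))

theorem eval_mulDenom {D s t : ℕ} (hs : s ≠ 8) (ht : t ≠ 8) (hn : σ D (e s) (e t) < n) :
    (mulDenom (.entry D s t)).eval I σ e = I.denom * σ D (e s) (e t) := by
  rw [mulDenom, eval_mul (a := I.denom) (b := σ D (e s) (e t)) (fun _ => rfl)
    (fun _ => by simp [Term.eval, Function.update_of_ne hs, Function.update_of_ne ht]),
    min_eq_left hn.le]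

theorem eval_budget {s t : ℕ} (hs : s ≠ 8) (ht : t ≠ 8) (hn : σ mDG (e s) (e t) < n) :
    (budget s t).eval I σ e = (I.numer + I.denom) * σ mDG (e s) (e t) + 4 * I.denom := by
  rw [budget, Term.eval, eval_mul (a := I.numer + I.denom) (b := σ mDG (e s) (e t)) (fun _ => rfl)
    (fun _ => by simp [Term.eval, Function.update_of_ne hs, Function.update_of_ne ht]),
    min_eq_left hn.le]
  simp only [Term.eval]
  ring

theorem holds_isBad {s t : ℕ} (hs : s ≠ 8) (ht : t ≠ 8) (hDG : σ mDG = hd G) (hDH : σ mDH = hd H) :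
    Holds I σ (isBad s t) e ↔ ¬ Good I.numer I.denom G H (e s) (e t) := by
  simp only [isBad, holds_and, holds_lt, holds_or, holds_not]
  rw [Good, Classical.not_imp]
  have e1 : Term.eval I σ (.entry mDG s t) e = hd G (e s) (e t) := by rw [Term.eval, hDG]
  have e2 : Term.eval I σ (.entry mDH s t) e = hd H (e s) (e t) := by rw [Term.eval, hDH]
  rw [e1, e2]
  refine and_congr_right fun h1 => ?_
  by_cases h2 : hd H (e s) (e t) < n
  · rw [eval_mulDenom hs ht (by rw [hDH]; exact h2), eval_budget hs ht (by rw [hDG]; exact h1),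
      hDG, hDH]
    simp [Term.eval, h2]
  · simp [Term.eval, h2]

/-- The pair `(24, 25)` is to be served through `26` and `27`. -/
def shouldServe : Term := .and (.pairs 24 25) (.and (isBad 24 25) (.and
  (.lt (.entry mDG 24 26) .size) (.and (.lt (.entry mDH 26 27) .size) (.and
  (.lt (.entry mDG 25 27) .size) (.and (.not (.lt (.idx vT) (mcTerm 24 26))) (.and
  (.not (.lt (.idx vT) (mcTerm 25 27)))
  (.not (.lt (budget 24 25) (.add (mulDenom (.entry mDG 24 26)) (.add
    (mulDenom (.entry mDH 26 27)) (mulDenom (.entry mDG 25 27))))))))))))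

theorem Setup.holds_shouldServe (hs : Setup I σ G H₀ cl) (hDH : σ mDH = hd H)
    (hP : ∀ s t, I.pairs s t ≠ 0 ↔ (s, t) ∈ P) :
    Holds I σ shouldServe e ↔ (e 24, e 25) ∈ P ∧ ¬ Good I.numer I.denom G H (e 24) (e 25) ∧
      Detour I.numer I.denom (e vT) G H₀ H (e 24) (e 25) (e 26) (e 27) := by
  simp only [shouldServe, holds_and, holds_pairs, hP]
  rw [holds_isBad (by decide) (by decide) hs.dist hDH]
  refine and_congr_right fun _ => and_congr_right fun hbad => ?_
  have h0 : hd G (e 24) (e 25) < n := (Classical.not_imp.1 hbad).1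
  simp only [holds_lt, holds_not, hs.eval_mc (show 24 ≠ 8 by decide) (show 26 ≠ 8 by decide),
    hs.eval_mc (show 25 ≠ 8 by decide) (show 27 ≠ 8 by decide), not_lt, Detour]
  have e1 : Term.eval I σ (.entry mDG 24 26) e = hd G (e 24) (e 26) := by rw [Term.eval, hs.dist]
  have e2 : Term.eval I σ (.entry mDH 26 27) e = hd H (e 26) (e 27) := by rw [Term.eval, hDH]
  have e3 : Term.eval I σ (.entry mDG 25 27) e = hd G (e 25) (e 27) := by rw [Term.eval, hs.dist]
  have e4 : Term.eval I σ .size e = n := rfl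
  rw [e1, e2, e3, e4]
  refine and_congr_right fun h1 => and_congr_right fun h2 => and_congr_right fun h3 =>
    and_congr_right fun _ => and_congr_right fun _ => ?_
  rw [eval_budget (by decide) (by decide) (by rw [hs.dist]; exact h0), Term.eval, Term.eval,
    eval_mulDenom (by decide) (by decide) (by rw [hs.dist]; exact h1),
    eval_mulDenom (by decide) (by decide) (by rw [hDH]; exact h2),
    eval_mulDenom (by decide) (by decide) (by rw [hs.dist]; exact h3), hs.dist, hDH,
    ← mul_add, ← mul_add, add_assoc]

/-- Serves the pairs one by one, through any pair of vertices that admits a cheap detour. -/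
def joinPairs : Stmt := .loop 24 (.loop 25 (.loop 26 (.loop 27 (.seq refresh
  (.seq (.fill mFlag shouldServe)
    (.seq (buyIf (.entry mFlag 0 0) 24 26) (buyIf (.entry mFlag 0 0) 25 27)))))))

theorem joinPairs_writes :
    joinPairs.writes = [mDH, mDH, mFlag, mCur, mNext, mH, mCur, mCur, mNext, mH, mCur] := rfl

theorem Setup.run_serve (hs : Setup I σ G H₀ cl) (hH : Rep (σ mH) H.Adj) (h₀ : H₀ ≤ H)
    (hG : H ≤ G) (hP : ∀ s t, I.pairs s t ≠ 0 ↔ (s, t) ∈ P) :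
    ∃ H', Rep ((Stmt.seq refresh (.seq (.fill mFlag shouldServe)
        (.seq (buyIf (.entry mFlag 0 0) 24 26) (buyIf (.entry mFlag 0 0) 25 27)))).run I e σ mH)
          H'.Adj ∧ H ≤ H' ∧ H' ≤ G ∧
      ((H' = H ∧ ((e 24, e 25) ∈ P →
          Detour I.numer I.denom (e vT) G H₀ H (e 24) (e 25) (e 26) (e 27) →
          Good I.numer I.denom G H (e 24) (e 25))) ∨
        ((e 24, e 25) ∈ P ∧ ¬ Good I.numer I.denom G H (e 24) (e 25) ∧
          Good I.numer I.denom G H' (e 24) (e 25) ∧ ecard H' ≤ ecard H + 2 * (e vT : ℕ))) := by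
  classical
  obtain ⟨C, hCdef⟩ : ∃ C : Prop, C = ((e 24, e 25) ∈ P ∧
    ¬ Good I.numer I.denom G H (e 24) (e 25) ∧
      Detour I.numer I.denom (e vT) G H₀ H (e 24) (e 25) (e 26) (e 27)) := ⟨_, rfl⟩
  obtain ⟨a₁, ha₁⟩ : ∃ a, a = refresh.run I e σ := ⟨_, rfl⟩
  obtain ⟨a₂, ha₂⟩ : ∃ a, a = (Stmt.fill mFlag shouldServe).run I e a₁ := ⟨_, rfl⟩
  obtain ⟨a₃, ha₃⟩ : ∃ a, a = (buyIf (.entry mFlag 0 0) 24 26).run I e a₂ := ⟨_, rfl⟩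
  have hrun : (Stmt.seq refresh (.seq (.fill mFlag shouldServe)
      (.seq (buyIf (.entry mFlag 0 0) 24 26) (buyIf (.entry mFlag 0 0) 25 27)))).run I e σ =
      (buyIf (.entry mFlag 0 0) 25 27).run I e a₃ := by
    rw [ha₃, ha₂, ha₁]; rfl
  rw [hrun]
  have hk₁ : ∀ k, k ≠ mDH → a₁ k = σ k := fun k hk => by
    rw [ha₁, run_refresh hH, Function.update_of_ne hk]
  have hDH : a₁ mDH = hd H := by rw [ha₁, run_refresh hH, Function.update_self]
  have hs₁ : Setup I a₁ G H₀ cl := hs.congr (hk₁ _ (by decide)) (hk₁ _ (by decide))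
    (hk₁ _ (by decide)) (hk₁ _ (by decide))
  have hk₂ : ∀ k, k ≠ mFlag → a₂ k = a₁ k := fun k hk => by
    rw [ha₂, Stmt.run, Function.update_of_ne hk]
  have hs₂ : Setup I a₂ G H₀ cl := hs₁.congr (hk₂ _ (by decide)) (hk₂ _ (by decide))
    (hk₂ _ (by decide)) (hk₂ _ (by decide))
  have hH₂ : Rep (a₂ mH) H.Adj := by rw [hk₂ _ (by decide), hk₁ _ (by decide)]; exact hH
  have hflag₂ : ∀ i j, a₂ mFlag i j ≠ 0 ↔ C := by
    intro i j
    rw [ha₂, Stmt.run, Function.update_self]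
    change Holds _ _ _ _ ↔ _
    rw [hs₁.holds_shouldServe hDH hP, hCdef]
    simp
  have hk₃ : ∀ k, k ∉ [mCur, mNext, mH, mCur] → a₃ k = a₂ k := fun k hk => by
    rw [ha₃]; exact Stmt.run_of_notMem (buyIf (.entry mFlag 0 0) 24 26) _ _ hk
  have hs₃ : Setup I a₃ G H₀ cl := hs₂.congr (hk₃ _ (by decide)) (hk₃ _ (by decide))
    (hk₃ _ (by decide)) (hk₃ _ (by decide))
  have hflag₃ : ∀ i j, a₃ mFlag i j ≠ 0 ↔ C := by rw [hk₃ _ (by decide)]; exact hflag₂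
  have b1 := run_buyIf (I := I) (σ := a₂) (e := e) (s := 24) (t := 26) (c := .entry mFlag 0 0)
    (by decide) (by decide) hs.graph hs₂.base hs₂.lex hH₂ C (fun i j => hflag₂ _ _)
    (by rw [hCdef]; exact fun h => h.2.2.1)
  rw [← ha₃] at b1
  rcases b1 with ⟨hC, p, hp, hH₃⟩ | ⟨hC, hH₃⟩
  · have b2 := run_buyIf (I := I) (σ := a₃) (e := e) (s := 25) (t := 27) (c := .entry mFlag 0 0)
      (by decide) (by decide) hs.graph hs₃.base hs₃.lex hH₃ C (fun i j => hflag₃ _ _)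
      (by rw [hCdef]; exact fun h => h.2.2.2.2.1)
    rcases b2 with ⟨-, q, hq, hH₄⟩ | ⟨hC', -⟩
    · have l1 : H ≤ addWalk H p := le_addWalk p
      have l2 : addWalk H p ≤ addWalk (addWalk H p) q := le_addWalk q
      refine ⟨_, hH₄, l1.trans l2, addWalk_le (addWalk_le hG p) q, Or.inr ?_⟩
      rw [hCdef] at hC
      obtain ⟨g1, g2, g3, g4, g5, g6, g7, g8⟩ := hC
      refine ⟨g1, g2, fun hr => ?_, ?_⟩
      · have d1 : hd (addWalk (addWalk H p) q) (e 24) (e 26) ≤ hd G (e 24) (e 26) :=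
          (hd_mono l2).trans (hp.1 ▸ hd_addWalk_le p fun _ h => h)
        have d2 : hd (addWalk (addWalk H p) q) (e 26) (e 27) ≤ hd H (e 26) (e 27) :=
          hd_mono (l1.trans l2)
        have d3 : hd (addWalk (addWalk H p) q) (e 27) (e 25) ≤ hd G (e 25) (e 27) := by
          rw [hd_comm]
          exact hq.1 ▸ hd_addWalk_le q fun _ h => h
        have d4 : hd (addWalk (addWalk H p) q) (e 24) (e 25) ≤
            hd G (e 24) (e 26) + hd H (e 26) (e 27) + hd G (e 25) (e 27) :=
          hd_triangle.trans (add_le_add (hd_triangle.trans (add_le_add d1 d2)) d3)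
        refine ⟨?_, (Nat.mul_le_mul_left _ d4).trans g8⟩
        rw [hd_lt_iff]
        exact ((hd_lt_iff.1 (d1.trans_lt g3)).trans (hd_lt_iff.1 (d2.trans_lt g4))).trans
          (hd_lt_iff.1 (d3.trans_lt g5))
      · have c1 := ecard_addWalk_le h₀ p
        have c2 := ecard_addWalk_le (h₀.trans l1) q
        have c3 := hp.2
        have c4 := hq.2
        omega
    · exact absurd hC hC'
  · have b2 := run_buyIf (I := I) (σ := a₃) (e := e) (s := 25) (t := 27) (c := .entry mFlag 0 0)
      (by decide) (by decide) hs.graph hs₃.base hs₃.lex hH₃ C (fun i j => hflag₃ _ _)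
      (fun h => absurd h hC)
    rcases b2 with ⟨hC', -⟩ | ⟨-, hH₄⟩
    · exact absurd hC' hC
    · refine ⟨H, hH₄, le_rfl, hG, Or.inl ⟨rfl, fun g1 g2 => ?_⟩⟩
      by_contra g3
      exact hC (hCdef ▸ ⟨g1, g3, g2⟩)

theorem run_joinPairs (hs : Setup I σ G H₀ cl) (hH : Rep (σ mH) H₁.Adj) (h₀ : H₀ ≤ H₁)
    (hG : H₁ ≤ G) (hP : ∀ s t, I.pairs s t ≠ 0 ↔ (s, t) ∈ P) :
    ∃ H, Rep (joinPairs.run I e σ mH) H.Adj ∧ H ≤ G ∧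
      (∀ s t, (s, t) ∈ P → (∃ u v, Detour I.numer I.denom (e vT) G H₀ H₁ s t u v) →
        Good I.numer I.denom G H s t) ∧
      ecard H ≤ ecard H₁ + 2 * (e vT : ℕ) * P.card := by
  classical
  let good : SimpleGraph (Fin n) → Finset (Fin n × Fin n) := fun H =>
    P.filter fun p => Good I.numer I.denom G H p.1 p.2
  let Inv : Mats n → Prop := fun a => (∀ k, k ∉ joinPairs.writes → a k = σ k) ∧
    ∃ H, Rep (a mH) H.Adj ∧ H₁ ≤ H ∧ H ≤ G ∧
      ecard H ≤ ecard H₁ + 2 * (e vT : ℕ) * (good H).card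
  let Q : Fin n → Fin n → Fin n → Fin n → Mats n → Prop := fun s t u v a => ∀ H, Rep (a mH) H.Adj →
    (s, t) ∈ P → Detour I.numer I.denom (e vT) G H₀ H₁ s t u v → Good I.numer I.denom G H s t
  have hQ : ∀ s t u v a b, Inv a → Grow a b → Q s t u v a → Q s t u v b := by
    rintro s t u v a b ⟨-, H, hH, -⟩ hab hq H' hH' g1 g2
    exact (hq H hH g1 g2).mono (hab.le hH hH')
  have hrefl : ∀ a : Mats n, Grow a a := fun a x y h => h
  have htrans : ∀ a b c : Mats n, Grow a b → Grow b c → Grow a c :=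
    fun a b c h1 h2 x y h => h2 x y (h1 x y h)
  have hmain : Inv (joinPairs.run I e σ) ∧ Grow σ (joinPairs.run I e σ) ∧
      ∀ s t u v, Q s t u v (joinPairs.run I e σ) := by
    refine run_loop_forall Inv Grow (fun s a => ∀ t u v, Q s t u v a) hrefl htrans
      (fun s a b g1 g2 g3 t u v => hQ s t u v a b g1 g2 (g3 t u v))
      ⟨fun _ _ => rfl, H₁, hH, le_rfl, hG, by omega⟩ fun s a ha _ => ?_
    refine run_loop_forall Inv Grow (fun t a => ∀ u v, Q s t u v a) hrefl htrans
      (fun t a b g1 g2 g3 u v => hQ s t u v a b g1 g2 (g3 u v)) ha fun t a ha _ => ?_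
    refine run_loop_forall Inv Grow (fun u a => ∀ v, Q s t u v a) hrefl htrans
      (fun u a b g1 g2 g3 v => hQ s t u v a b g1 g2 (g3 v)) ha fun u a ha _ => ?_
    refine run_loop_forall Inv Grow (fun v a => Q s t u v a) hrefl htrans
      (fun v a b g1 g2 g3 => hQ s t u v a b g1 g2 g3) ha fun v a ha _ => ?_
    obtain ⟨hfr, H, hHa, h1, h2, h3⟩ := ha
    set e' := Function.update (Function.update (Function.update (Function.update e 24 s) 25 t)
      26 u) 27 v with he'
    have hsa : Setup I a G H₀ cl := hs.congr (hfr _ (by rw [joinPairs_writes]; decide))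
      (hfr _ (by rw [joinPairs_writes]; decide)) (hfr _ (by rw [joinPairs_writes]; decide))
      (hfr _ (by rw [joinPairs_writes]; decide))
    have x1 : e' 24 = s := by simp [he']
    have x2 : e' 25 = t := by simp [he']
    have x3 : e' 26 = u := by simp [he']
    have x4 : e' 27 = v := by simp [he']
    have x5 : e' vT = e vT := by simp [he']
    obtain ⟨H', hrep, l1, l2, hor⟩ := hsa.run_serve (e := e') hHa (h₀.trans h1) h2 hP
    rw [x1, x2, x3, x4, x5] at hor
    refine ⟨⟨fun k hk => (Stmt.run_of_notMem (.seq refresh (.seq (.fill mFlag shouldServe)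
      (.seq (buyIf (.entry mFlag 0 0) 24 26) (buyIf (.entry mFlag 0 0) 25 27)))) _ _ hk).trans
        (hfr k hk), H', hrep, h1.trans l1, l2, ?_⟩, hHa.grow hrep l1, ?_⟩
    · rcases hor with ⟨rfl, -⟩ | ⟨g1, g2, g3, g4⟩
      · exact h3
      · have hcard : (good H).card + 1 ≤ (good H').card := by
          have hn : (s, t) ∉ good H := fun h => g2 (Finset.mem_filter.1 h).2
          rw [← Finset.card_insert_of_notMem hn]
          refine Finset.card_le_card fun p hp => ?_
          rcases Finset.mem_insert.1 hp with rfl | hp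
          · exact Finset.mem_filter.2 ⟨g1, g3⟩
          · exact Finset.mem_filter.2 ⟨(Finset.mem_filter.1 hp).1,
              (Finset.mem_filter.1 hp).2.mono l1⟩
        have := Nat.mul_le_mul_left (2 * (e vT : ℕ)) hcard
        rw [mul_add, mul_one] at this
        omega
    · intro H'' hH'' hst hdet
      obtain rfl := hrep.graph_eq hH''
      rcases hor with ⟨rfl, g⟩ | ⟨g1, g2, g3, g4⟩
      · exact g hst (hdet.mono h1)
      · exact g3
  obtain ⟨⟨-, H, g1, g2, g3, g4⟩, -, g5⟩ := hmain
  refine ⟨H, g1, g3, fun s t hst ⟨u, v, h⟩ => g5 s t u v H g1 hst h, g4.trans ?_⟩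
  exact Nat.add_le_add_left (Nat.mul_le_mul_left _ (Finset.card_filter_le _ _)) _

/-! ### Keeping the best spanner -/

/-- The graph serves all pairs. -/
def Valid (I : Inst n) (P : Finset (Fin n × Fin n)) (G H : SimpleGraph (Fin n)) : Prop :=
  ∀ s t, (s, t) ∈ P → Good I.numer I.denom G H s t

/-- Twice the number of edges of a graph. -/
def size (k : ℕ) : Term := .sum 2 (.sum 3 (.bool (.entry k 2 3)))

theorem eval_size {k : ℕ} (hH : Rep (σ k) H.Adj) : (size k).eval I σ e = 2 * ecard H := by
  classical
  have h1 : ∀ x, (Term.sum 3 (.bool (.entry k 2 3))).eval I σ (Function.update e 2 x) =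
      H.degree x := by
    intro x
    rw [eval_sum_bool (p := fun y => H.Adj x y), ← card_neighborFinset_eq_degree,
      neighborFinset_eq_filter]
    intro y
    rw [holds_entry, hH]
    simp
  rw [size, Term.eval, Finset.sum_congr rfl fun x _ => h1 x, sum_degrees_eq_twice_card_edges, ecard,
    ← coe_edgeFinset, Set.ncard_coe_finset]

/-- Replaces the best spanner by the current graph, if this serves all pairs and has fewer edges. -/
def update : Stmt := .seq refresh (.fill mBest (.ite
  (.and (.not (.ex 2 (.ex 3 (.and (.pairs 2 3) (isBad 2 3))))) (.lt (size mH) (size mBest)))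
  (.entry mH 0 1) (.entry mBest 0 1)))

theorem run_update (hDG : σ mDG = hd G) (hH : Rep (σ mH) H.Adj) (hHG : H ≤ G)
    (hP : ∀ s t, I.pairs s t ≠ 0 ↔ (s, t) ∈ P) {B : SimpleGraph (Fin n)} (hB : Rep (σ mBest) B.Adj)
    (hBG : B ≤ G) (hBv : Valid I P G B) :
    ∃ B', Rep (update.run I e σ mBest) B'.Adj ∧ B' ≤ G ∧ Valid I P G B' ∧ ecard B' ≤ ecard B ∧
      (Valid I P G H → ecard B' ≤ ecard H) := by
  classical
  obtain ⟨a, ha⟩ : ∃ a, a = refresh.run I e σ := ⟨_, rfl⟩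
  have hk : ∀ k, k ≠ mDH → a k = σ k := fun k hk => by
    rw [ha, run_refresh hH, Function.update_of_ne hk]
  have hDH : a mDH = hd H := by rw [ha, run_refresh hH, Function.update_self]
  have hcond : ∀ i j, Holds I a (.and (.not (.ex 2 (.ex 3 (.and (.pairs 2 3) (isBad 2 3)))))
      (.lt (size mH) (size mBest))) (Function.update (Function.update e 0 i) 1 j) ↔
      Valid I P G H ∧ ecard H < ecard B := by
    intro i j
    rw [holds_and, holds_lt, eval_size (H := H) (by rw [hk _ (by decide)]; exact hH),
      eval_size (H := B) (by rw [hk _ (by decide)]; exact hB)]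
    refine and_congr ?_ (by omega)
    simp only [holds_not, holds_ex, holds_and, holds_pairs, hP, not_exists, not_and,
      holds_isBad (show 2 ≠ 8 by decide) (show 3 ≠ 8 by decide)
        ((hk mDG (by decide)).trans hDG) hDH, not_not, Valid]
    simp
  have hrun : ∀ i j, update.run I e σ mBest i j =
      if Valid I P G H ∧ ecard H < ecard B then σ mH i j else σ mBest i j := by
    intro i j
    rw [update, Stmt.run, ← ha, Stmt.run, Function.update_self, eval_ite,
      if_congr (hcond i j) rfl rfl]
    simp [Term.eval, hk]
  by_cases hc : Valid I P G H ∧ ecard H < ecard B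
  · exact ⟨H, fun i j => by rw [hrun, if_pos hc]; exact hH i j, hHG, hc.1, hc.2.le, fun _ => le_rfl⟩
  · refine ⟨B, fun i j => by rw [hrun, if_neg hc]; exact hB i j, hBG, hBv, le_rfl, fun h => ?_⟩
    by_contra h'
    exact hc ⟨h, not_le.1 h'⟩

/-! ### The greedy spanner -/

/-- The variable of the loop that holds the stretch of the greedy spanner. -/
abbrev vL : ℕ := 30

/-- The greedy spanner with stretch `L`; for `L = 0`, the graph without edges. -/
def greedy : Stmt := .seq (.fill mH (.lit 0)) (.loop 22 (.loop 23 (.seq refresh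
  (.fill mH (.or (.entry mH 0 1) (.and (.and (.graph 22 23) (.and (.lt (.lit 0) (.idx vL))
    (.lt (.idx vL) (.entry mDH 22 23))))
    (.or (.and (.eq (.idx 0) (.idx 22)) (.eq (.idx 1) (.idx 23)))
      (.and (.eq (.idx 0) (.idx 23)) (.eq (.idx 1) (.idx 22))))))))))

theorem greedy_writes : greedy.writes = [mH, mDH, mDH, mH] := rfl

theorem run_greedy (hG : Rep I.graph G.Adj) :
    ∃ H, Rep (greedy.run I e σ mH) H.Adj ∧ H ≤ G ∧ NoShortCycle H (e vL) ∧
      ((e vL : ℕ) = 0 → H = ⊥) ∧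
      (0 < (e vL : ℕ) → ∀ x y, G.Adj x y → hd H x y ≤ e vL) := by
  classical
  let Inv : Mats n → Prop := fun a =>
    ∃ H, Rep (a mH) H.Adj ∧ H ≤ G ∧ NoShortCycle H (e vL) ∧ ((e vL : ℕ) = 0 → H = ⊥)
  let Q : Fin n → Fin n → Mats n → Prop := fun x y a => ∀ H, Rep (a mH) H.Adj →
    0 < (e vL : ℕ) → G.Adj x y → hd H x y ≤ e vL
  have hQ : ∀ x y a b, Inv a → Grow a b → Q x y a → Q x y b := by
    rintro x y a b ⟨H, hH, -⟩ hab hq H' hH' g1 g2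
    exact (hd_mono (hab.le hH hH')).trans (hq H hH g1 g2)
  have hrefl : ∀ a : Mats n, Grow a a := fun a x y h => h
  have htrans : ∀ a b c : Mats n, Grow a b → Grow b c → Grow a c :=
    fun a b c h1 h2 x y h => h2 x y (h1 x y h)
  let S : Stmt := .seq refresh
    (.fill mH (.or (.entry mH 0 1) (.and (.and (.graph 22 23) (.and (.lt (.lit 0) (.idx vL))
      (.lt (.idx vL) (.entry mDH 22 23))))
      (.or (.and (.eq (.idx 0) (.idx 22)) (.eq (.idx 1) (.idx 23)))
        (.and (.eq (.idx 0) (.idx 23)) (.eq (.idx 1) (.idx 22)))))))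
  obtain ⟨σ₀, hσ₀⟩ : ∃ a, a = (Stmt.fill mH (.lit 0)).run I e σ := ⟨_, rfl⟩
  have hmain : Inv ((Stmt.loop 22 (.loop 23 S)).run I e σ₀) ∧
      Grow σ₀ ((Stmt.loop 22 (.loop 23 S)).run I e σ₀) ∧
      ∀ x y, Q x y ((Stmt.loop 22 (.loop 23 S)).run I e σ₀) := by
    refine run_loop_forall Inv Grow (fun x a => ∀ y, Q x y a) hrefl htrans
      (fun x a b g1 g2 g3 y => hQ x y a b g1 g2 (g3 y)) ⟨⊥, ?_, bot_le, ?_, fun _ => rfl⟩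
      fun x a ha _ => ?_
    · intro x y
      simp [hσ₀, Stmt.run, Term.eval]
    · intro x y h
      exact absurd h (by simp)
    refine run_loop_forall Inv Grow (fun y a => Q x y a) hrefl htrans
      (fun y a b g1 g2 g3 => hQ x y a b g1 g2 g3) ha fun y a ha _ => ?_
    obtain ⟨H, hHa, h1, h2, h3⟩ := ha
    set e' := Function.update (Function.update e 22 x) 23 y with he'
    obtain ⟨a', ha'⟩ : ∃ b, b = refresh.run I e' a := ⟨_, rfl⟩
    have hk : ∀ k, k ≠ mDH → a' k = a k := fun k hk => by
      rw [ha', run_refresh hHa, Function.update_of_ne hk]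
    have hDH : a' mDH = hd H := by rw [ha', run_refresh hHa, Function.update_self]
    have hx : e' 22 = x := by simp [he']
    have hy : e' 23 = y := by simp [he']
    have hL : e' vL = e vL := by simp [he']
    have hrun : ∀ i j, S.run I e' a mH i j ≠ 0 ↔ (H.Adj i j ∨
        ((G.Adj x y ∧ 0 < (e vL : ℕ) ∧ (e vL : ℕ) < hd H x y) ∧
          (i = x ∧ j = y ∨ i = y ∧ j = x))) := by
      intro i j
      simp only [S]
      rw [Stmt.run, ← ha', Stmt.run, Function.update_self]
      change Holds _ _ _ _ ↔ _
      simp only [holds_or, holds_and, holds_graph, holds_entry, holds_lt, holds_eq, Term.eval, hDH,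
        hk mH (by decide), hHa _ _, hG _ _]
      simp [hx, hy, hL, Fin.ext_iff]
    by_cases hc : G.Adj x y ∧ 0 < (e vL : ℕ) ∧ (e vL : ℕ) < hd H x y
    · have hrep : Rep (S.run I e' a mH) (H ⊔ edge x y).Adj := by
        intro i j
        rw [hrun, sup_adj, edge_adj]
        have := hc.1.ne
        constructor
        · rintro (h | ⟨-, ⟨rfl, rfl⟩ | ⟨rfl, rfl⟩⟩)
          · exact Or.inl h
          · exact Or.inr ⟨Or.inl ⟨rfl, rfl⟩, this⟩
          · exact Or.inr ⟨Or.inr ⟨rfl, rfl⟩, this.symm⟩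
        · rintro (h | ⟨h, -⟩)
          · exact Or.inl h
          · exact Or.inr ⟨hc, h⟩
      refine ⟨⟨H ⊔ edge x y, hrep, sup_le h1 ?_, h2.sup_edge fun q => hc.2.2.trans_le (hd_le q),
        fun h0 => by omega⟩, hHa.grow hrep le_sup_left, ?_⟩
      · intro i j hij
        rw [edge_adj] at hij
        rcases hij with ⟨⟨rfl, rfl⟩ | ⟨rfl, rfl⟩, -⟩
        · exact hc.1
        · exact hc.1.symm
      · intro H' hH' g1 g2
        obtain rfl := hrep.graph_eq hH'
        refine (hd_le_one ?_).trans g1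
        rw [sup_adj, edge_adj]
        exact Or.inr ⟨Or.inl ⟨rfl, rfl⟩, g2.ne⟩
    · have hrep : Rep (S.run I e' a mH) H.Adj := by
        intro i j
        rw [hrun]
        simp [hc]
      refine ⟨⟨H, hrep, h1, h2, h3⟩, hHa.grow hrep le_rfl, fun H' hH' g1 g2 => ?_⟩
      obtain rfl := hrep.graph_eq hH'
      exact not_lt.1 fun h => hc ⟨g2, g1, h⟩
  have hgr : greedy.run I e σ = (Stmt.loop 22 (.loop 23 S)).run I e σ₀ := by
    rw [hσ₀]; rfl
  rw [hgr]
  obtain ⟨⟨H, g1, g2, g3, g4⟩, -, g5⟩ := hmain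
  exact ⟨H, g1, g2, g3, g4, fun h x y hxy => g5 x y H g1 h hxy⟩

end stages

end MatProg

namespace MatProg

open PairSpanner SimpleGraph

/-! ### The algorithm -/

section main

variable {n : ℕ} {I : Inst n} {σ : Mats n} {e : Env n} {G : SimpleGraph (Fin n)}
  {P : Finset (Fin n × Fin n)}

/-- The candidate for the parameters `h`, `τ` and `κ`. -/
def candidate : Stmt := .seq cluster (.seq lexDistances (.seq hitBoth (.seq
  (.fill mH (.entry mBase 0 1)) (.seq joinCenters (.seq joinPairs update)))))

theorem candidate_writes : mDG ∉ candidate.writes := by decide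

/-- The bound on the number `m` of edges of a candidate: `N` is the number of centers, `s` that of
the centers in the hitting sets, and `p` that of the pairs. -/
def CandidateBound (n p h τ κ m : ℕ) : Prop :=
  ∃ N s : ℕ, N * h ≤ n ∧ (s : ℝ) ≤ 2 * (1 + 3 * N / (τ + 1 : ℕ) * Real.log p) ∧
    m ≤ n + n * h + (κ * (N * N) + 9 * (s * N)) + 2 * τ * p

theorem CandidateBound.mono {n p h τ κ m m' : ℕ} (hb : CandidateBound n p h τ κ m) (hm : m' ≤ m) :
    CandidateBound n p h τ κ m' := by
  obtain ⟨N, s, h1, h2, h3⟩ := hb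
  exact ⟨N, s, h1, h2, hm.trans h3⟩

/-- The parameters are such that a pair whose walk is not bought entirely is either far apart, so
that `ε d ≥ 2`, or so close that shortest walks between centers are available. -/
def Suitable (n a b τ κ : ℕ) : Prop :=
  ∀ d < n, 2 * τ < d → 2 * b ≤ a * d ∨ d + 2 ≤ κ ∨ n ≤ κ + 1

theorem run_candidate (hG : Rep I.graph G.Adj) (hP : ∀ s t, I.pairs s t ≠ 0 ↔ (s, t) ∈ P)
    (hDG : σ mDG = hd G) {B : SimpleGraph (Fin n)} (hB : Rep (σ mBest) B.Adj) (hBG : B ≤ G)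
    (hBv : Valid I P G B) :
    ∃ B', Rep (candidate.run I e σ mBest) B'.Adj ∧ B' ≤ G ∧ Valid I P G B' ∧ ecard B' ≤ ecard B ∧
      (Suitable n I.numer I.denom (e vT) (e vK) →
        CandidateBound n P.card (e vH + 1) (e vT) (e vK) (ecard B')) := by
  classical
  obtain ⟨a₁, ha₁⟩ : ∃ a, a = cluster.run I e σ := ⟨_, rfl⟩
  obtain ⟨a₂, ha₂⟩ : ∃ a, a = lexDistances.run I e a₁ := ⟨_, rfl⟩
  obtain ⟨a₃, ha₃⟩ : ∃ a, a = hitBoth.run I e a₂ := ⟨_, rfl⟩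
  obtain ⟨a₄, ha₄⟩ : ∃ a, a = (Stmt.fill mH (.entry mBase 0 1)).run I e a₃ := ⟨_, rfl⟩
  obtain ⟨a₅, ha₅⟩ : ∃ a, a = joinCenters.run I e a₄ := ⟨_, rfl⟩
  obtain ⟨a₆, ha₆⟩ : ∃ a, a = joinPairs.run I e a₅ := ⟨_, rfl⟩
  have hrun : candidate.run I e σ = update.run I e a₆ := by
    rw [ha₆, ha₅, ha₄, ha₃, ha₂, ha₁]; rfl
  rw [hrun]
  have k₁ : ∀ k, k ∉ cluster.writes → a₁ k = σ k := fun k hk => ha₁ ▸ Stmt.run_of_notMem _ _ _ hk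
  obtain ⟨cl, H₀, hc, hcl, hH₀⟩ := run_cluster (I := I) (σ := σ) (e := e) hG
  rw [← ha₁] at hcl hH₀
  have hlex : a₂ = Function.update a₁ mLd (ld G H₀) := ha₂.trans (run_lexDistances hG hH₀)
  have k₂ : ∀ k, k ≠ mLd → a₂ k = a₁ k := fun k hk => by rw [hlex, Function.update_of_ne hk]
  have hs₂ : Setup I a₂ G H₀ cl :=
    ⟨hG, by rw [k₂ _ (by decide), k₁ _ (by rw [cluster_writes]; decide)]; exact hDG,
      by rw [k₂ _ (by decide)]; exact hH₀, by rw [k₂ _ (by decide)]; exact hcl,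
      by rw [hlex, Function.update_self]⟩
  have k₃ : ∀ k, k ∉ hitBoth.writes → a₃ k = a₂ k := fun k hk => ha₃ ▸ Stmt.run_of_notMem _ _ _ hk
  have hs₃ : Setup I a₃ G H₀ cl := hs₂.congr (k₃ _ (by rw [hitBoth_writes]; decide))
    (k₃ _ (by rw [hitBoth_writes]; decide)) (k₃ _ (by rw [hitBoth_writes]; decide))
    (k₃ _ (by rw [hitBoth_writes]; decide))
  obtain ⟨hhit, hcard₁, hcard₂⟩ := run_hitBoth (e := e) hs₂ hc hP
  rw [← ha₃] at hhit hcard₁ hcard₂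
  have k₄ : ∀ k, k ≠ mH → a₄ k = a₃ k := fun k hk => by
    rw [ha₄, Stmt.run, Function.update_of_ne hk]
  have hs₄ : Setup I a₄ G H₀ cl := hs₃.congr (k₄ _ (by decide)) (k₄ _ (by decide))
    (k₄ _ (by decide)) (k₄ _ (by decide))
  have hH₄ : Rep (a₄ mH) H₀.Adj := by
    intro x y
    rw [ha₄, Stmt.run, Function.update_self, Term.eval]
    simpa using hs₃.base x y
  obtain ⟨S₁, hS₁⟩ : ∃ S, S = diagSet (a₃ mS₁) := ⟨_, rfl⟩
  obtain ⟨S₂, hS₂⟩ : ∃ S, S = diagSet (a₃ mS₂) := ⟨_, rfl⟩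
  rw [← hS₁] at hhit hcard₁
  rw [← hS₂] at hhit hcard₂
  obtain ⟨H₁, hH₁, h01, h1G, hshort, hfar, hecard₁⟩ := run_joinCenters (e := e) hs₄ hc hH₄
    (S := S₁ ∪ S₂) (by rw [hS₁, hS₂, k₄ _ (by decide), k₄ _ (by decide)])
  rw [← ha₅] at hH₁
  have k₅ : ∀ k, k ∉ joinCenters.writes → a₅ k = a₄ k := fun k hk =>
    ha₅ ▸ Stmt.run_of_notMem _ _ _ hk
  have hs₅ : Setup I a₅ G H₀ cl := hs₄.congr (k₅ _ (by rw [joinCenters_writes]; decide))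
    (k₅ _ (by rw [joinCenters_writes]; decide)) (k₅ _ (by rw [joinCenters_writes]; decide))
    (k₅ _ (by rw [joinCenters_writes]; decide))
  obtain ⟨H, hH, hHG, hgood, hecard⟩ := run_joinPairs (e := e) hs₅ hH₁ h01 h1G hP
  rw [← ha₆] at hH
  have k₆ : ∀ k, k ∉ joinPairs.writes → a₆ k = a₅ k := fun k hk => ha₆ ▸ Stmt.run_of_notMem _ _ _ hk
  have hB₆ : Rep (a₆ mBest) B.Adj := by
    rw [k₆ _ (by rw [joinPairs_writes]; decide), k₅ _ (by rw [joinCenters_writes]; decide),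
      k₄ _ (by decide), k₃ _ (by rw [hitBoth_writes]; decide), k₂ _ (by decide),
      k₁ _ (by rw [cluster_writes]; decide)]
    exact hB
  have hDG₆ : a₆ mDG = hd G := (k₆ _ (by rw [joinPairs_writes]; decide)).trans hs₅.dist
  obtain ⟨B', hB', h1, h2, h3, h4⟩ := run_update (e := e) hDG₆ hH hHG hP hB₆ hBG hBv
  refine ⟨B', hB', h1, h2, h3, fun hsuit => ?_⟩
  have hvalid : Valid I P G H := by
    intro s t hst hr
    refine hgood s t hst ?_ hr
    -- if `κ` is maximal, then all distances between centers are preserved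
    refine hc.exists_detour (κ := if n ≤ (e vK : ℕ) + 1 then n + 2 else e vK) (S₁ := S₁) (S₂ := S₂)
      h01 hr (fun x hx y hy g1 g2 => ?_) hfar (fun hm => hhit s t hst hr hm) fun hm => ?_
    · refine hshort x hx y hy g1 ?_
      split_ifs at g2 <;> omega
    · obtain ⟨-, -, -, -, g, -⟩ := exists_min_walk (H₀ := H₀) hr
      rcases hsuit (hd G s t) hr (by omega) with g1 | g1 | g1
      · exact Or.inl g1
      · right; split_ifs <;> omega
      · right; rw [if_pos g1]; omega
  refine ⟨(centers cl).card, (S₁ ∪ S₂).card, hc.card_centers, ?_, ?_⟩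
  · have : ((S₁ ∪ S₂).card : ℝ) ≤ S₁.card + S₂.card := by exact_mod_cast Finset.card_union_le _ _
    linarith
  · have := hc.ecard_le
    have := h4 hvalid
    omega

/-- The whole algorithm: it computes all candidates, and keeps the best graph that serves all
pairs. -/
def algorithm : Stmt := .seq (hops mDG (.graph 2 1)) (.seq (.fill mBest (.graph 0 1)) (.seq
  (.loop vL (.seq greedy update)) (.seq (.loop vH (.loop vT (.loop vK candidate)))
  (.fill mBest (.bool (.entry mBest 0 1))))))

open Classical in
theorem run_algorithm (hG : Rep I.graph G.Adj) (hP : ∀ s t, I.pairs s t ≠ 0 ↔ (s, t) ∈ P) :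
    ∃ B, (∀ i j, algorithm.run I e σ mBest i j = if B.Adj i j then 1 else 0) ∧ B ≤ G ∧
      Valid I P G B ∧ ecard B ≤ ecard G ∧
      (∀ L : Fin n, ∃ H ≤ G, NoShortCycle H L ∧ ((L : ℕ) = 0 → H = ⊥) ∧
        (0 < (L : ℕ) → ∀ x y, G.Adj x y → hd H x y ≤ L) ∧ (Valid I P G H → ecard B ≤ ecard H)) ∧
      ∀ h τ κ : Fin n, Suitable n I.numer I.denom τ κ →
        CandidateBound n P.card (h + 1) τ κ (ecard B) := by
  let Le : ℕ → Mats n → Prop := fun m a => ∃ B, Rep (a mBest) B.Adj ∧ ecard B ≤ m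
  let Inv : Mats n → Prop := fun a => a mDG = hd G ∧ ∃ B, Rep (a mBest) B.Adj ∧ B ≤ G ∧
    Valid I P G B
  let R : Mats n → Mats n → Prop := fun a b => ∀ m, Le m a → Le m b
  have hrefl : ∀ a, R a a := fun a m h => h
  have htrans : ∀ a b c, R a b → R b c → R a c := fun a b c h1 h2 m h => h2 m (h1 m h)
  have hR : ∀ {a b : Mats n} {B B' : SimpleGraph (Fin n)}, Rep (a mBest) B.Adj →
      Rep (b mBest) B'.Adj → ecard B' ≤ ecard B → R a b := by
    rintro a b B B' h1 h2 h3 m ⟨B'', h4, h5⟩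
    obtain rfl := h1.graph_eq h4
    exact ⟨B', h2, h3.trans h5⟩
  obtain ⟨a₁, ha₁⟩ : ∃ a, a = (hops mDG (.graph 2 1)).run I e σ := ⟨_, rfl⟩
  obtain ⟨a₂, ha₂⟩ : ∃ a, a = (Stmt.fill mBest (.graph 0 1)).run I e a₁ := ⟨_, rfl⟩
  obtain ⟨a₃, ha₃⟩ : ∃ a, a = (Stmt.loop vL (.seq greedy update)).run I e a₂ := ⟨_, rfl⟩
  obtain ⟨a₄, ha₄⟩ : ∃ a, a = (Stmt.loop vH (.loop vT (.loop vK candidate))).run I e a₃ := ⟨_, rfl⟩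
  have hrun : algorithm.run I e σ = (Stmt.fill mBest (.bool (.entry mBest 0 1))).run I e a₄ := by
    rw [ha₄, ha₃, ha₂, ha₁]; rfl
  have hdist : a₁ mDG = hd G := by
    have := run_hops (I := I) (σ := σ) (e := e) (D := mDG) (adj := .graph 2 1) (E := G)
      fun M e => hG _ _
    rw [ha₁, this, Function.update_self]
  have hrep₂ : Rep (a₂ mBest) G.Adj := by
    intro x y
    rw [ha₂, Stmt.run, Function.update_self]
    simpa [Term.eval] using hG x y
  have hinv₂ : Inv a₂ := ⟨by rw [ha₂, Stmt.run, Function.update_of_ne (by decide)]; exact hdist,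
    G, hrep₂, le_rfl, fun _ _ _ => good_self⟩
  let Q₁ : Fin n → Mats n → Prop := fun L a => ∃ H ≤ G, NoShortCycle H L ∧ ((L : ℕ) = 0 → H = ⊥) ∧
        (0 < (L : ℕ) → ∀ x y, G.Adj x y → hd H x y ≤ L) ∧ (Valid I P G H → Le (ecard H) a)
  have h₃ : Inv a₃ ∧ R a₂ a₃ ∧ ∀ L, Q₁ L a₃ := by
    rw [ha₃]
    refine run_loop_forall Inv R Q₁ hrefl htrans ?_ hinv₂ fun L a ha _ => ?_
    · rintro L a b - hab ⟨H, h1, h2, h3, h4, h5⟩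
      exact ⟨H, h1, h2, h3, h4, fun hv => hab _ (h5 hv)⟩
    · obtain ⟨g1, B, g2, g3, g4⟩ := ha
      have hL : Function.update e vL L vL = L := Function.update_self _ _ _
      obtain ⟨H, h1, h2, h3, h4, h5⟩ :=
        run_greedy (I := I) (σ := a) (e := Function.update e vL L) hG
      rw [hL] at h3 h4 h5
      have hk : ∀ k, k ∉ greedy.writes → greedy.run I (Function.update e vL L) a k = a k :=
        fun k hk => Stmt.run_of_notMem _ _ _ hk
      obtain ⟨B', f1, f2, f3, f4, f5⟩ := run_update (e := Function.update e vL L)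
        ((hk mDG (by rw [greedy_writes]; decide)).trans g1) h1 h2 hP (B := B)
        (by rw [hk mBest (by rw [greedy_writes]; decide)]; exact g2) g3 g4
      refine ⟨⟨?_, B', f1, f2, f3⟩, hR g2 f1 f4, H, h2, h3, h4, h5, fun hv => ⟨B', f1, f5 hv⟩⟩
      rw [← g1]
      exact Stmt.run_of_notMem (.seq greedy update) _ _ (by decide)
  let Q₂ : Fin n → Fin n → Fin n → Mats n → Prop := fun h τ κ a => Suitable n I.numer I.denom τ κ →
    ∃ m, Le m a ∧ CandidateBound n P.card (h + 1) τ κ m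
  have hQ₂ : ∀ h τ κ a b, R a b → Q₂ h τ κ a → Q₂ h τ κ b := by
    intro h τ κ a b hab hq hs
    obtain ⟨m, h1, h2⟩ := hq hs
    exact ⟨m, hab m h1, h2⟩
  have h₄ : Inv a₄ ∧ R a₃ a₄ ∧ ∀ h τ κ, Q₂ h τ κ a₄ := by
    rw [ha₄]
    refine run_loop_forall Inv R (fun h a => ∀ τ κ, Q₂ h τ κ a) hrefl htrans
      (fun h a b _ hab hq τ κ => hQ₂ h τ κ a b hab (hq τ κ)) h₃.1 fun h a ha _ => ?_
    refine run_loop_forall Inv R (fun τ a => ∀ κ, Q₂ h τ κ a) hrefl htrans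
      (fun τ a b _ hab hq κ => hQ₂ h τ κ a b hab (hq κ)) ha fun τ a ha _ => ?_
    refine run_loop_forall Inv R (fun κ a => Q₂ h τ κ a) hrefl htrans
      (fun κ a b _ hab hq => hQ₂ h τ κ a b hab hq) ha fun κ a ha _ => ?_
    set e' := Function.update (Function.update (Function.update e vH h) vT τ) vK κ with he'
    have x1 : e' vH = h := by simp [he']
    have x2 : e' vT = τ := by simp [he']
    have x3 : e' vK = κ := by simp [he']
    obtain ⟨g1, B, g2, g3, g4⟩ := ha
    obtain ⟨B', f1, f2, f3, f4, f5⟩ := run_candidate (e := e') hG hP g1 g2 g3 g4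
    rw [x1, x2, x3] at f5
    refine ⟨⟨?_, B', f1, f2, f3⟩, hR g2 f1 f4, fun hs => ⟨_, ⟨B', f1, le_rfl⟩, f5 hs⟩⟩
    rw [← g1]
    exact Stmt.run_of_notMem candidate _ _ candidate_writes
  obtain ⟨⟨-, B, hB, hBG, hBv⟩, hR₄, hQ₄⟩ := h₄
  have hLe : ∀ m, Le m a₄ → ecard B ≤ m := by
    rintro m ⟨B', h1, h2⟩
    obtain rfl := hB.graph_eq h1
    exact h2
  refine ⟨B, fun i j => ?_, hBG, hBv, hLe _ (hR₄ _ (h₃.2.1 _ ⟨G, hrep₂, le_rfl⟩)), fun L => ?_,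
    fun h τ κ hs => ?_⟩
  · rw [hrun, Stmt.run, Function.update_self, eval_bool]
    refine if_congr ?_ rfl rfl
    rw [holds_entry, hB]
    simp
  · obtain ⟨H, h1, h2, h3, h4, h5⟩ := h₃.2.2 L
    exact ⟨H, h1, h2, h3, h4, fun hv => hLe _ (hR₄ _ (h5 hv))⟩
  · obtain ⟨m, h1, h2⟩ := hQ₄ h τ κ hs
    exact h2.mono (hLe m h1)

end main

end MatProg

namespace MatProg

open PairSpanner SimpleGraph

/-! ### The number of edges -/

section bounds

variable {n : ℕ} {I : Inst n} {G : SimpleGraph (Fin n)} {P : Finset (Fin n × Fin n)}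

theorem reachable_of_hd_le {H : SimpleGraph (Fin n)} {L : ℕ} (hL : L < n)
    (h : ∀ x y, G.Adj x y → hd H x y ≤ L) {s t : Fin n} (hst : G.Reachable s t) :
    H.Reachable s t := by
  obtain ⟨p⟩ := hst
  induction p with
  | nil => exact Reachable.refl _
  | cons hxy _ ih => exact (hd_lt_iff.1 ((h _ _ hxy).trans_lt hL)).trans ih

theorem valid_of_stretch {H : SimpleGraph (Fin n)} {L : ℕ} (hL : L < n)
    (h : ∀ x y, G.Adj x y → hd H x y ≤ L) (hLb : I.denom * L ≤ I.numer + I.denom) :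
    Valid I P G H := by
  intro s t _ hr
  refine ⟨hd_lt_iff.2 (reachable_of_hd_le hL h (hd_lt_iff.1 hr)), ?_⟩
  have h1 := Nat.mul_le_mul_left I.denom (hd_le_mul_hd h hr)
  have h2 := Nat.mul_le_mul_right (hd G s t) hLb
  rw [← mul_assoc] at h1
  omega

/-- The greedy spanner has girth at least about `ε`, hence at most about `n ^ (1 + 4 / ε)`
edges. -/
theorem exists_greedy_le {ε : ℝ} {m : ℕ} (hn : 2 ≤ n) (hε : 0 < ε) (hb : 0 < I.denom)
    (hab : ε ≤ 2 * ((I.numer : ℝ) / I.denom))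
    (hm : ∀ L : Fin n, ∃ H ≤ G, NoShortCycle H L ∧ ((L : ℕ) = 0 → H = ⊥) ∧
      (0 < (L : ℕ) → ∀ x y, G.Adj x y → hd H x y ≤ L) ∧ (Valid I P G H → m ≤ ecard H)) :
    (m : ℝ) ≤ n * (Real.exp (4 * Real.log n / ε) + 3) := by
  set a := I.numer
  set b := I.denom
  set ℓ := Real.log n
  have hn' : (2 : ℝ) ≤ n := by exact_mod_cast hn
  have hℓ : 0 ≤ ℓ := Real.log_natCast_nonneg n
  have hdiv : 1 ≤ (a + b) / b := (Nat.one_le_div_iff hb).2 (by omega)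
  obtain ⟨L, hL⟩ : ∃ L, L = min ((a + b) / b) (n - 1) := ⟨_, rfl⟩
  have hLn : L < n := by omega
  have hL1 : 1 ≤ L := by omega
  obtain ⟨H, -, h2, -, h4, h5⟩ := hm ⟨L, hLn⟩
  simp only at h2 h4 h5
  have hLb : b * L ≤ a + b :=
    (Nat.mul_le_mul_left b (by omega : L ≤ (a + b) / b)).trans (Nat.mul_div_le _ _)
  have hmH := h5 (valid_of_stretch hLn (h4 hL1) hLb)
  obtain ⟨k, hk⟩ : ∃ k, k = (L + 1) / 2 := ⟨_, rfl⟩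
  obtain ⟨d, hd⟩ : ∃ d, d = ⌊Real.exp (4 * ℓ / ε)⌋₊ + 3 := ⟨_, rfl⟩
  have hd1 : Real.exp (4 * ℓ / ε) < d := by
    rw [hd]; push_cast
    have := Nat.lt_floor_add_one (Real.exp (4 * ℓ / ε))
    linarith
  have hd2 : (d : ℝ) ≤ Real.exp (4 * ℓ / ε) + 3 := by
    rw [hd]; push_cast
    have := Nat.floor_le (Real.exp_pos (4 * ℓ / ε)).le
    linarith
  have hd4 : 4 ≤ d := by
    have : 1 ≤ ⌊Real.exp (4 * ℓ / ε)⌋₊ :=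
      Nat.le_floor (by simpa using Real.one_le_exp (by positivity))
    omega
  have hpow : n < d ^ k := by
    rcases Nat.lt_or_ge ((a + b) / b) n with hc | hc
    · -- here `L + 1 > 1 + a / b`, so that `k ≥ ε / 4`
      have hLeq : L = (a + b) / b := by omega
      have h1 : a + b < b * (L + 1) := by
        rw [hLeq]; exact Nat.lt_mul_div_succ _ hb
      have h2 : (a : ℝ) / b < L := by
        rw [div_lt_iff₀ (by exact_mod_cast hb)]
        have : ((a + b : ℕ) : ℝ) < ((b * (L + 1) : ℕ) : ℝ) := by exact_mod_cast h1
        push_cast at this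
        linarith
      have h3 : (L : ℝ) ≤ 2 * k := by
        have : L ≤ 2 * k := by omega
        exact_mod_cast this
      have hk0 : 0 < k := by omega
      have h4 : ℓ ≤ k * (4 * ℓ / ε) := by
        rw [mul_div_assoc', le_div_iff₀ hε]
        nlinarith
      have h5 : (n : ℝ) < (d : ℝ) ^ k := by
        calc (n : ℝ) = Real.exp ℓ := (Real.exp_log (by linarith)).symm
          _ ≤ Real.exp (k * (4 * ℓ / ε)) := Real.exp_le_exp.2 h4
          _ = Real.exp (4 * ℓ / ε) ^ k := Real.exp_nat_mul _ _
          _ < (d : ℝ) ^ k := pow_lt_pow_left₀ hd1 (Real.exp_pos _).le hk0.ne'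
      exact_mod_cast h5
    · have h1 : n < 2 * k + 2 := by omega
      have h2 : k < 2 ^ k := Nat.lt_two_pow_self
      have h3 : 2 ≤ 2 ^ k := by
        calc 2 = 2 ^ 1 := rfl
          _ ≤ 2 ^ k := Nat.pow_le_pow_right (by omega) (by omega)
      have h4 : (4 : ℕ) ^ k = 2 ^ k * 2 ^ k := by rw [← mul_pow]; norm_num
      have h5 : 4 ^ k ≤ d ^ k := Nat.pow_le_pow_left hd4 k
      nlinarith
  have := h2.ecard_le (k := k) (d := d) (by omega) hpow
  calc (m : ℝ) ≤ ((n * d : ℕ) : ℝ) := by exact_mod_cast hmH.trans this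
    _ = n * d := by push_cast; ring
    _ ≤ n * (Real.exp (4 * ℓ / ε) + 3) := by gcongr

/-- The estimate for the number of edges of a candidate, for parameters with `h ≈ p ^ (1 / 4) x`,
where `x ^ 2 = log n / ε`, with `τ ≈ n h / p` or `τ` maximal, and with `κ = 0` or both `κ` and
`τ` at most about `1 / ε`. -/
theorem CandidateBound.le {n p h τ κ m : ℕ} (hb : CandidateBound n p h τ κ m) {q x ε : ℝ}
    (hq : 1 ≤ q) (hx : 1 ≤ x) (hε : 0 < ε) (hp : (p : ℝ) = q ^ 4) (hlog : Real.log p ≤ 16 * x ^ 2)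
    (hxε : 1 / 2 ≤ x ^ 2 * ε) (h1 : q * x ≤ h) (h2 : (h : ℝ) ≤ 2 * (q * x))
    (hτ : (τ : ℝ) * p ≤ n * h) (hτ' : (n : ℝ) * h ≤ (τ + 1) * p ∨ (n : ℝ) ≤ τ + 1)
    (hκ : κ = 0 ∨ (κ : ℝ) * ε ≤ 16 ∧ (n : ℝ) * h * ε ≤ 4 * p) :
    (m : ℝ) ≤ 1400 * (n + n * (q * x)) := by
  obtain ⟨N, s, hN, hs, hm⟩ := hb
  have hn0 : (0 : ℝ) ≤ n := n.cast_nonneg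
  have hN0 : (0 : ℝ) ≤ N := N.cast_nonneg
  have hκ0 : (0 : ℝ) ≤ κ := κ.cast_nonneg
  have hτ0 : (0 : ℝ) < (τ : ℝ) + 1 := by positivity
  have hq0 : 0 < q := by linarith
  have hx0 : 0 < x := by linarith
  have hqx : 1 ≤ q * x := one_le_mul_of_one_le_of_one_le hq hx
  have hh0 : (0 : ℝ) < h := by linarith
  have hNh : (N : ℝ) * h ≤ n := by exact_mod_cast hN
  have hNn : (N : ℝ) ≤ n := by nlinarith
  have hNN : (N : ℝ) ^ 2 * h ^ 2 ≤ n ^ 2 := by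
    rw [← mul_pow]; exact pow_le_pow_left₀ (by positivity) hNh 2
  have hm' : (m : ℝ) ≤ n + n * h + (κ * (N * N) + 9 * (s * N)) + 2 * τ * p := by exact_mod_cast hm
  have hhit : (N : ℝ) ^ 2 * x ^ 2 ≤ (n + n * (q * x)) * (τ + 1) := by
    have hqxh : (q * x) ^ 2 ≤ (h : ℝ) ^ 2 := pow_le_pow_left₀ (by positivity) h1 2
    have h3 : (N : ℝ) ^ 2 * (q * x) ^ 2 ≤ n ^ 2 :=
      (mul_le_mul_of_nonneg_left hqxh (by positivity)).trans hNN
    rcases hτ' with hτ' | hτ'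
    · have h4 : (N : ℝ) ^ 2 * x ^ 2 * p ≤ n * (q * x) * (τ + 1) * p := by
        calc (N : ℝ) ^ 2 * x ^ 2 * p = N ^ 2 * (q * x) ^ 2 * q ^ 2 := by rw [hp]; ring
          _ ≤ n ^ 2 * q ^ 2 := by gcongr
          _ ≤ n ^ 2 * (q * x * h) := by
              refine mul_le_mul_of_nonneg_left ?_ (by positivity)
              have : q ≤ h := by nlinarith
              have : q * 1 ≤ q * x := by gcongr
              nlinarith
          _ = n * (q * x) * (n * h) := by ring
          _ ≤ n * (q * x) * ((τ + 1) * p) := by gcongr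
          _ = n * (q * x) * (τ + 1) * p := by ring
      have hp0 : (0 : ℝ) < p := by rw [hp]; positivity
      have h5 := le_of_mul_le_mul_right h4 hp0
      rw [add_mul]
      linarith [mul_nonneg hn0 hτ0.le]
    · have h4 : (N : ℝ) ^ 2 * x ^ 2 ≤ N ^ 2 * (q * x) ^ 2 := by
        have : x ≤ q * x := le_mul_of_one_le_left hx0.le hq
        gcongr
      have h5 : (n : ℝ) ^ 2 ≤ n * (τ + 1) := by rw [sq]; gcongr
      have : 0 ≤ (n : ℝ) * (q * x) * (τ + 1) := by positivity
      rw [add_mul]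
      linarith
  have hsN : (s : ℝ) * N ≤ 2 * n + 96 * (n + n * (q * x)) := by
    have hpos : 0 ≤ Real.log p := Real.log_natCast_nonneg p
    calc (s : ℝ) * N ≤ 2 * (1 + 3 * N / (τ + 1 : ℕ) * Real.log p) * N := by gcongr
      _ = 2 * N + 6 * (N ^ 2 * Real.log p / (τ + 1)) := by push_cast; field_simp; ring
      _ ≤ 2 * n + 6 * (16 * (n + n * (q * x))) := by
          have : (N : ℝ) ^ 2 * Real.log p / (τ + 1) ≤ 16 * (n + n * (q * x)) := by
            rw [div_le_iff₀ hτ0]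
            calc (N : ℝ) ^ 2 * Real.log p ≤ N ^ 2 * (16 * x ^ 2) := by gcongr
              _ = 16 * (N ^ 2 * x ^ 2) := by ring
              _ ≤ 16 * ((n + n * (q * x)) * (τ + 1)) := by gcongr
              _ = _ := by ring
          linarith
      _ = _ := by ring
  have hκN : (κ : ℝ) * (N * N) ≤ 256 * (n * h) := by
    rcases hκ with rfl | ⟨hκ1, hκ2⟩
    · simp only [Nat.cast_zero, zero_mul]; positivity
    · have hqxh : (q * x) ^ 4 ≤ (h : ℝ) ^ 4 := pow_le_pow_left₀ (by positivity) h1 4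
      have hxε2 : 1 / 4 ≤ x ^ 4 * ε ^ 2 := by
        calc (1 : ℝ) / 4 = (1 / 2) ^ 2 := by norm_num
          _ ≤ (x ^ 2 * ε) ^ 2 := pow_le_pow_left₀ (by norm_num) hxε 2
          _ = _ := by ring
      have g1 : (n : ℝ) * h * ε ≤ 16 * h ^ 4 * ε ^ 2 := by
        calc (n : ℝ) * h * ε ≤ 4 * p := hκ2
          _ = 16 * q ^ 4 * (1 / 4) := by rw [hp]; ring
          _ ≤ 16 * q ^ 4 * (x ^ 4 * ε ^ 2) := by gcongr
          _ = 16 * (q * x) ^ 4 * ε ^ 2 := by ring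
          _ ≤ _ := by gcongr
      have g2 : (n : ℝ) ≤ 16 * h ^ 3 * ε := by
        refine le_of_mul_le_mul_right ?_ (mul_pos hh0 hε)
        calc (n : ℝ) * (h * ε) = n * h * ε := by ring
          _ ≤ _ := g1
          _ = _ := by ring
      have g3 : (N : ℝ) ^ 2 ≤ 16 * (n * h * ε) := by
        refine le_of_mul_le_mul_right (hNN.trans ?_) (pow_pos hh0 2)
        calc (n : ℝ) ^ 2 = n * n := sq _
          _ ≤ n * (16 * h ^ 3 * ε) := by gcongr
          _ = _ := by ring
      refine le_of_mul_le_mul_right ?_ hε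
      calc (κ : ℝ) * (N * N) * ε = κ * ε * N ^ 2 := by ring
        _ ≤ 16 * (16 * (n * h * ε)) := by gcongr
        _ = _ := by ring
  have hnh : (n : ℝ) * h ≤ n * (2 * (q * x)) := by gcongr
  have : 0 ≤ (n : ℝ) * (q * x) := by positivity
  linarith

theorem ecard_le_sq (G : SimpleGraph (Fin n)) : ecard G ≤ n * n := by
  have := ecard_le_of_subset_image (H := G) Finset.univ (fun u v _ => Or.inl (Finset.mem_univ _))
  simpa using this

/-- Suitable parameters exist. -/
theorem exists_parameters {a b p h : ℕ} {ε : ℝ} (hn : 2 ≤ n) (hp : 0 < p) (hε : 0 < ε) (ha : 0 < a)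
    (hb : 0 < b) (hab : ε ≤ 2 * ((a : ℝ) / b)) :
    ∃ τ κ : Fin n, Suitable n a b τ κ ∧ ((τ : ℕ) : ℝ) * p ≤ n * h ∧
      ((n : ℝ) * h ≤ ((τ : ℕ) + 1) * p ∨ (n : ℝ) ≤ (τ : ℕ) + 1) ∧
      ((κ : ℕ) = 0 ∨ ((κ : ℕ) : ℝ) * ε ≤ 16 ∧ (n : ℝ) * h * ε ≤ 4 * p) := by
  obtain ⟨τ, hτ⟩ : ∃ τ, τ = min (n * h / p) (n - 1) := ⟨_, rfl⟩
  have hτn : τ < n := by omega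
  have h1 : τ * p ≤ n * h :=
    (Nat.mul_le_mul_right p (by omega : τ ≤ n * h / p)).trans (Nat.div_mul_le_self _ _)
  have h2 : τ ≠ n - 1 → n * h < (τ + 1) * p := by
    intro hne
    have : τ = n * h / p := by omega
    rw [this, mul_comm (_ + 1)]
    exact Nat.lt_mul_div_succ _ hp
  have h1' : (τ : ℝ) * p ≤ n * h := by exact_mod_cast h1
  have h2' : (n : ℝ) * h ≤ (τ + 1) * p ∨ (n : ℝ) ≤ τ + 1 := by
    by_cases hne : τ = n - 1
    · right
      have : n = τ + 1 := by omega
      exact_mod_cast this.le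
    · left
      exact_mod_cast (h2 hne).le
  by_cases hc : 2 * b ≤ a * (2 * τ + 1) ∨ τ = n - 1
  · refine ⟨⟨τ, hτn⟩, ⟨0, by omega⟩, ?_, h1', h2', Or.inl rfl⟩
    intro d hd hd'
    simp only at hd'
    rcases hc with hc | hc
    · exact Or.inl (hc.trans (Nat.mul_le_mul_left _ (by omega)))
    · omega
  · rw [not_or, not_le] at hc
    obtain ⟨κ, hκ⟩ : ∃ κ, κ = min (2 * b / a + 3) (n - 1) := ⟨_, rfl⟩
    refine ⟨⟨τ, hτn⟩, ⟨κ, by omega⟩, ?_, h1', h2', Or.inr ?_⟩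
    · intro d hd hd'
      simp only
      by_cases hd2 : 2 * b ≤ a * d
      · exact Or.inl hd2
      · have : d ≤ 2 * b / a := (Nat.le_div_iff_mul_le ha).2 (by rw [mul_comm]; omega)
        omega
    · have ha' : (0 : ℝ) < a := by exact_mod_cast ha
      have hb' : (0 : ℝ) < b := by exact_mod_cast hb
      have hε' : ε * b ≤ 2 * a := by
        rw [mul_div_assoc', le_div_iff₀ hb'] at hab
        exact hab
      have g1 : (a : ℝ) * (2 * τ + 1) < 2 * b := by exact_mod_cast hc.1
      have g2 : ε * (2 * τ + 1) < 4 := by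
        have : (ε * (2 * τ + 1)) * (a * b) < 4 * (a * b) := by
          calc (ε * (2 * τ + 1)) * (a * b) = (ε * b) * (a * (2 * τ + 1)) := by ring
            _ ≤ (2 * a) * (a * (2 * τ + 1)) := by gcongr
            _ < (2 * a) * (2 * b) := by gcongr
            _ = _ := by ring
        exact lt_of_mul_lt_mul_right this (by positivity)
      have hε4 : ε < 4 := by nlinarith [mul_nonneg hε.le (Nat.cast_nonneg (α := ℝ) τ)]
      constructor
      · have g3 : (κ : ℝ) ≤ 2 * b / a + 3 := by
          have : κ ≤ 2 * b / a + 3 := by omega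
          have h3 : ((2 * b / a : ℕ) : ℝ) ≤ ((2 * b : ℕ) : ℝ) / a := Nat.cast_div_le
          have h4 : (κ : ℝ) ≤ ((2 * b / a : ℕ) : ℝ) + 3 := by exact_mod_cast this
          push_cast at h3
          linarith
        have g4 : 2 * (b : ℝ) / a * ε ≤ 4 := by
          rw [div_mul_eq_mul_div, div_le_iff₀ ha']
          linarith
        calc (κ : ℝ) * ε ≤ (2 * b / a + 3) * ε := by gcongr
          _ = 2 * b / a * ε + 3 * ε := by ring
          _ ≤ 16 := by linarith
      · have g3 : (n : ℝ) * h ≤ (τ + 1) * p := by exact_mod_cast (h2 hc.2).le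
        calc (n : ℝ) * h * ε ≤ (τ + 1) * p * ε := by gcongr
          _ = (ε * (2 * τ + 1) + ε) / 2 * p := by ring
          _ ≤ 4 * p := by gcongr; linarith

theorem ecard_le_spannerBound {ε : ℝ} {m : ℕ} (hn : 2 ≤ n) (hP : P.Nonempty) (hε : 0 < ε)
    (ha : 0 < I.numer) (hb : 0 < I.denom) (hab : ε ≤ 2 * ((I.numer : ℝ) / I.denom))
    (hmG : m ≤ ecard G)
    (hm : ∀ L : Fin n, ∃ H ≤ G, NoShortCycle H L ∧ ((L : ℕ) = 0 → H = ⊥) ∧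
      (0 < (L : ℕ) → ∀ x y, G.Adj x y → hd H x y ≤ L) ∧ (Valid I P G H → m ≤ ecard H))
    (hm' : ∀ h τ κ : Fin n, Suitable n I.numer I.denom τ κ →
      CandidateBound n P.card (h + 1) τ κ m) :
    (m : ℝ) ≤ 1400 * (n + spannerBound n P.card ε) := by
  have hn' : (2 : ℝ) ≤ n := by exact_mod_cast hn
  have hp : 0 < P.card := hP.card_pos
  have hp' : (1 : ℝ) ≤ P.card := by exact_mod_cast hp
  obtain ⟨ℓ, hℓ⟩ : ∃ ℓ, ℓ = Real.log n := ⟨_, rfl⟩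
  have hℓ2 : 1 / 2 ≤ ℓ := by
    have h1 : Real.log 2 ≤ Real.log n := Real.log_le_log (by norm_num) hn'
    have h2 := Real.log_two_gt_d9
    rw [hℓ]; linarith
  obtain ⟨q, hq⟩ : ∃ q, q = (P.card : ℝ) ^ (1 / 4 : ℝ) := ⟨_, rfl⟩
  obtain ⟨x, hx⟩ : ∃ x, x = √(ℓ / ε) := ⟨_, rfl⟩
  have hq1 : 1 ≤ q := by rw [hq]; exact Real.one_le_rpow hp' (by norm_num)
  have hq4 : (P.card : ℝ) = q ^ 4 := by
    rw [hq, ← Real.rpow_natCast, ← Real.rpow_mul (by linarith)]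
    norm_num
  have hx0 : 0 ≤ x := by rw [hx]; exact Real.sqrt_nonneg _
  have hx2 : x ^ 2 = ℓ / ε := by rw [hx]; exact Real.sq_sqrt (by positivity)
  have hbound : spannerBound n P.card ε = n * (q * x) := by
    rw [spannerBound, ← hq, ← hℓ, ← hx, mul_assoc]
  rw [hbound]
  have hgreedy := exists_greedy_le hn hε hb hab hm
  rw [← hℓ] at hgreedy
  have hqx0 : 0 ≤ (n : ℝ) * (q * x) := by positivity
  by_cases hc1 : ℓ ≤ ε
  · have h1 : Real.exp (4 * ℓ / ε) ≤ 81 := by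
      calc Real.exp (4 * ℓ / ε) ≤ Real.exp ((4 : ℕ) * 1) := by
            refine Real.exp_le_exp.2 ?_
            rw [div_le_iff₀ hε]; push_cast; linarith
        _ = Real.exp 1 ^ 4 := Real.exp_nat_mul _ _
        _ ≤ 3 ^ 4 := pow_le_pow_left₀ (Real.exp_pos _).le
            (by have := Real.exp_one_lt_d9; linarith) 4
        _ = 81 := by norm_num
    have : (n : ℝ) * (Real.exp (4 * ℓ / ε) + 3) ≤ n * 84 := by gcongr; linarith
    linarith
  rw [not_le] at hc1
  have hx1 : 1 ≤ x := by
    rw [hx]; exact Real.one_le_sqrt.2 ((one_le_div hε).2 hc1.le)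
  have hqx1 : 1 ≤ q * x := one_le_mul_of_one_le_of_one_le hq1 hx1
  by_cases hc2 : 16 * ℓ / ε ≤ Real.log P.card
  · -- then `n ^ (4 / ε) ≤ |P| ^ (1 / 4)`
    have h1 : Real.exp (4 * ℓ / ε) ≤ q := by
      rw [hq, Real.rpow_def_of_pos (by linarith)]
      refine Real.exp_le_exp.2 ?_
      have : 4 * ℓ / ε = 16 * ℓ / ε * (1 / 4) := by ring
      rw [this]; gcongr
    have h2 : q ≤ q * x := le_mul_of_one_le_right (by linarith) hx1
    have : (n : ℝ) * (Real.exp (4 * ℓ / ε) + 3) ≤ n * (q * x + 3) := by gcongr; linarith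
    nlinarith
  rw [not_le] at hc2
  obtain ⟨h, hh⟩ : ∃ h, h = ⌈q * x⌉₊ := ⟨_, rfl⟩
  have hh1 : q * x ≤ h := by rw [hh]; exact Nat.le_ceil _
  have hh2 : (h : ℝ) < q * x + 1 := by rw [hh]; exact Nat.ceil_lt_add_one (by linarith)
  by_cases hhn : h ≤ n
  · have hh0 : 0 < h := by rw [hh]; exact Nat.ceil_pos.2 (by linarith)
    obtain ⟨τ, κ, g1, g2, g3, g4⟩ := exists_parameters (n := n) (h := h) hn hp hε ha hb hab
    have hcb := hm' ⟨h - 1, by omega⟩ τ κ g1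
    rw [show ((⟨h - 1, by omega⟩ : Fin n) : ℕ) + 1 = h by simp only; omega] at hcb
    exact hcb.le hq1 hx1 hε hq4 (by rw [hx2]; rw [mul_div_assoc] at hc2; exact hc2.le)
      (by rw [hx2, div_mul_cancel₀ _ hε.ne']; exact hℓ2) hh1 (by linarith) g2 g3 g4
  · -- the bound exceeds the square of `n`
    have h1 : (n : ℝ) + 1 ≤ h := by exact_mod_cast not_le.1 hhn
    have h2 : (m : ℝ) ≤ n * n := by exact_mod_cast hmG.trans (ecard_le_sq G)
    have h3 : (n : ℝ) * n ≤ n * (q * x) := by gcongr; linarith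
    linarith

end bounds

end MatProg

/-! ### The theorem -/

namespace MatProg

open PairSpanner SimpleGraph

section result

variable {n : ℕ}

open Classical in
/-- The matrix of zeros and ones of a relation. -/
noncomputable def indicatorMatrix (r : Fin n → Fin n → Prop) (u v : Fin n) : ℕ :=
  if r u v then 1 else 0

theorem indicatorMatrix_ne_zero {r : Fin n → Fin n → Prop} {u v : Fin n} :
    indicatorMatrix r u v ≠ 0 ↔ r u v := by
  simp [indicatorMatrix]

/-- The data of a matrix program that represent an input. -/
noncomputable def inputInst (G : SimpleGraph (Fin n)) (P : Finset (Fin n × Fin n)) (a b : ℕ) :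
    Inst n where
  graph := indicatorMatrix G.Adj
  pairs := indicatorMatrix fun u v => (u, v) ∈ P
  numer := a
  denom := b

theorem encode_inputInst (G : SimpleGraph (Fin n)) (P : Finset (Fin n × Fin n)) (a b : ℕ) :
    (inputInst G P a b).encode = encodeInput G P a b := rfl

theorem length_encodeGraph (H : SimpleGraph (Fin n)) : (encodeGraph H).length = n * n :=
  List.length_ofFn

open Classical in
theorem getD_encodeGraph (H : SimpleGraph (Fin n)) (i j : Fin n) :
    (encodeGraph H).getD (i * n + j) 0 = if H.Adj i j then 1 else 0 := by
  have hlt := offset_lt i j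
  obtain ⟨h1, h2⟩ := divNat_modNat_offset i j
  rw [List.getD_eq_getElem _ _ (by rw [length_encodeGraph]; exact hlt)]
  simp only [encodeGraph, encodeRel, List.getElem_ofFn, h1, h2]

theorem le_inputSize (G : SimpleGraph (Fin n)) (P : Finset (Fin n × Fin n)) (a b : ℕ) :
    n ≤ RAM.inputSize (encodeInput G P a b) := by
  have h1 : (encodeInput G P a b).length ≤ RAM.inputSize (encodeInput G P a b) := by
    rw [RAM.inputSize]
    refine le_trans (by simp) (List.length_le_sum_of_one_le _ ?_)
    simp
  rw [← encode_inputInst, Inst.length_encode, encode_inputInst] at h1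
  have := Nat.le_mul_self n
  omega

theorem polynomial_eval_mono (p : Polynomial ℕ) : Monotone fun k => p.eval k := by
  intro k l hkl
  simp only [Polynomial.eval_eq_sum_range]
  gcongr

theorem isPairwiseSpanner_of_valid {G H : SimpleGraph (Fin n)} {P : Finset (Fin n × Fin n)}
    {a b : ℕ} {ε : ℝ} (hHG : H ≤ G) (hv : Valid (inputInst G P a b) P G H) (hb : 0 < b)
    (hε : (a : ℝ) / b ≤ ε) : IsPairwiseSpanner G H P fun d => (1 + ε) * (d : ℝ) + 4 := by
  refine ⟨hHG, fun s t hst hr => ?_⟩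
  obtain ⟨h1, h2⟩ := hv s t hst (hd_lt_iff.2 hr)
  have hH := hd_lt_iff.1 h1
  refine ⟨hH, ?_⟩
  rw [hd_eq_dist hr, hd_eq_dist hH] at h2
  have hb' : (0 : ℝ) < b := by exact_mod_cast hb
  have h3 : (b : ℝ) * H.dist s t ≤ (a + b) * G.dist s t + 4 * b := by exact_mod_cast h2
  have h4 : (a : ℝ) ≤ ε * b := (div_le_iff₀ hb').1 hε
  refine le_of_mul_le_mul_left (h3.trans ?_) hb'
  have : (a : ℝ) * G.dist s t ≤ ε * b * G.dist s t := by gcongr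
  linarith

theorem le_two_mul_spannerBound {p : ℕ} {ε : ℝ} (hn : 2 ≤ n) (hp : 0 < p) (hε : 0 < ε)
    (hε1 : ε ≤ 1) : (n : ℝ) ≤ 2 * spannerBound n p ε := by
  have h1 : (1 : ℝ) ≤ (p : ℝ) ^ (1 / 4 : ℝ) :=
    Real.one_le_rpow (by exact_mod_cast hp) (by norm_num)
  have h2 : 1 / 2 ≤ √(Real.log n / ε) := by
    refine Real.le_sqrt_of_sq_le ?_
    rw [le_div_iff₀ hε]
    have h3 : Real.log 2 ≤ Real.log n := Real.log_le_log (by norm_num) (by exact_mod_cast hn)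
    have h4 := Real.log_two_gt_d9
    linarith
  have h3 : 1 * (1 / 2) ≤ (p : ℝ) ^ (1 / 4 : ℝ) * √(Real.log n / ε) := by gcongr
  have h4 : (n : ℝ) * (1 * (1 / 2)) ≤ n * ((p : ℝ) ^ (1 / 4 : ℝ) * √(Real.log n / ε)) := by gcongr
  rw [spannerBound, mul_assoc]
  linarith

theorem spannerBound_nonneg {p : ℕ} {ε : ℝ} : 0 ≤ spannerBound n p ε := by
  unfold spannerBound; positivity

theorem exists_output (G : SimpleGraph (Fin n)) (P : Finset (Fin n × Fin n)) {ε : ℝ} {a b : ℕ}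
    (hε : 0 < ε) (ha : 0 < a) (hb : 0 < b) (h2 : ε ≤ 2 * ((a : ℝ) / b)) :
    ∃ H ≤ G, (algorithm.program mBest).OutputsWithin (encodeInput G P a b) (encodeGraph H)
        ((algorithm.programTime mBest).eval n) ∧
      Valid (inputInst G P a b) P G H ∧
      (ecard H = 0 ∨ 2 ≤ n ∧ P.Nonempty ∧
        (ecard H : ℝ) ≤ 1400 * (n + spannerBound n P.card ε)) := by
  classical
  rcases Nat.eq_zero_or_pos n with rfl | hn
  · refine ⟨G, le_rfl, ?_, fun s => s.elim0, Or.inl ?_⟩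
    · rw [← encode_inputInst]
      exact Stmt.program_outputs _ _ _ _ (length_encodeGraph G) fun h => absurd h (lt_irrefl 0)
    · have := ecard_le_sq G
      omega
  have hG : Rep (inputInst G P a b).graph G.Adj := fun _ _ => indicatorMatrix_ne_zero
  have hP : ∀ s t, (inputInst G P a b).pairs s t ≠ 0 ↔ (s, t) ∈ P := fun _ _ =>
    indicatorMatrix_ne_zero (r := fun u v => (u, v) ∈ P)
  obtain ⟨H, hrun, hHG, hv, hle, hgr, hcand⟩ := run_algorithm (I := inputInst G P a b)
    (σ := fun _ _ _ => 0) (e := fun _ => ⟨0, hn⟩) hG hP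
  refine ⟨H, hHG, ?_, hv, ?_⟩
  · rw [← encode_inputInst]
    refine Stmt.program_outputs _ _ _ _ (length_encodeGraph H) fun _ i j => ?_
    rw [hrun, getD_encodeGraph]
  · rcases P.eq_empty_or_nonempty with rfl | hne
    · -- the graph without edges is one of the candidates
      obtain ⟨H₁, -, -, h3, -, h4⟩ := hgr ⟨0, hn⟩
      left
      have := h4 fun s t hst => absurd hst (Finset.notMem_empty _)
      rw [h3 rfl] at this
      simpa [ecard] using this
    rcases Nat.lt_or_ge n 2 with hn2 | hn2
    · left
      obtain rfl : n = 1 := by omega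
      have : H = ⊥ := by
        ext x y
        have : x = y := Subsingleton.elim _ _
        subst this
        simp
      simp [this, ecard]
    · exact Or.inr ⟨hn2, hne, ecard_le_spannerBound hn2 hne hε ha hb h2 hle hgr hcand⟩

end result

end MatProg

/-- One algorithm and one constant serve all graphs, all sets of pairs and all `ε > 0`.  The real
number `ε` is given to the algorithm through a rational number `a / b` with
`a / b ≤ ε ≤ 2 * (a / b)`; for rational `ε` one can take `a / b = ε`. -/
theorem theorem1 :
    ∃ (A : RAM.Prog) (p : Polynomial ℕ) (C : ℝ), 0 < C ∧
      ∀ (n : ℕ) (G : SimpleGraph (Fin n)) (P : Finset (Fin n × Fin n)) (ε : ℝ) (a b : ℕ),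
        0 < ε → 0 < a → 0 < b → (a : ℝ) / b ≤ ε → ε ≤ 2 * ((a : ℝ) / b) →
        ∃ H : SimpleGraph (Fin n),
          A.OutputsWithin (encodeInput G P a b) (encodeGraph H)
            (p.eval (RAM.inputSize (encodeInput G P a b))) ∧
          IsPairwiseSpanner G H P (fun d => (1 + ε) * (d : ℝ) + 4) ∧
          (H.edgeSet.ncard : ℝ) ≤ C * ((n : ℝ) + spannerBound n P.card ε) ∧
          (ε ≤ 1 → (H.edgeSet.ncard : ℝ) ≤ C * spannerBound n P.card ε) := by
  refine ⟨MatProg.algorithm.program MatProg.mBest, MatProg.algorithm.programTime MatProg.mBest,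
    4200, by norm_num, fun n G P ε a b hε ha hb h1 h2 => ?_⟩
  obtain ⟨H, hHG, ⟨t, ht, hout⟩, hv, hcard⟩ := MatProg.exists_output G P hε ha hb h2
  have hB := MatProg.spannerBound_nonneg (n := n) (p := P.card) (ε := ε)
  have hn0 : (0 : ℝ) ≤ n := n.cast_nonneg
  change (PairSpanner.ecard H = 0) ∨ 2 ≤ n ∧ P.Nonempty ∧
    (H.edgeSet.ncard : ℝ) ≤ 1400 * (n + spannerBound n P.card ε) at hcard
  refine ⟨H, ⟨t, ht.trans ?_, hout⟩, MatProg.isPairwiseSpanner_of_valid hHG hv hb h1, ?_,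
    fun hε1 => ?_⟩
  · exact MatProg.polynomial_eval_mono _ (MatProg.le_inputSize G P a b)
  · rcases hcard with h0 | ⟨-, -, h⟩
    · rw [show H.edgeSet.ncard = 0 from h0]; push_cast; positivity
    · linarith
  · rcases hcard with h0 | ⟨hn, hne, h⟩
    · rw [show H.edgeSet.ncard = 0 from h0]; push_cast; positivity
    · have := MatProg.le_two_mul_spannerBound hn hne.card_pos hε hε1
      linarith
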